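/- Setting. Fix $K>0$, $\sigma>0$ and $c_{\max}>1$. Admissible input distributions on $[0,1]$ are those with a piecewise continuous density $p$ with $0\le p\le c_{\max}$. For a memoryless channel $p_{Y|X}$ with input alphabet $[0,1]$, let $I(X;Y)$ be the mutual information of input $X\sim p$ and output $Y$, let $C_{\max}=\sup_p I(X;Y)$, and for an integrable function $\beta$ on $[0,1]$ and a rate $R\ge 0$ let $B_\beta(R)=\sup\{\mathbb E_p[\beta(X)] : p \text{ admissible},\ I(X;Y)\ge R\}$. A harvesting function $\beta:[0,1]\to[0,\infty)$ of total variation at most $K$ is observed through the $m$ noisy samples $Y_i=\beta\big(\tfrac{i}{m-1}\big)+Z_i$, $i=0,\dots,m-1$, where the $Z_i$ are i.i.d. $\mathcal N(0,\sigma^2)$. A reconstruction method assigns to the samples an integrable function $\widehat\beta_m$ on $[0,1]$ (depending measurably on the samples); it may depend on the channel and on $R,K,\sigma,c_{\max}$. Theorem. There are a channel $p_{Y|X}$ with finite capacity $C_{\max}$ and a constant $c>0$ such that, at rate $R=C_{\max}$, for all sufficiently large $m$ and every reconstruction method $\widehat\beta_m$, $$\sup_{\beta}\ \mathbb E\Big[\big|B_\beta(R)-B_{\widehat\beta_m}(R)\big|\Big]\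 \ge\ c\,m^{-1/3},$$ where the supremum is over all $\beta:[0,1]\to[0,\infty)$ of total variation at most $K$ and the expectation is over the noise. The channel and $c$ do not depend on $m$ or on the reconstruction method. -/

import Mathlib

open MeasureTheory ProbabilityTheory Filter Topology
open scoped ENNReal NNReal

namespace SIET

noncomputable section

/-- Admissible input densities on the input alphabet `[0,1]`: probability densities that are
bounded by `cmax` and piecewise continuous (finitely many discontinuities, with one-sided
limits everywhere). In particular there are no point masses. -/
structure IsAdmissible (cmax : ℝ) (p : unitInterval → ℝ) : Prop where
  nonneg : ∀ x, 0 ≤ p x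
  le_bound : ∀ x, p x ≤ cmax
  finite_discontinuities : {x | ¬ ContinuousAt p x}.Finite
  right_limit : ∀ x, ∃ l, Tendsto p (𝓝[>] x) (𝓝 l)
  left_limit : ∀ x, ∃ l, Tendsto p (𝓝[<] x) (𝓝 l)
  integral_eq_one : ∫ x, p x = 1

/-- The law of the channel input `X` with density `p`. -/
def inputLaw (p : unitInterval → ℝ) : Measure unitInterval :=
  volume.withDensity fun x => ENNReal.ofReal (p x)

variable {𝒴 : Type} [MeasurableSpace 𝒴]

/-- Mutual information `I(X;Y)` (in nats) when `X` has density `p` and `Y` is the output of the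
memoryless channel `W`: the relative entropy of the joint law of `(X, Y)` with respect to the
product of its marginals. -/
def mutualInfo (W : Kernel unitInterval 𝒴) (p : unitInterval → ℝ) : ℝ≥0∞ :=
  InformationTheory.klDiv (inputLaw p ⊗ₘ W) ((inputLaw p).prod (W ∘ₘ inputLaw p))

/-- The capacity `C_max` of the channel without energy constraint. -/
def capacity (W : Kernel unitInterval 𝒴) (cmax : ℝ) : ℝ≥0∞ :=
  ⨆ (p : unitInterval → ℝ) (_ : IsAdmissible cmax p), mutualInfo W p

/-- The energy-capacity function `B_β(R)`: the largest mean energy `E[β(X)]` over admissible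
inputs with `I(X;Y) ≥ R`. -/
def energyCapacity (W : Kernel unitInterval 𝒴) (cmax : ℝ) (R : ℝ≥0)
    (β : unitInterval → ℝ) : ℝ :=
  sSup {B : ℝ | ∃ p : unitInterval → ℝ,
    IsAdmissible cmax p ∧ (R : ℝ≥0∞) ≤ mutualInfo W p ∧ B = ∫ x, p x * β x}

/-- Functions on `[0,1]` of total variation at most `K`. -/
def BV (K : ℝ≥0) : Set (unitInterval → ℝ) :=
  {f | eVariationOn f Set.univ ≤ (K : ℝ≥0∞)}

/-- The `i`-th point `i / (m - 1)` of the regular grid with `m` points. -/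
def gridPoint (m : ℕ) (i : Fin m) : unitInterval :=
  ⟨(i : ℝ) / ((m : ℝ) - 1), by
    have h : (i : ℝ) + 1 ≤ m := by exact_mod_cast i.isLt
    have h0 : (0 : ℝ) ≤ (i : ℝ) := Nat.cast_nonneg _
    exact ⟨div_nonneg h0 (by linarith), div_le_one_of_le₀ (by linarith) (by linarith)⟩⟩

/-- The law of the noisy samples `β (i / (m - 1)) + Z i`, `i < m`, where the `Z i` are
independent centred Gaussians of standard deviation `σ`. -/
def sampleLaw (σ : ℝ≥0) (m : ℕ) (β : unitInterval → ℝ) : Measure (Fin m → ℝ) :=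
  Measure.pi fun i => gaussianReal (β (gridPoint m i)) (σ ^ 2)

/-- A reconstruction method from `m` samples: a rule `βhat` that turns the vector `y` of samples
into an integrable function `βhat y` on `[0,1]`, such that the energy `B_{βhat y}(R)` is a
measurable function of the samples (so that the expected energy loss makes sense). -/
structure IsReconstruction (W : Kernel unitInterval 𝒴) (cmax : ℝ) (R : ℝ≥0) (m : ℕ)
    (βhat : (Fin m → ℝ) → unitInterval → ℝ) : Prop where
  integrable : ∀ y, Integrable (βhat y) volume
  measurable_energy : Measurable fun y => energyCapacity W cmax R (βhat y)

/-- The expected energy loss `E |B_β(R) - B_{βhat}(R)|`; the expectation is over the noise. -/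
def expectedEnergyLoss (W : Kernel unitInterval 𝒴) (cmax : ℝ) (R σ : ℝ≥0) (m : ℕ)
    (β : unitInterval → ℝ) (βhat : (Fin m → ℝ) → unitInterval → ℝ) : ℝ≥0∞ :=
  ∫⁻ y, ENNReal.ofReal |energyCapacity W cmax R β - energyCapacity W cmax R (βhat y)|
    ∂(sampleLaw σ m β)

/-- The worst-case expected energy loss of `βhat` over a class `F` of harvesting functions. -/
def worstCaseEnergyLoss (W : Kernel unitInterval 𝒴) (cmax : ℝ) (R σ : ℝ≥0) (m : ℕ)
    (F : Set (unitInterval → ℝ)) (βhat : (Fin m → ℝ) → unitInterval → ℝ) : ℝ≥0∞ :=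
  ⨆ β ∈ F, expectedEnergyLoss W cmax R σ m β βhat

end

end SIET

/-! The channel. If every law `W x` has the same divergence D from a reference law Q, the
compensation identity `klDiv_compProd_prod` gives I(X;Y) = D - KL(output law, Q). So I ≤ D, with
equality exactly when the output law is Q. `circleChannel` has this property: its output is an index
j together with a point of a circle, whose density 1 + g_j cos + b_j sin is a rotated cardioid, and
the output law is Q exactly when all g_j and b_j have mean zero. Rate `C_max` therefore imposes
countably many linear constraints on the input density, and the g_j may be any measurable functions
bounded by 1 (`exists_channel_of_constraints`). The companion b_j is forced by g_j² + b_j² = 1;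
giving it opposite signs on the two halves of [0,1] makes its constraint automatic for densities
pulled back along `fold`.

The constraints. Level k has N = 2^k Haar functions on [1/2,1) and a tiny hidden interval near 0,
cut into one cell per word of a code in {±1}^N. The constraints fix the mass of the hidden interval
and tie the mean of the i-th Haar function to the mean of the i-th letter over that interval. The
vector of Haar means is thus confined to an affine image of the convex hull of the code, and
concentrating the hidden mass on one cell attains the vertex of that word. For a harvesting function
a + δ Σ θ_i h_i, the energy capacity is then, up to a term linear in θ, the largest correlation of θ
with a code word. It differs by δε/32 between code words and words nearly orthogonal to the code
(`energyCapacity_separation`).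

The statistics. Membership in the code cannot be detected from the samples. Take M pairs of words
from a nearly orthogonal family, with M exponential in N, and let a sign decide which word of each
pair enters the code. For suitable signs, the cross terms in the squared L² norm of the difference
of the two mixture likelihoods do not add up (`exists_signs_sum_integral_sq_le`), so the mixtures
are close whenever mδ²/σ² ≤ N/64 (`exists_words`). Two close mixtures with separated values force a
risk of a quarter of the gap (`le_of_close_mixtures`).

The rate. Variation at most K forces δ of order 1/N. The closeness condition then admits m of order
N³ = 8^k, and the gap is of order 1/N, that is m^(-1/3). The channel may not depend on m, so it
carries all levels at once, and the code of level k serves every m ≤ α 8^k. -/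

namespace SIET

/-! ### Divergence and the compensation identity -/

section KullbackLeibler

open InformationTheory

variable {α β : Type*} [MeasurableSpace α] [MeasurableSpace β]

/-- Data processing applies in both directions because the swap is invertible. -/
theorem klDiv_map_swap (μ ν : Measure (α × β)) [IsFiniteMeasure μ] [IsFiniteMeasure ν] :
    klDiv (μ.map Prod.swap) (ν.map Prod.swap) = klDiv μ ν := by
  refine le_antisymm (klDiv_map_le _ _ measurable_swap) ?_
  have h := klDiv_map_le (μ.map Prod.swap) (ν.map Prod.swap)
    (g := (Prod.swap : β × α → α × β)) measurable_swap
  rwa [Measure.map_map measurable_swap measurable_swap,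
    Measure.map_map measurable_swap measurable_swap, Prod.swap_swap_eq, Measure.map_id,
    Measure.map_id] at h

/-- The compensation identity for the mutual information. -/
theorem klDiv_compProd_prod [StandardBorelSpace α] [Nonempty α] (μ : Measure α)
    [IsProbabilityMeasure μ] (W : Kernel α β) [IsMarkovKernel W] (ν : Measure β)
    [IsProbabilityMeasure ν] :
    klDiv (μ ⊗ₘ W) (μ.prod ν) =
      klDiv (W ∘ₘ μ) ν + klDiv (μ ⊗ₘ W) (μ.prod (W ∘ₘ μ)) := by
  -- After the swap the output comes first. Disintegrating the joint law by the posterior turns the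
  -- identity into the chain rule, with the constant kernel μ as second conditional law.
  rw [← klDiv_map_swap (μ ⊗ₘ W) (μ.prod ν), ← klDiv_map_swap (μ ⊗ₘ W) (μ.prod (W ∘ₘ μ)),
    Measure.prod_swap, Measure.prod_swap, ← compProd_posterior_eq_map_swap,
    ← Measure.compProd_const, ← Measure.compProd_const]
  exact klDiv_compProd_eq_add _ _ _ _

/-- The divergence of a measure given by a density. -/
theorem klDiv_withDensity (ν : Measure α) [IsFiniteMeasure ν] (f : α → ℝ≥0∞) (hf : Measurable f)
    [IsFiniteMeasure (ν.withDensity f)] :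
    klDiv (ν.withDensity f) ν = ∫⁻ x, ENNReal.ofReal (klFun (f x).toReal) ∂ν := by
  rw [klDiv_eq_lintegral_klFun_of_ac (withDensity_absolutelyContinuous _ _)]
  refine lintegral_congr_ae ?_
  filter_upwards [ν.rnDeriv_withDensity hf] with x hx
  rw [hx]

end KullbackLeibler

/-! ### A channel whose output laws are equidistant from a reference law -/

section CircleChannel

/-- The reference law of the output: a full-support law on `ℕ` times the uniform law on `(0,1]`. -/
noncomputable def refLaw : Measure (ℕ × ℝ) :=
  (poissonMeasure 1).prod (volume.restrict (Set.Ioc 0 1))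

instance : IsProbabilityMeasure (volume.restrict (Set.Ioc (0 : ℝ) 1)) :=
  ⟨by simp⟩

instance : IsProbabilityMeasure refLaw := by unfold refLaw; infer_instance

variable {α : Type*}

/-- The density `1 + g cos + b sin` of the output given the input. -/
noncomputable def circleDensity (g b : ℕ → α → ℝ) (x : α) (z : ℕ × ℝ) : ℝ :=
  1 + g z.1 x * Real.cos (2 * Real.pi * z.2) + b z.1 x * Real.sin (2 * Real.pi * z.2)

/-- The same density with values in `ℝ≥0∞`. -/
noncomputable def circleDensityENN (g b : ℕ → α → ℝ) (x : α) (z : ℕ × ℝ) : ℝ≥0∞ :=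
  ENNReal.ofReal (circleDensity g b x z)

variable [MeasurableSpace α]

/-- The channel with this density. -/
noncomputable def circleChannel (g b : ℕ → α → ℝ) : Kernel α (ℕ × ℝ) :=
  (Kernel.const α refLaw).withDensity (circleDensityENN g b)

variable {g b : ℕ → α → ℝ}

theorem measurable_circleDensity (hg : ∀ j, Measurable (g j)) (hb : ∀ j, Measurable (b j)) :
    Measurable (Function.uncurry (circleDensity g b)) := by
  have hg' : Measurable (fun q : α × (ℕ × ℝ) => g q.2.1 q.1) := by
    have : Measurable (fun q : α × ℕ => g q.2 q.1) :=
      measurable_from_prod_countable_left hg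
    exact this.comp (by fun_prop : Measurable fun q : α × (ℕ × ℝ) => (q.1, q.2.1))
  have hb' : Measurable (fun q : α × (ℕ × ℝ) => b q.2.1 q.1) := by
    have : Measurable (fun q : α × ℕ => b q.2 q.1) :=
      measurable_from_prod_countable_left hb
    exact this.comp (by fun_prop : Measurable fun q : α × (ℕ × ℝ) => (q.1, q.2.1))
  change Measurable fun q : α × (ℕ × ℝ) => 1 + g q.2.1 q.1 * Real.cos (2 * Real.pi * q.2.2) +
    b q.2.1 q.1 * Real.sin (2 * Real.pi * q.2.2)
  exact (measurable_const.add (hg'.mul (by fun_prop))).add (hb'.mul (by fun_prop))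

theorem measurable_circleDensityENN (hg : ∀ j, Measurable (g j)) (hb : ∀ j, Measurable (b j)) :
    Measurable (Function.uncurry (circleDensityENN g b)) :=
  (measurable_circleDensity hg hb).ennreal_ofReal

omit [MeasurableSpace α] in
-- The point (g, b) lies on the unit circle, so its argument is the phase of a rotation.
theorem exists_circleDensity_eq_cos (h1 : ∀ j x, g j x ^ 2 + b j x ^ 2 = 1) (j : ℕ) (x : α) :
    ∃ s : ℝ, ∀ t, circleDensity g b x (j, t) = 1 + Real.cos (2 * Real.pi * (t - s)) := by
  set z : ℂ := ⟨g j x, b j x⟩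
  have hz : ‖z‖ = 1 := by
    rw [Complex.norm_def, Complex.normSq_mk, Real.sqrt_eq_one]
    nlinarith [h1 j x]
  refine ⟨z.arg / (2 * Real.pi), fun t => ?_⟩
  have hc := Complex.norm_mul_cos_arg z
  have hs := Complex.norm_mul_sin_arg z
  rw [hz, one_mul] at hc hs
  rw [show 2 * Real.pi * (t - z.arg / (2 * Real.pi)) = 2 * Real.pi * t - z.arg by
    field_simp, Real.cos_sub, hc, hs]
  simp only [circleDensity, z]
  ring

/-- The divergence of `W x` from the reference law, the same for all `x`. -/
noncomputable def circleDivergence : ℝ :=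
  ∫ t in (0 : ℝ)..1, InformationTheory.klFun (1 + Real.cos (2 * Real.pi * t))

theorem periodic_cos_two_pi (F : ℝ → ℝ) :
    Function.Periodic (fun t => F (Real.cos (2 * Real.pi * t))) 1 := by
  intro t
  simp only
  rw [mul_add, mul_one, Real.cos_add_two_pi]

theorem intervalIntegral_cos_shift (F : ℝ → ℝ) (s : ℝ) :
    ∫ t in (0 : ℝ)..1, F (Real.cos (2 * Real.pi * (t - s))) =
      ∫ t in (0 : ℝ)..1, F (Real.cos (2 * Real.pi * t)) := by
  rw [intervalIntegral.integral_comp_sub_right (fun t => F (Real.cos (2 * Real.pi * t))) s,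
    show (1 : ℝ) - s = (0 - s) + 1 by ring,
    (periodic_cos_two_pi F).intervalIntegral_add_eq (0 - s) 0, zero_add]

omit [MeasurableSpace α] in
theorem circleDensity_nonneg (h1 : ∀ j x, g j x ^ 2 + b j x ^ 2 = 1) (x : α) (z : ℕ × ℝ) :
    0 ≤ circleDensity g b x z := by
  obtain ⟨s, hs⟩ := exists_circleDensity_eq_cos h1 z.1 x
  have := hs z.2
  rw [this]
  linarith [Real.neg_one_le_cos (2 * Real.pi * (z.2 - s))]

theorem lintegral_Ioc_cos (F : ℝ → ℝ) (hF : Continuous F)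
    (hF0 : ∀ u ∈ Set.Icc (-1 : ℝ) 1, 0 ≤ F u) (s : ℝ) :
    ∫⁻ t in Set.Ioc (0 : ℝ) 1, ENNReal.ofReal (F (Real.cos (2 * Real.pi * (t - s)))) =
      ENNReal.ofReal (∫ t in (0 : ℝ)..1, F (Real.cos (2 * Real.pi * t))) := by
  rw [← intervalIntegral_cos_shift F s, intervalIntegral.integral_of_le zero_le_one,
    ofReal_integral_eq_lintegral_ofReal]
  · exact (Continuous.integrableOn_Icc (by fun_prop)).mono_set Set.Ioc_subset_Icc_self
  · exact ae_of_all _ fun t => hF0 _ ⟨Real.neg_one_le_cos _, Real.cos_le_one _⟩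

/-- On each circle the density is a rotation of 1 + cos, and the uniform law is rotation invariant.
Hence the integral depends neither on the input nor on the index; this serves both for total mass 1
and for the constant divergence. -/
theorem lintegral_circleDensity_comp (h1 : ∀ j x, g j x ^ 2 + b j x ^ 2 = 1)
    (hg : ∀ j, Measurable (g j)) (hb : ∀ j, Measurable (b j))
    (F : ℝ → ℝ) (hF : Continuous F) (hF0 : ∀ u, 0 ≤ u → 0 ≤ F u) (x : α) :
    ∫⁻ z, ENNReal.ofReal (F (circleDensity g b x z)) ∂refLaw =
      ENNReal.ofReal (∫ t in (0 : ℝ)..1, F (1 + Real.cos (2 * Real.pi * t))) := by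
  have hm : Measurable fun z => ENNReal.ofReal (F (circleDensity g b x z)) :=
    (hF.measurable.comp ((measurable_circleDensity hg hb).comp measurable_prodMk_left)).ennreal_ofReal
  rw [refLaw, lintegral_prod _ hm.aemeasurable]
  have : ∀ j, ∫⁻ t in Set.Ioc (0 : ℝ) 1, ENNReal.ofReal (F (circleDensity g b x (j, t))) =
      ENNReal.ofReal (∫ t in (0 : ℝ)..1, F (1 + Real.cos (2 * Real.pi * t))) := by
    intro j
    obtain ⟨s, hs⟩ := exists_circleDensity_eq_cos h1 j x
    simp_rw [hs]
    exact lintegral_Ioc_cos (fun u => F (1 + u)) (by fun_prop)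
      (fun u hu => hF0 _ (by linarith [hu.1])) s
  simp_rw [this]
  simp

theorem integral_cos_two_pi : ∫ t in (0 : ℝ)..1, (1 + Real.cos (2 * Real.pi * t)) = 1 := by
  rw [intervalIntegral.integral_add (by simp) (Continuous.intervalIntegrable (by fun_prop) _ _),
    intervalIntegral.integral_comp_mul_left (fun t => Real.cos t) (by positivity)]
  simp

theorem isMarkovKernel_circleChannel (h1 : ∀ j x, g j x ^ 2 + b j x ^ 2 = 1)
    (hg : ∀ j, Measurable (g j)) (hb : ∀ j, Measurable (b j)) :
    IsMarkovKernel (circleChannel g b) := by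
  refine ⟨fun x => ⟨?_⟩⟩
  rw [circleChannel, Kernel.withDensity_apply' _ (measurable_circleDensityENN hg hb)]
  simp only [Measure.restrict_univ, Kernel.const_apply, circleDensityENN]
  rw [lintegral_circleDensity_comp h1 hg hb (fun u => u) continuous_id (fun u hu => hu),
    integral_cos_two_pi, ENNReal.ofReal_one]

theorem compProd_circleChannel (h1 : ∀ j x, g j x ^ 2 + b j x ^ 2 = 1)
    (hg : ∀ j, Measurable (g j)) (hb : ∀ j, Measurable (b j)) (μ : Measure α) [SFinite μ] :
    μ ⊗ₘ circleChannel g b =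
      (μ.prod refLaw).withDensity (Function.uncurry (circleDensityENN g b)) := by
  have := isMarkovKernel_circleChannel h1 hg hb
  have h2 : IsSFiniteKernel ((Kernel.const α refLaw).withDensity (circleDensityENN g b)) := by
    change IsSFiniteKernel (circleChannel g b)
    infer_instance
  rw [circleChannel, Measure.compProd_withDensity (measurable_circleDensityENN hg hb),
    Measure.compProd_const]
  rfl

theorem klDiv_circleChannel (h1 : ∀ j x, g j x ^ 2 + b j x ^ 2 = 1)
    (hg : ∀ j, Measurable (g j)) (hb : ∀ j, Measurable (b j)) (μ : Measure α)
    [IsProbabilityMeasure μ] :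
    InformationTheory.klDiv (μ ⊗ₘ circleChannel g b) (μ.prod refLaw) =
      ENNReal.ofReal circleDivergence := by
  have := isMarkovKernel_circleChannel h1 hg hb
  have hfin : IsFiniteMeasure
      ((μ.prod refLaw).withDensity (Function.uncurry (circleDensityENN g b))) := by
    rw [← compProd_circleChannel h1 hg hb]; infer_instance
  have hmeas := measurable_circleDensityENN hg hb
  rw [compProd_circleChannel h1 hg hb, klDiv_withDensity _ _ hmeas,
    lintegral_prod _ (by
      exact ((InformationTheory.measurable_klFun.comp hmeas.ennreal_toReal).ennreal_ofReal).aemeasurable)]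
  have : ∀ x, ∫⁻ z, ENNReal.ofReal (InformationTheory.klFun
      (Function.uncurry (circleDensityENN g b) (x, z)).toReal) ∂refLaw =
      ENNReal.ofReal circleDivergence := by
    intro x
    simp only [Function.uncurry, circleDensityENN]
    simp_rw [ENNReal.toReal_ofReal (circleDensity_nonneg h1 x _)]
    exact lintegral_circleDensity_comp h1 hg hb _ InformationTheory.continuous_klFun
      (fun u hu => InformationTheory.klFun_nonneg hu) x
  simp_rw [this]
  simp

theorem integrable_of_unit (h1 : ∀ j x, g j x ^ 2 + b j x ^ 2 = 1)
    (hg : ∀ j, Measurable (g j)) (μ : Measure α) [IsFiniteMeasure μ] (j : ℕ) :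
    Integrable (g j) μ := by
  refine Integrable.of_bound (hg j).aestronglyMeasurable 1 (ae_of_all _ fun x => ?_)
  rw [Real.norm_eq_abs, ← sq_le_one_iff_abs_le_one]
  nlinarith [h1 j x, sq_nonneg (b j x)]

/-- The density is affine in (g, b), so averaging over the input only sees the means of g and b. -/
theorem comp_circleChannel (h1 : ∀ j x, g j x ^ 2 + b j x ^ 2 = 1)
    (hg : ∀ j, Measurable (g j)) (hb : ∀ j, Measurable (b j)) (μ : Measure α)
    [IsProbabilityMeasure μ] :
    circleChannel g b ∘ₘ μ = refLaw.withDensity fun z => ENNReal.ofReal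
      (1 + (∫ x, g z.1 x ∂μ) * Real.cos (2 * Real.pi * z.2) +
        (∫ x, b z.1 x ∂μ) * Real.sin (2 * Real.pi * z.2)) := by
  have := isMarkovKernel_circleChannel h1 hg hb
  ext s hs
  rw [Measure.bind_apply hs (Kernel.aemeasurable _), withDensity_apply _ hs]
  have hmeas := measurable_circleDensityENN hg hb
  simp_rw [circleChannel, Kernel.withDensity_apply' _ hmeas, Kernel.const_apply]
  rw [lintegral_lintegral_swap hmeas.aemeasurable]
  refine lintegral_congr fun z => ?_
  have hi : Integrable (fun x => circleDensity g b x z) μ := by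
    unfold circleDensity
    exact ((integrable_const _).add ((integrable_of_unit h1 hg μ _).mul_const _)).add
      ((integrable_of_unit (g := b) (b := g) (fun j x => by rw [add_comm]; exact h1 j x)
        hb μ _).mul_const _)
  simp only [circleDensityENN]
  rw [← ofReal_integral_eq_lintegral_ofReal hi (ae_of_all _ fun x => circleDensity_nonneg h1 x z)]
  unfold circleDensity
  rw [integral_add, integral_add, integral_mul_const, integral_mul_const]
  · simp
  · exact integrable_const _
  · exact (integrable_of_unit h1 hg μ _).mul_const _
  · exact (integrable_const _).add ((integrable_of_unit h1 hg μ _).mul_const _)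
  · exact (integrable_of_unit (g := b) (b := g) (fun j x => by rw [add_comm]; exact h1 j x)
        hb μ _).mul_const _

theorem eq_zero_of_ae_cos_sin (A B : ℝ)
    (h : ∀ᵐ t ∂(volume.restrict (Set.Ioc (0 : ℝ) 1)),
      A * Real.cos (2 * Real.pi * t) + B * Real.sin (2 * Real.pi * t) = 0) : A = 0 ∧ B = 0 := by
  have key : ∀ u ∈ Set.Icc (0 : ℝ) 1,
      ∫ t in (0 : ℝ)..u, (A * Real.cos (2 * Real.pi * t) + B * Real.sin (2 * Real.pi * t)) = 0 := by
    intro u hu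
    rw [intervalIntegral.integral_of_le hu.1]
    refine integral_eq_zero_of_ae ?_
    exact ae_restrict_of_ae_restrict_of_subset (Set.Ioc_subset_Ioc_right hu.2) h
  have val : ∀ u, ∫ t in (0 : ℝ)..u,
      (A * Real.cos (2 * Real.pi * t) + B * Real.sin (2 * Real.pi * t)) =
      (2 * Real.pi)⁻¹ * (A * Real.sin (2 * Real.pi * u) + B * (1 - Real.cos (2 * Real.pi * u))) := by
    intro u
    rw [intervalIntegral.integral_add (Continuous.intervalIntegrable (by fun_prop) _ _)
      (Continuous.intervalIntegrable (by fun_prop) _ _),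
      intervalIntegral.integral_const_mul, intervalIntegral.integral_const_mul,
      intervalIntegral.integral_comp_mul_left (fun t => Real.cos t) (by positivity),
      intervalIntegral.integral_comp_mul_left (fun t => Real.sin t) (by positivity)]
    simp
    ring
  have hpi := Real.pi_pos
  -- The half period isolates B, since sin π = 0; the quarter period then gives A + B = 0.
  have e1 := key (1 / 2) (by norm_num)
  have e2 := key (1 / 4) (by norm_num)
  rw [val, show 2 * Real.pi * (1 / 2) = Real.pi by ring, Real.sin_pi, Real.cos_pi] at e1
  rw [val, show 2 * Real.pi * (1 / 4) = Real.pi / 2 by ring, Real.sin_pi_div_two,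
    Real.cos_pi_div_two] at e2
  have hne : (2 * Real.pi)⁻¹ ≠ 0 := by positivity
  have e1' := (mul_eq_zero.1 e1).resolve_left hne
  have e2' := (mul_eq_zero.1 e2).resolve_left hne
  constructor <;> linarith

/-- The law of the index charges every j, so equality of densities almost everywhere can be read off
on each circle separately, where cos and sin are linearly independent. -/
theorem comp_circleChannel_eq_refLaw_iff (h1 : ∀ j x, g j x ^ 2 + b j x ^ 2 = 1)
    (hg : ∀ j, Measurable (g j)) (hb : ∀ j, Measurable (b j)) (μ : Measure α)
    [IsProbabilityMeasure μ] :
    circleChannel g b ∘ₘ μ = refLaw ↔ ∀ j, ∫ x, g j x ∂μ = 0 ∧ ∫ x, b j x ∂μ = 0 := by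
  rw [comp_circleChannel h1 hg hb]
  constructor
  · intro h j
    have hmeas : Measurable fun z : ℕ × ℝ => ENNReal.ofReal
      (1 + (∫ x, g z.1 x ∂μ) * Real.cos (2 * Real.pi * z.2) +
        (∫ x, b z.1 x ∂μ) * Real.sin (2 * Real.pi * z.2)) := by
      have hG : Measurable fun j => ∫ x, g j x ∂μ := measurable_of_countable _
      have hB : Measurable fun j => ∫ x, b j x ∂μ := measurable_of_countable _
      have hG' : Measurable fun z : ℕ × ℝ => ∫ x, g z.1 x ∂μ := hG.comp measurable_fst
      have hB' : Measurable fun z : ℕ × ℝ => ∫ x, b z.1 x ∂μ := hB.comp measurable_fst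
      exact ((measurable_const.add (hG'.mul (by fun_prop))).add
        (hB'.mul (by fun_prop))).ennreal_ofReal
    conv_rhs at h => rw [← withDensity_one (μ := refLaw)]
    replace h := (withDensity_eq_iff_of_sigmaFinite hmeas.aemeasurable aemeasurable_one).1 h
    have h2 := Measure.ae_ae_of_ae_prod h
    have h3 := (ae_iff_of_countable.1 h2) j (by
      have := poissonMeasure_real_singleton_pos (r := 1) j one_pos
      intro h0
      rw [measureReal_def, h0] at this
      simp at this)
    refine eq_zero_of_ae_cos_sin _ _ ?_
    filter_upwards [h3] with t ht
    simp only [ENNReal.ofReal_eq_one] at ht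
    linarith
  · intro h
    simp_rw [fun j => (h j).1, fun j => (h j).2]
    simp

/-- The mutual information across the circle channel is at most the common divergence, with
equality exactly when `g` and `b` have mean zero under the input law. -/
theorem klDiv_circleChannel_le [StandardBorelSpace α] [Nonempty α]
    (h1 : ∀ j x, g j x ^ 2 + b j x ^ 2 = 1)
    (hg : ∀ j, Measurable (g j)) (hb : ∀ j, Measurable (b j)) (μ : Measure α)
    [IsProbabilityMeasure μ] :
    InformationTheory.klDiv (μ ⊗ₘ circleChannel g b) (μ.prod (circleChannel g b ∘ₘ μ)) ≤
      ENNReal.ofReal circleDivergence ∧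
    (ENNReal.ofReal circleDivergence ≤
      InformationTheory.klDiv (μ ⊗ₘ circleChannel g b) (μ.prod (circleChannel g b ∘ₘ μ)) ↔
      ∀ j, ∫ x, g j x ∂μ = 0 ∧ ∫ x, b j x ∂μ = 0) := by
  have := isMarkovKernel_circleChannel h1 hg hb
  have key := klDiv_compProd_prod μ (circleChannel g b) refLaw
  rw [klDiv_circleChannel h1 hg hb] at key
  rw [← comp_circleChannel_eq_refLaw_iff h1 hg hb, ← InformationTheory.klDiv_eq_zero_iff]
  refine ⟨key ▸ le_add_self, fun h => ?_, fun h => ?_⟩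
  · rw [key] at h
    have hne : InformationTheory.klDiv (μ ⊗ₘ circleChannel g b)
        (μ.prod (circleChannel g b ∘ₘ μ)) ≠ ∞ :=
      ne_top_of_le_ne_top ENNReal.ofReal_ne_top (key ▸ le_add_self)
    by_contra hpos
    exact absurd h (not_le.2 (by
      conv_lhs => rw [← zero_add (InformationTheory.klDiv _ (μ.prod _))]
      exact ENNReal.add_lt_add_right hne (pos_iff_ne_zero.2 hpos)))
  · rw [key, h, zero_add]

end CircleChannel

/-! ### Admissible densities as probability laws -/

section Admissible

variable {cmax : ℝ} {p : unitInterval → ℝ}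

theorem IsAdmissible.aestronglyMeasurable (hp : IsAdmissible cmax p) :
    AEStronglyMeasurable p volume := by
  set F := {x | ¬ ContinuousAt p x}
  have hF : F.Finite := hp.finite_discontinuities
  have h1 : AEStronglyMeasurable p (volume.restrict Fᶜ) := by
    refine ContinuousOn.aestronglyMeasurable (fun x hx => ?_) hF.measurableSet.compl
    have : ContinuousAt p x := by simpa [F] using hx
    exact this.continuousWithinAt
  rwa [Measure.restrict_eq_self_of_ae_mem] at h1
  exact hF.countable.ae_notMem volume

theorem IsAdmissible.integrable (hp : IsAdmissible cmax p) : Integrable p volume :=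
  Integrable.of_bound hp.aestronglyMeasurable cmax
    (ae_of_all _ fun x => by rw [Real.norm_of_nonneg (hp.nonneg x)]; exact hp.le_bound x)

theorem IsAdmissible.integrable_mul (hp : IsAdmissible cmax p) {f : unitInterval → ℝ}
    (hf : Measurable f) {C : ℝ} (hC : ∀ x, |f x| ≤ C) : Integrable (fun x => p x * f x) volume :=
  hp.integrable.mul_bdd hf.aestronglyMeasurable (ae_of_all _ hC)

theorem IsAdmissible.isProbabilityMeasure (hp : IsAdmissible cmax p) :
    IsProbabilityMeasure (inputLaw p) := by
  refine ⟨?_⟩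
  rw [inputLaw, withDensity_apply _ MeasurableSet.univ, Measure.restrict_univ,
    ← ofReal_integral_eq_lintegral_ofReal hp.integrable (ae_of_all _ hp.nonneg),
    hp.integral_eq_one, ENNReal.ofReal_one]

theorem IsAdmissible.integral_inputLaw (hp : IsAdmissible cmax p) (f : unitInterval → ℝ) :
    ∫ x, f x ∂(inputLaw p) = ∫ x, p x * f x := by
  rw [inputLaw, integral_withDensity_eq_integral_toReal_smul₀
    hp.aestronglyMeasurable.aemeasurable.ennreal_ofReal (ae_of_all _ fun _ => ENNReal.ofReal_lt_top)]
  simp [ENNReal.toReal_ofReal (hp.nonneg _)]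

end Admissible

/-- For every sequence of constraints `∫ p g_j = 0` with `|g_j| ≤ 1` there is a channel of finite
capacity for which the inputs of maximal mutual information are those satisfying the constraints,
together with the constraints for the compensators `τ √(1 - g_j²)`. -/
theorem exists_channel_of_constraints (g : ℕ → unitInterval → ℝ) (hg : ∀ j, Measurable (g j))
    (hg1 : ∀ j x, |g j x| ≤ 1) (τ : unitInterval → ℝ) (hτ : Measurable τ) (hτ1 : ∀ x, τ x ^ 2 = 1) :
    ∃ (W : Kernel unitInterval (ℕ × ℝ)) (_ : IsMarkovKernel W) (R : ℝ≥0),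
      ∀ (cmax : ℝ) (p : unitInterval → ℝ), IsAdmissible cmax p →
        mutualInfo W p ≤ R ∧
        ((R : ℝ≥0∞) ≤ mutualInfo W p ↔ ∀ j, ∫ x, p x * g j x = 0 ∧
          ∫ x, p x * (τ x * √(1 - g j x ^ 2)) = 0) := by
  set b : ℕ → unitInterval → ℝ := fun j x => τ x * √(1 - g j x ^ 2)
  have hb : ∀ j, Measurable (b j) := fun j =>
    hτ.mul (Real.continuous_sqrt.measurable.comp (measurable_const.sub ((hg j).pow_const 2)))
  have h1 : ∀ j x, g j x ^ 2 + b j x ^ 2 = 1 := by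
    intro j x
    have h0 : 0 ≤ 1 - g j x ^ 2 := by
      have := (sq_le_one_iff_abs_le_one (g j x)).2 (hg1 j x)
      linarith
    simp only [b]
    rw [mul_pow, hτ1, Real.sq_sqrt h0]
    ring
  refine ⟨circleChannel g b, isMarkovKernel_circleChannel h1 hg hb, circleDivergence.toNNReal, ?_⟩
  intro cmax p hp
  have := hp.isProbabilityMeasure
  have key := klDiv_circleChannel_le h1 hg hb (inputLaw p)
  simp_rw [hp.integral_inputLaw] at key
  exact key

/-! ### Likelihood ratios of shifted Gaussian samples -/

section GaussianShift

theorem pi_withDensity {ι : Type*} [Fintype ι] {Ω : ι → Type*} [∀ i, MeasurableSpace (Ω i)]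
    (μ : ∀ i, Measure (Ω i)) [∀ i, IsProbabilityMeasure (μ i)] (f : ∀ i, Ω i → ℝ≥0∞)
    (hf : ∀ i, Measurable (f i)) [∀ i, SigmaFinite ((μ i).withDensity (f i))] :
    Measure.pi (fun i => (μ i).withDensity (f i)) =
      (Measure.pi μ).withDensity fun ω => ∏ i, f i (ω i) := by
  refine (Measure.pi_eq fun s hs => ?_)
  rw [withDensity_apply _ (MeasurableSet.univ_pi hs),
    ← lintegral_indicator (MeasurableSet.univ_pi hs)]
  have h1 : ∀ ω, (Set.univ.pi s).indicator (fun ω => ∏ i, f i (ω i)) ω =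
      ∏ i, (s i).indicator (f i) (ω i) := by
    intro ω
    by_cases h : ω ∈ Set.univ.pi s
    · rw [Set.indicator_of_mem h]
      exact Finset.prod_congr rfl fun i _ => (Set.indicator_of_mem (h i trivial) _).symm
    · rw [Set.indicator_of_notMem h]
      simp only [Set.mem_pi, Set.mem_univ, true_imp_iff, not_forall] at h
      obtain ⟨i, hi⟩ := h
      exact (Finset.prod_eq_zero (Finset.mem_univ i) (Set.indicator_of_notMem hi _)).symm
  simp_rw [h1]
  have hm : ∀ i, Measurable ((s i).indicator (f i)) := fun i => (hf i).indicator (hs i)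
  rw [lintegral_prod_eq_prod_lintegral_of_indepFun Finset.univ
    (fun i (ω : ∀ i, Ω i) => (s i).indicator (f i) (ω i)) (iIndepFun_pi fun i => (hm i).aemeasurable)
    (fun i => (hm i).comp (measurable_pi_apply i))]
  refine Finset.prod_congr rfl fun i _ => ?_
  rw [(measurePreserving_eval μ i).lintegral_comp (hm i), lintegral_indicator (hs i),
    withDensity_apply _ (hs i)]

theorem gaussianReal_add_eq_withDensity (a s : ℝ) {v : ℝ≥0} (hv : v ≠ 0) :
    gaussianReal (a + s) v = (gaussianReal a v).withDensity
      fun y => ENNReal.ofReal (Real.exp ((s * (y - a) - s ^ 2 / 2) / v)) := by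
  have hm : Measurable fun y : ℝ =>
      ENNReal.ofReal (Real.exp ((s * (y - a) - s ^ 2 / 2) / v)) := by fun_prop
  rw [gaussianReal_of_var_ne_zero _ hv, gaussianReal_of_var_ne_zero _ hv,
    ← withDensity_mul _ (measurable_gaussianPDF a v) hm]
  congr 1
  ext y
  simp only [Pi.mul_apply, gaussianPDF]
  rw [← ENNReal.ofReal_mul (gaussianPDFReal_nonneg a v y)]
  congr 1
  have hv' : (v : ℝ) ≠ 0 := by exact_mod_cast hv
  simp only [gaussianPDFReal]
  rw [mul_assoc (√_)⁻¹, ← Real.exp_add]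
  congr 2
  field_simp
  ring

variable {m : ℕ}

/-- The likelihood ratio of the samples with mean `a + s i` against those with mean `a`. -/
noncomputable def shiftLikelihood (v : ℝ≥0) (a : ℝ) (s : Fin m → ℝ) (y : Fin m → ℝ) : ℝ :=
  ∏ i, Real.exp ((s i * (y i - a) - s i ^ 2 / 2) / v)

theorem continuous_shiftLikelihood (v : ℝ≥0) (a : ℝ) (s : Fin m → ℝ) :
    Continuous (shiftLikelihood v a s) := by
  unfold shiftLikelihood
  fun_prop

theorem shiftLikelihood_pos (v : ℝ≥0) (a : ℝ) (s y : Fin m → ℝ) : 0 < shiftLikelihood v a s y :=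
  Finset.prod_pos fun _ _ => Real.exp_pos _

theorem pi_gaussianReal_shift {v : ℝ≥0} (hv : v ≠ 0) (a : ℝ) (s : Fin m → ℝ) :
    Measure.pi (fun i => gaussianReal (a + s i) v) =
      (Measure.pi fun _ : Fin m => gaussianReal a v).withDensity
        fun y => ENNReal.ofReal (shiftLikelihood v a s y) := by
  have h := fun i => gaussianReal_add_eq_withDensity a (s i) hv
  have hsf : ∀ i, SigmaFinite ((gaussianReal a v).withDensity
      fun y => ENNReal.ofReal (Real.exp ((s i * (y - a) - s i ^ 2 / 2) / v))) := by
    intro i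
    rw [← h]
    infer_instance
  simp_rw [h]
  rw [pi_withDensity _ _ (fun i => by fun_prop)]
  congr 1
  ext y
  rw [shiftLikelihood, ENNReal.ofReal_prod_of_nonneg fun _ _ => (Real.exp_pos _).le]

theorem lintegral_shiftLikelihood {v : ℝ≥0} (hv : v ≠ 0) (a : ℝ) (s : Fin m → ℝ) :
    ∫⁻ y, ENNReal.ofReal (shiftLikelihood v a s y)
      ∂(Measure.pi fun _ : Fin m => gaussianReal a v) = 1 := by
  rw [← setLIntegral_univ, ← withDensity_apply _ MeasurableSet.univ, ← pi_gaussianReal_shift hv]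
  exact measure_univ

theorem integrable_shiftLikelihood {v : ℝ≥0} (hv : v ≠ 0) (a : ℝ) (s : Fin m → ℝ) :
    Integrable (shiftLikelihood v a s) (Measure.pi fun _ : Fin m => gaussianReal a v) := by
  refine (lintegral_ofReal_ne_top_iff_integrable
    (continuous_shiftLikelihood v a s).aestronglyMeasurable
    (ae_of_all _ fun y => (shiftLikelihood_pos v a s y).le)).1 ?_
  rw [lintegral_shiftLikelihood hv]
  exact ENNReal.one_ne_top

theorem integral_shiftLikelihood {v : ℝ≥0} (hv : v ≠ 0) (a : ℝ) (s : Fin m → ℝ) :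
    ∫ y, shiftLikelihood v a s y ∂(Measure.pi fun _ : Fin m => gaussianReal a v) = 1 := by
  rw [integral_eq_lintegral_of_nonneg_ae (ae_of_all _ fun y => (shiftLikelihood_pos v a s y).le)
    (continuous_shiftLikelihood v a s).aestronglyMeasurable, lintegral_shiftLikelihood hv]
  simp

/-- Squaring doubles the shift and leaves a constant factor. As every likelihood has mean 1, this
factor is the second moment. -/
theorem shiftLikelihood_sq (v : ℝ≥0) (a : ℝ) (s y : Fin m → ℝ) :
    shiftLikelihood v a s y ^ 2 =
      Real.exp ((∑ i, s i ^ 2) / v) * shiftLikelihood v a (fun i => 2 * s i) y := by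
  unfold shiftLikelihood
  rw [Finset.sum_div, Real.exp_sum, ← Finset.prod_pow, ← Finset.prod_mul_distrib]
  refine Finset.prod_congr rfl fun i _ => ?_
  rw [← Real.exp_add, ← Real.exp_nat_mul]
  congr 1
  push_cast
  ring

theorem memLp_shiftLikelihood {v : ℝ≥0} (hv : v ≠ 0) (a : ℝ) (s : Fin m → ℝ) :
    MemLp (shiftLikelihood v a s) 2 (Measure.pi fun _ : Fin m => gaussianReal a v) := by
  rw [memLp_two_iff_integrable_sq (continuous_shiftLikelihood v a s).aestronglyMeasurable]
  simp_rw [shiftLikelihood_sq]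
  exact (integrable_shiftLikelihood hv a _).const_mul _

theorem integral_shiftLikelihood_sq {v : ℝ≥0} (hv : v ≠ 0) (a : ℝ) (s : Fin m → ℝ) :
    ∫ y, shiftLikelihood v a s y ^ 2 ∂(Measure.pi fun _ : Fin m => gaussianReal a v) =
      Real.exp ((∑ i, s i ^ 2) / v) := by
  simp_rw [shiftLikelihood_sq]
  rw [integral_const_mul, integral_shiftLikelihood hv, mul_one]

end GaussianShift

/-! ### Derandomised choice of signs -/

section SignChoice

/-- The sign `±1` of a Boolean. -/
def boolSign (b : Bool) : ℝ := if b then 1 else -1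

theorem boolSign_sq (b : Bool) : boolSign b ^ 2 = 1 := by cases b <;> simp [boolSign]

theorem integral_add_sq_add_integral_sub_sq {Ω : Type*} [MeasurableSpace Ω] {μ : Measure Ω}
    {f g : Ω → ℝ} (hf : MemLp f 2 μ) (hg : MemLp g 2 μ) :
    ∫ ω, (f ω + g ω) ^ 2 ∂μ + ∫ ω, (f ω - g ω) ^ 2 ∂μ =
      2 * ∫ ω, f ω ^ 2 ∂μ + 2 * ∫ ω, g ω ^ 2 ∂μ := by
  have h1 : Integrable (fun ω => (f ω + g ω) ^ 2) μ := (hf.add hg).integrable_sq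
  have h2 : Integrable (fun ω => (f ω - g ω) ^ 2) μ := (hf.sub hg).integrable_sq
  rw [← integral_add h1 h2, ← integral_const_mul, ← integral_const_mul,
    ← integral_add (hf.integrable_sq.const_mul 2) (hg.integrable_sq.const_mul 2)]
  congr 1
  ext ω
  ring

/-- Signs can be chosen so that the squared `L²` norm of a signed sum does not exceed the sum of the
squared norms, simultaneously summed over finitely many probability spaces. -/
theorem exists_signs_sum_integral_sq_le {ι κ : Type*} [DecidableEq ι] (s : Finset ι) (T : Finset κ)
    {Ω : κ → Type*} [∀ k, MeasurableSpace (Ω k)] (μ : ∀ k, Measure (Ω k)) (f : ι → ∀ k, Ω k → ℝ)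
    (hf : ∀ i k, MemLp (f i k) 2 (μ k)) :
    ∃ e : ι → Bool, ∑ k ∈ T, ∫ ω, (∑ i ∈ s, boolSign (e i) * f i k ω) ^ 2 ∂(μ k) ≤
      ∑ i ∈ s, ∑ k ∈ T, ∫ ω, f i k ω ^ 2 ∂(μ k) := by
  induction s using Finset.induction_on with
  | empty => exact ⟨fun _ => true, by simp⟩
  | insert a s ha ih =>
    obtain ⟨e, he⟩ := ih
    set F : ∀ k, Ω k → ℝ := fun k ω => ∑ i ∈ s, boolSign (e i) * f i k ω
    have hF : ∀ k, MemLp (F k) 2 (μ k) := fun k =>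
      memLp_finsetSum s fun i _ => (hf i k).const_mul _
    have hsum : ∀ (b : Bool) k ω, ∑ i ∈ insert a s,
        boolSign (Function.update e a b i) * f i k ω = boolSign b * f a k ω + F k ω := by
      intro b k ω
      rw [Finset.sum_insert ha, Function.update_self]
      congr 1
      refine Finset.sum_congr rfl fun i hi => ?_
      rw [Function.update_of_ne (by rintro rfl; exact ha hi)]
    -- By the parallelogram identity the two signs for the new term average to the desired bound, so
    -- one of them meets it. Summing over `T` first makes the same sign work for all spaces
    -- together.
    have hpar : ∑ k ∈ T, ∫ ω, (F k ω + f a k ω) ^ 2 ∂(μ k) +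
        ∑ k ∈ T, ∫ ω, (F k ω - f a k ω) ^ 2 ∂(μ k) =
        2 * ∑ k ∈ T, ∫ ω, F k ω ^ 2 ∂(μ k) + 2 * ∑ k ∈ T, ∫ ω, f a k ω ^ 2 ∂(μ k) := by
      rw [← Finset.sum_add_distrib, Finset.mul_sum, Finset.mul_sum, ← Finset.sum_add_distrib]
      exact Finset.sum_congr rfl fun k _ => integral_add_sq_add_integral_sub_sq (hF k) (hf a k)
    rw [Finset.sum_insert ha]
    by_cases hle : ∑ k ∈ T, ∫ ω, (F k ω + f a k ω) ^ 2 ∂(μ k) ≤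
        ∑ k ∈ T, ∫ ω, F k ω ^ 2 ∂(μ k) + ∑ k ∈ T, ∫ ω, f a k ω ^ 2 ∂(μ k)
    · refine ⟨Function.update e a true, ?_⟩
      simp_rw [hsum]
      simp only [boolSign, if_true, one_mul]
      simp_rw [add_comm (f a _ _) (F _ _)]
      linarith
    · refine ⟨Function.update e a false, ?_⟩
      simp_rw [hsum]
      simp only [boolSign, Bool.false_eq_true, if_false, neg_one_mul]
      simp_rw [neg_add_eq_sub]
      linarith

end SignChoice

/-! ### Nearly orthogonal codes of exponential size -/

section Codes

variable {N : ℕ}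

/-- This is the unnormalised moment generating function of the correlation of a uniformly random
word with `c`; it factors over the coordinates. -/
theorem sum_exp_correlation (c : Fin N → Bool) (t : ℝ) :
    ∑ x : Fin N → Bool, Real.exp (t * ∑ i, boolSign (x i) * boolSign (c i)) =
      (2 * Real.cosh t) ^ N := by
  have h1 : ∀ x : Fin N → Bool, Real.exp (t * ∑ i, boolSign (x i) * boolSign (c i)) =
      ∏ i, Real.exp (t * (boolSign (x i) * boolSign (c i))) := by
    intro x
    rw [Finset.mul_sum, Real.exp_sum]
  simp_rw [h1]
  have h2 := Finset.prod_univ_sum (fun _ : Fin N => (Finset.univ : Finset Bool))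
    (fun i b => Real.exp (t * (boolSign b * boolSign (c i))))
  rw [Fintype.piFinset_univ] at h2
  rw [← h2]
  have h3 : ∀ i, ∑ b : Bool, Real.exp (t * (boolSign b * boolSign (c i))) = 2 * Real.cosh t := by
    intro i
    rw [Real.cosh_eq, Fintype.sum_bool]
    cases c i <;> simp [boolSign] <;> ring
  simp_rw [h3]
  simp

/-- Chernoff's bound at parameter 1/4: the threshold contributes exp(N/16), and cosh(1/4)^N ≤
exp(N/32). -/
theorem card_correlated_le (c : Fin N → Bool) :
    ((Finset.univ.filter fun x : Fin N → Bool =>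
      (N : ℝ) / 4 < |∑ i, boolSign (x i) * boolSign (c i)|).card : ℝ) * Real.exp (N / 32) ≤
      2 * 2 ^ N := by
  obtain ⟨u, hu⟩ : ∃ u : (Fin N → Bool) → ℝ, ∀ x, u x = ∑ i, boolSign (x i) * boolSign (c i) :=
    ⟨_, fun _ => rfl⟩
  simp_rw [← hu]
  obtain ⟨S, hS⟩ : ∃ S : Finset (Fin N → Bool),
      S = Finset.univ.filter fun x => (N : ℝ) / 4 < |u x| := ⟨_, rfl⟩
  rw [← hS]
  have h1 : (S.card : ℝ) * Real.exp (N / 16) ≤ 2 * (2 * Real.cosh (1 / 4)) ^ N := by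
    have e1 : ∑ x ∈ S, Real.exp ((N : ℝ) / 16) ≤
        ∑ x ∈ S, (Real.exp (1 / 4 * u x) + Real.exp (-(1 / 4) * u x)) := by
      refine Finset.sum_le_sum fun x hx => ?_
      rw [hS, Finset.mem_filter] at hx
      rcases lt_abs.1 hx.2 with h | h
      · exact le_add_of_le_of_nonneg (Real.exp_le_exp.2 (by linarith)) (Real.exp_pos _).le
      · exact le_add_of_nonneg_of_le (Real.exp_pos _).le (Real.exp_le_exp.2 (by linarith))
    have e2 : ∑ x ∈ S, (Real.exp (1 / 4 * u x) + Real.exp (-(1 / 4) * u x)) ≤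
        ∑ x, (Real.exp (1 / 4 * u x) + Real.exp (-(1 / 4) * u x)) :=
      Finset.sum_le_univ_sum_of_nonneg fun x => add_nonneg (Real.exp_pos _).le (Real.exp_pos _).le
    have e3 : ∑ x, (Real.exp (1 / 4 * u x) + Real.exp (-(1 / 4) * u x)) =
        2 * (2 * Real.cosh (1 / 4)) ^ N := by
      simp_rw [hu]
      rw [Finset.sum_add_distrib, sum_exp_correlation, sum_exp_correlation, Real.cosh_neg]
      ring
    rw [Finset.sum_const, nsmul_eq_mul] at e1
    linarith
  have h2 : (2 * Real.cosh (1 / 4)) ^ N ≤ 2 ^ N * Real.exp (N / 32) := by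
    rw [mul_pow]
    refine mul_le_mul_of_nonneg_left ?_ (by positivity)
    calc Real.cosh (1 / 4) ^ N ≤ Real.exp ((1 / 4) ^ 2 / 2) ^ N :=
          pow_le_pow_left₀ (Real.cosh_pos _).le (Real.cosh_le_exp_half_sq _) _
      _ = Real.exp (N / 32) := by
        rw [← Real.exp_nat_mul]
        congr 1
        ring
  have h3 : Real.exp ((N : ℝ) / 16) = Real.exp (N / 32) * Real.exp (N / 32) := by
    rw [← Real.exp_add]
    congr 1
    ring
  rw [h3, ← mul_assoc] at h1
  have h4 : (S.card : ℝ) * Real.exp (N / 32) * Real.exp (N / 32) ≤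
      2 * 2 ^ N * Real.exp (N / 32) := by linarith
  exact le_of_mul_le_mul_right h4 (Real.exp_pos _)

theorem sum_boolSign_sq (c : Fin N → Bool) : ∑ i, boolSign (c i) * boolSign (c i) = N := by
  simp_rw [← sq, boolSign_sq]
  simp

/-- Greedy construction of a large code of nearly uncorrelated sign vectors. -/
theorem exists_code_finset (hN : 0 < N) (n : ℕ) (hn : 2 * (n : ℝ) < Real.exp (N / 32)) :
    ∃ S : Finset (Fin N → Bool), S.card = n ∧ ∀ x ∈ S, ∀ y ∈ S, x ≠ y →
      |∑ i, boolSign (x i) * boolSign (y i)| ≤ (N : ℝ) / 4 := by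
  induction n with
  | zero => exact ⟨∅, by simp⟩
  | succ n ih =>
    push_cast at hn
    obtain ⟨S, hS, hS2⟩ := ih (by linarith)
    obtain ⟨x, hx⟩ : ∃ x : Fin N → Bool, ∀ c ∈ S,
        |∑ i, boolSign (x i) * boolSign (c i)| ≤ (N : ℝ) / 4 := by
      -- If no word can be added, the sets of words too correlated with some member of `S` cover the
      -- cube. By the Chernoff count this needs 2n ≥ exp(N/32).
      by_contra! hcon
      have hcov : (Finset.univ : Finset (Fin N → Bool)) ⊆ S.biUnion fun c =>
          Finset.univ.filter fun x : Fin N → Bool =>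
            (N : ℝ) / 4 < |∑ i, boolSign (x i) * boolSign (c i)| := by
        intro x _
        obtain ⟨c, hc, h⟩ := hcon x
        exact Finset.mem_biUnion.2 ⟨c, hc, by simpa using h⟩
      have hcard := (Finset.card_le_card hcov).trans Finset.card_biUnion_le
      have h5 : (2 : ℝ) ^ N ≤ ∑ c ∈ S, ((Finset.univ.filter fun x : Fin N → Bool =>
            (N : ℝ) / 4 < |∑ i, boolSign (x i) * boolSign (c i)|).card : ℝ) := by
        have : Fintype.card (Fin N → Bool) = 2 ^ N := by simp
        rw [Finset.card_univ, this] at hcard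
        exact_mod_cast hcard
      have h6 : (2 : ℝ) ^ N * Real.exp (N / 32) ≤ n * (2 * 2 ^ N) := by
        calc (2 : ℝ) ^ N * Real.exp (N / 32) ≤ _ :=
              mul_le_mul_of_nonneg_right h5 (Real.exp_pos _).le
          _ ≤ ∑ c ∈ S, (2 * 2 ^ N : ℝ) := by
            rw [Finset.sum_mul]
            exact Finset.sum_le_sum fun c _ => card_correlated_le c
          _ = n * (2 * 2 ^ N) := by rw [Finset.sum_const, hS, nsmul_eq_mul]
      have h7 : (0 : ℝ) < 2 ^ N := by positivity
      nlinarith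
    have hxS : x ∉ S := by
      intro h
      have := hx x h
      rw [sum_boolSign_sq, abs_of_nonneg (by positivity)] at this
      have : (0 : ℝ) < N := by exact_mod_cast hN
      linarith
    refine ⟨insert x S, by rw [Finset.card_insert_of_notMem hxS, hS], ?_⟩
    intro y hy z hz hyz
    rcases Finset.mem_insert.1 hy with rfl | hy <;> rcases Finset.mem_insert.1 hz with rfl | hz
    · exact absurd rfl hyz
    · exact hx z hz
    · have := hx y ‹y ∈ S›
      simp_rw [mul_comm (boolSign (z _))] at this
      exact this
    · exact hS2 y hy z hz hyz

theorem exists_code {ι : Type*} [Fintype ι] (hN : 0 < N)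
    (hn : 2 * (Fintype.card ι : ℝ) < Real.exp (N / 32)) :
    ∃ c : ι → Fin N → Bool, ∀ x y, x ≠ y →
      |∑ i, boolSign (c x i) * boolSign (c y i)| ≤ (N : ℝ) / 4 := by
  obtain ⟨S, hS, h⟩ := exists_code_finset hN _ hn
  have e : ι ≃ S := Fintype.equivOfCardEq (by rw [Fintype.card_coe, hS])
  exact ⟨fun x => e x, fun x y hxy => h _ (e x).2 _ (e y).2
    (fun heq => hxy (e.injective (Subtype.ext heq)))⟩

end Codes

/-! ### Risk lower bound from two close mixtures -/

section Hypotheses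

/-- Lower bound for the worst-case risk of an estimator `T` between two families of hypotheses whose
uniform mixtures are close. -/
theorem le_of_close_mixtures {Ω : Type*} [MeasurableSpace Ω] (P : Measure Ω)
    [IsProbabilityMeasure P] {M : ℕ} (hM : 0 < M) (f h : Fin M → Ω → ℝ)
    (hf0 : ∀ l ω, 0 ≤ f l ω) (hh0 : ∀ l ω, 0 ≤ h l ω)
    (hfm : ∀ l, Measurable (f l)) (hhm : ∀ l, Measurable (h l))
    (hf : ∀ l, MemLp (f l) 2 P) (hh : ∀ l, MemLp (h l) 2 P) (hh1 : ∀ l, ∫ ω, h l ω ∂P = 1)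
    (hclose : ∫ ω, (∑ l, (f l ω - h l ω)) ^ 2 ∂P ≤ (M : ℝ) ^ 2 / 4)
    (T : Ω → ℝ) (hT : Measurable T) (a d : Fin M → ℝ) (v₁ v₂ : ℝ) (hv : v₂ ≤ v₁)
    (ha : ∀ l, v₁ ≤ a l) (hd : ∀ l, d l ≤ v₂) (S : ℝ≥0∞)
    (hSf : ∀ l, ∫⁻ ω, ENNReal.ofReal |a l - T ω|
      ∂(P.withDensity fun ω => ENNReal.ofReal (f l ω)) ≤ S)
    (hSh : ∀ l, ∫⁻ ω, ENNReal.ofReal |d l - T ω|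
      ∂(P.withDensity fun ω => ENNReal.ofReal (h l ω)) ≤ S) :
    ENNReal.ofReal ((v₁ - v₂) / 4) ≤ S := by
  rcases eq_or_ne S ∞ with rfl | hS
  · exact le_top
  set Δ := v₁ - v₂
  have hΔ : 0 ≤ Δ := sub_nonneg.2 hv
  -- A soft test: it equals Δ when T ≤ v₂ and 0 when T ≥ v₁. Thus φ is below the loss under each `f
  -- l`, and Δ - φ is below the loss under each `h l`.
  set φ : Ω → ℝ := fun ω => min Δ (max 0 (v₁ - T ω))
  have hφm : Measurable φ := by fun_prop
  have hφ0 : ∀ ω, 0 ≤ φ ω := fun ω => le_min hΔ (le_max_left _ _)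
  have hφΔ : ∀ ω, φ ω ≤ Δ := fun ω => min_le_left _ _
  have hφa : ∀ l ω, φ ω ≤ |a l - T ω| := by
    intro l ω
    refine (min_le_right _ _).trans (max_le (abs_nonneg _) ?_)
    exact (by linarith [ha l] : v₁ - T ω ≤ a l - T ω).trans (le_abs_self _)
  have hφd : ∀ l ω, Δ - φ ω ≤ |d l - T ω| := by
    intro l ω
    rw [sub_le_comm]
    refine le_min (sub_le_self _ (abs_nonneg _)) (le_max_of_le_right ?_)
    have := neg_abs_le (d l - T ω)
    linarith [hd l, (rfl : Δ = v₁ - v₂)]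
  have hint : ∀ g : Ω → ℝ, MemLp g 2 P → ∀ u : Ω → ℝ, Measurable u → (∀ ω, 0 ≤ u ω) →
      (∀ ω, u ω ≤ Δ) → Integrable (fun ω => g ω * u ω) P := fun g hg u hu h0 h1 =>
    (hg.integrable (by norm_num)).mul_bdd (c := Δ) hu.aestronglyMeasurable
      (ae_of_all _ fun ω => by rw [Real.norm_of_nonneg (h0 ω)]; exact h1 ω)
  have hbound : ∀ g : Ω → ℝ, Measurable g → MemLp g 2 P → (∀ ω, 0 ≤ g ω) → ∀ u : Ω → ℝ,
      Measurable u → (∀ ω, 0 ≤ u ω) → (∀ ω, u ω ≤ Δ) → ∀ w : Ω → ℝ, Measurable w →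
      (∀ ω, u ω ≤ w ω) →
      ∫⁻ ω, ENNReal.ofReal (w ω) ∂(P.withDensity fun ω => ENNReal.ofReal (g ω)) ≤ S →
      ∫ ω, g ω * u ω ∂P ≤ S.toReal := by
    intro g hgm hg hg0 u hum hu0 huΔ w hwm huw hle
    rw [lintegral_withDensity_eq_lintegral_mul _ hgm.ennreal_ofReal hwm.ennreal_ofReal] at hle
    rw [integral_eq_lintegral_of_nonneg_ae (ae_of_all _ fun ω => mul_nonneg (hg0 ω) (hu0 ω))
      (hint g hg u hum hu0 huΔ).aestronglyMeasurable]
    refine ENNReal.toReal_mono hS (le_trans (lintegral_mono fun ω => ?_) hle)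
    rw [Pi.mul_apply, ← ENNReal.ofReal_mul (hg0 ω)]
    exact ENNReal.ofReal_le_ofReal (mul_le_mul_of_nonneg_left (huw ω) (hg0 ω))
  have h1 : ∀ l, ∫ ω, f l ω * φ ω ∂P ≤ S.toReal := fun l =>
    hbound _ (hfm l) (hf l) (hf0 l) φ hφm hφ0 hφΔ _ (by fun_prop) (hφa l) (hSf l)
  have h2 : ∀ l, ∫ ω, h l ω * (Δ - φ ω) ∂P ≤ S.toReal := fun l =>
    hbound _ (hhm l) (hh l) (hh0 l) (fun ω => Δ - φ ω) (by fun_prop)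
      (fun ω => sub_nonneg.2 (hφΔ ω)) (fun ω => sub_le_self _ (hφ0 ω)) _ (by fun_prop)
      (hφd l) (hSh l)
  have hq : MemLp (fun ω => ∑ l, (f l ω - h l ω)) 2 P :=
    memLp_finsetSum _ fun l _ => (hf l).sub (hh l)
  have h3 : ∀ l, ∫ ω, f l ω * φ ω ∂P + ∫ ω, h l ω * (Δ - φ ω) ∂P =
      Δ + ∫ ω, (f l ω - h l ω) * φ ω ∂P := by
    intro l
    have e1 := hint _ (hf l) φ hφm hφ0 hφΔ
    have e2 := hint _ (hh l) φ hφm hφ0 hφΔ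
    have e3 : Integrable (fun ω => h l ω * Δ) P := ((hh l).integrable (by norm_num)).mul_const _
    simp_rw [mul_sub, sub_mul]
    rw [integral_sub e3 e2, integral_sub e1 e2, integral_mul_const, hh1]
    ring
  have h4 : ∑ l, ∫ ω, (f l ω - h l ω) * φ ω ∂P = ∫ ω, (∑ l, (f l ω - h l ω)) * φ ω ∂P := by
    simp_rw [Finset.sum_mul]
    exact (integral_finsetSum _ fun l _ => hint _ ((hf l).sub (hh l)) φ hφm hφ0 hφΔ).symm
  have hMpos : (0 : ℝ) < M := by exact_mod_cast hM
  have h5 : -(M * Δ / 2) ≤ ∫ ω, (∑ l, (f l ω - h l ω)) * φ ω ∂P := by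
    have hsq := hq.integrable_sq
    have hlow : ∀ ω, -(Δ * ((∑ l, (f l ω - h l ω)) ^ 2 / M + M / 4)) ≤
        (∑ l, (f l ω - h l ω)) * φ ω := by
      intro ω
      set q := ∑ l, (f l ω - h l ω)
      -- The arithmetic-geometric mean inequality bounds |q| by quantities whose integrals are each
      -- at most M/4. Hence the L¹ distance of the summed densities is at most M/2, which leaves
      -- half of MΔ.
      have hqabs : |q| ≤ q ^ 2 / M + M / 4 := by
        rw [div_add' _ _ _ hMpos.ne', le_div_iff₀ hMpos]
        nlinarith [sq_nonneg (|q| - M / 2), sq_abs q]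
      have : |q * φ ω| ≤ |q| * Δ := by
        rw [abs_mul, abs_of_nonneg (hφ0 ω)]
        exact mul_le_mul_of_nonneg_left (hφΔ ω) (abs_nonneg _)
      have h8 := neg_abs_le (q * φ ω)
      nlinarith
    have hI : Integrable (fun ω => -(Δ * ((∑ l, (f l ω - h l ω)) ^ 2 / M + M / 4))) P :=
      (((hsq.div_const _).add (integrable_const _)).const_mul _).neg
    have h9 := integral_mono hI (hint _ hq φ hφm hφ0 hφΔ) hlow
    rw [integral_neg, integral_const_mul, integral_add (hsq.div_const _) (integrable_const _),
      integral_div, integral_const] at h9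
    simp only [probReal_univ, smul_eq_mul, one_mul] at h9
    refine le_trans (neg_le_neg ?_) h9
    have : (∫ ω, (∑ l, (f l ω - h l ω)) ^ 2 ∂P) / M ≤ M / 4 := by
      rw [div_le_iff₀ hMpos]
      linarith
    nlinarith
  have h6 : M * Δ + ∫ ω, (∑ l, (f l ω - h l ω)) * φ ω ∂P ≤ 2 * M * S.toReal := by
    rw [← h4]
    have : (M : ℝ) * Δ = ∑ _l : Fin M, Δ := by simp
    rw [this, ← Finset.sum_add_distrib]
    calc ∑ l, (Δ + ∫ ω, (f l ω - h l ω) * φ ω ∂P)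
        = ∑ l, (∫ ω, f l ω * φ ω ∂P + ∫ ω, h l ω * (Δ - φ ω) ∂P) :=
          Finset.sum_congr rfl fun l _ => (h3 l).symm
      _ ≤ ∑ _l : Fin M, (S.toReal + S.toReal) :=
          Finset.sum_le_sum fun l _ => add_le_add (h1 l) (h2 l)
      _ = 2 * M * S.toReal := by simp; ring
  refine ENNReal.ofReal_le_of_le_toReal ?_
  nlinarith

end Hypotheses

/-! ### Piecewise continuous functions and admissibility -/

section PiecewiseContinuous

/-- Real functions with finitely many discontinuities and one-sided limits everywhere. -/
structure IsPiecewiseContinuous (f : ℝ → ℝ) : Prop where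
  finite : {x | ¬ ContinuousAt f x}.Finite
  right_limit : ∀ x, ∃ l, Tendsto f (𝓝[>] x) (𝓝 l)
  left_limit : ∀ x, ∃ l, Tendsto f (𝓝[<] x) (𝓝 l)

namespace IsPiecewiseContinuous

variable {f g : ℝ → ℝ}

theorem of_continuous (hf : Continuous f) : IsPiecewiseContinuous f where
  finite := by simp [hf.continuousAt]
  right_limit x := ⟨f x, hf.continuousAt.tendsto.mono_left nhdsWithin_le_nhds⟩
  left_limit x := ⟨f x, hf.continuousAt.tendsto.mono_left nhdsWithin_le_nhds⟩

theorem add (hf : IsPiecewiseContinuous f) (hg : IsPiecewiseContinuous g) :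
    IsPiecewiseContinuous fun x => f x + g x where
  finite := (hf.finite.union hg.finite).subset fun x hx => by
    by_contra h
    simp only [Set.mem_union, Set.mem_ofPred_eq, not_or, not_not] at h
    exact hx (h.1.add h.2)
  right_limit x := by
    obtain ⟨a, ha⟩ := hf.right_limit x
    obtain ⟨b, hb⟩ := hg.right_limit x
    exact ⟨a + b, ha.add hb⟩
  left_limit x := by
    obtain ⟨a, ha⟩ := hf.left_limit x
    obtain ⟨b, hb⟩ := hg.left_limit x
    exact ⟨a + b, ha.add hb⟩

theorem const_mul (hf : IsPiecewiseContinuous f) (c : ℝ) :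
    IsPiecewiseContinuous fun x => c * f x where
  finite := hf.finite.subset fun x hx h => hx (continuousAt_const.mul h)
  right_limit x := by
    obtain ⟨a, ha⟩ := hf.right_limit x
    exact ⟨c * a, ha.const_mul c⟩
  left_limit x := by
    obtain ⟨a, ha⟩ := hf.left_limit x
    exact ⟨c * a, ha.const_mul c⟩

theorem sub (hf : IsPiecewiseContinuous f) (hg : IsPiecewiseContinuous g) :
    IsPiecewiseContinuous fun x => f x - g x := by
  have := hf.add (hg.const_mul (-1))
  simpa [sub_eq_add_neg] using this

theorem sum {ι : Type*} (s : Finset ι) {F : ι → ℝ → ℝ}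
    (h : ∀ i ∈ s, IsPiecewiseContinuous (F i)) :
    IsPiecewiseContinuous fun x => ∑ i ∈ s, F i x := by
  classical
  induction s using Finset.induction_on with
  | empty => simpa using of_continuous continuous_const
  | insert a s ha ih =>
    simp_rw [Finset.sum_insert ha]
    exact (h a (Finset.mem_insert_self _ _)).add
      (ih fun i hi => h i (Finset.mem_insert_of_mem hi))

theorem indicator_Ici (hf : Continuous f) (s : ℝ) :
    IsPiecewiseContinuous ((Set.Ici s).indicator f) := by
  have hlt : ∀ x, x < s → ∀ᶠ y in 𝓝 x, 0 = (Set.Ici s).indicator f y := fun x hx => by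
    filter_upwards [Iio_mem_nhds hx] with y hy
    rw [Set.indicator_of_notMem (by simpa using hy)]
  have hgt : ∀ x, s < x → ∀ᶠ y in 𝓝 x, f y = (Set.Ici s).indicator f y := fun x hx => by
    filter_upwards [Ioi_mem_nhds hx] with y hy
    rw [Set.indicator_of_mem (Set.mem_Ici.2 (le_of_lt (Set.mem_Ioi.1 hy)))]
  have hfx : ∀ x, Tendsto f (𝓝 x) (𝓝 (f x)) := fun x => hf.continuousAt
  refine ⟨(Set.finite_singleton s).subset fun x hx => ?_, fun x => ?_, fun x => ?_⟩
  · by_contra h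
    rcases lt_or_gt_of_ne (show x ≠ s from h) with h1 | h1
    · exact hx (ContinuousAt.congr continuousAt_const (hlt x h1))
    · exact hx (ContinuousAt.congr hf.continuousAt (hgt x h1))
  · rcases lt_or_ge x s with h1 | h1
    · exact ⟨0, (tendsto_const_nhds.congr' (hlt x h1)).mono_left nhdsWithin_le_nhds⟩
    · refine ⟨f x, ((hfx x).mono_left nhdsWithin_le_nhds).congr' ?_⟩
      filter_upwards [self_mem_nhdsWithin] with y hy
      rw [Set.indicator_of_mem (show y ∈ Set.Ici s from h1.trans (le_of_lt hy))]
  · rcases le_or_gt x s with h1 | h1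
    · refine ⟨0, tendsto_const_nhds.congr' ?_⟩
      filter_upwards [self_mem_nhdsWithin] with y hy
      rw [Set.indicator_of_notMem (by simpa using lt_of_lt_of_le hy h1)]
    · exact ⟨f x, ((hfx x).congr' (hgt x h1)).mono_left nhdsWithin_le_nhds⟩

theorem indicator_Ico (hf : Continuous f) {s t : ℝ} (hst : s ≤ t) :
    IsPiecewiseContinuous ((Set.Ico s t).indicator f) := by
  convert (indicator_Ici hf s).sub (indicator_Ici hf t) using 1
  ext x
  rw [← Set.Ici_sdiff_Ici, Set.indicator_sdiff (Set.Ici_subset_Ici.2 hst)]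
  rfl

theorem comp_two_mul_add (hf : IsPiecewiseContinuous f) (c : ℝ) :
    IsPiecewiseContinuous fun x => f (2 * x + c) := by
  have hc : Continuous fun x : ℝ => 2 * x + c := by fun_prop
  have hmono : StrictMono fun x : ℝ => 2 * x + c := fun x y h => by simp only; linarith
  refine ⟨(hf.finite.preimage hmono.injective.injOn).subset fun x hx h => hx ?_,
    fun x => ?_, fun x => ?_⟩
  · exact ContinuousAt.comp (f := fun x : ℝ => 2 * x + c) h hc.continuousAt
  · obtain ⟨l, hl⟩ := hf.right_limit (2 * x + c)
    refine ⟨l, hl.comp (tendsto_nhdsWithin_iff.2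
      ⟨hc.continuousAt.tendsto.mono_left nhdsWithin_le_nhds, ?_⟩)⟩
    filter_upwards [self_mem_nhdsWithin] with y hy using hmono hy
  · obtain ⟨l, hl⟩ := hf.left_limit (2 * x + c)
    refine ⟨l, hl.comp (tendsto_nhdsWithin_iff.2
      ⟨hc.continuousAt.tendsto.mono_left nhdsWithin_le_nhds, ?_⟩)⟩
    filter_upwards [self_mem_nhdsWithin] with y hy using hmono hy

end IsPiecewiseContinuous

theorem isAdmissible_restrict {f : ℝ → ℝ} (hf : IsPiecewiseContinuous f) {cmax : ℝ}
    (h0 : ∀ x : unitInterval, 0 ≤ f x) (h1 : ∀ x : unitInterval, f x ≤ cmax)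
    (hint : ∫ x : unitInterval, f x = 1) : IsAdmissible cmax fun x => f x where
  nonneg := h0
  le_bound := h1
  finite_discontinuities := (hf.finite.preimage Subtype.val_injective.injOn).subset
    fun x hx h => hx (ContinuousAt.comp (f := fun x : unitInterval => (x : ℝ)) h
      continuous_subtype_val.continuousAt)
  right_limit x := by
    obtain ⟨l, hl⟩ := hf.right_limit x
    refine ⟨l, hl.comp (tendsto_nhdsWithin_iff.2
      ⟨continuous_subtype_val.continuousAt.tendsto.mono_left nhdsWithin_le_nhds, ?_⟩)⟩
    filter_upwards [self_mem_nhdsWithin] with y hy using hy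
  left_limit x := by
    obtain ⟨l, hl⟩ := hf.left_limit x
    refine ⟨l, hl.comp (tendsto_nhdsWithin_iff.2
      ⟨continuous_subtype_val.continuousAt.tendsto.mono_left nhdsWithin_le_nhds, ?_⟩)⟩
    filter_upwards [self_mem_nhdsWithin] with y hy using hy
  integral_eq_one := hint

end PiecewiseContinuous

/-! ### Calculus of bounded measurable functions and step functions -/

section BoundedMeasurable

/-- Bounded measurable real functions. -/
structure IsBddMeasurable {α : Type*} [MeasurableSpace α] (f : α → ℝ) : Prop where
  measurable : Measurable f
  bdd : ∃ C, ∀ y, |f y| ≤ C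

namespace IsBddMeasurable

variable {α : Type*} [MeasurableSpace α] {f g : α → ℝ}

theorem const (c : ℝ) : IsBddMeasurable fun _ : α => c := ⟨measurable_const, |c|, fun _ => le_rfl⟩

theorem add (hf : IsBddMeasurable f) (hg : IsBddMeasurable g) :
    IsBddMeasurable fun y => f y + g y := by
  obtain ⟨a, ha⟩ := hf.bdd
  obtain ⟨b, hb⟩ := hg.bdd
  exact ⟨hf.measurable.add hg.measurable, a + b, fun y =>
    (abs_add_le _ _).trans (add_le_add (ha y) (hb y))⟩

theorem mul (hf : IsBddMeasurable f) (hg : IsBddMeasurable g) :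
    IsBddMeasurable fun y => f y * g y := by
  obtain ⟨a, ha⟩ := hf.bdd
  obtain ⟨b, hb⟩ := hg.bdd
  exact ⟨hf.measurable.mul hg.measurable, a * b, fun y => by
    rw [abs_mul]
    exact mul_le_mul (ha y) (hb y) (abs_nonneg _) ((abs_nonneg _).trans (ha y))⟩

theorem const_mul (hf : IsBddMeasurable f) (c : ℝ) : IsBddMeasurable fun y => c * f y :=
  (const c).mul hf

theorem sub (hf : IsBddMeasurable f) (hg : IsBddMeasurable g) :
    IsBddMeasurable fun y => f y - g y := by
  have := hf.add (hg.const_mul (-1))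
  simpa [sub_eq_add_neg] using this

theorem sum {ι : Type*} (s : Finset ι) {F : ι → α → ℝ} (h : ∀ i ∈ s, IsBddMeasurable (F i)) :
    IsBddMeasurable fun y => ∑ i ∈ s, F i y := by
  classical
  induction s using Finset.induction_on with
  | empty => simpa using const 0
  | insert a s ha ih =>
    simp_rw [Finset.sum_insert ha]
    exact (h a (Finset.mem_insert_self _ _)).add
      (ih fun i hi => h i (Finset.mem_insert_of_mem hi))

theorem indicator_const {s : Set α} (hs : MeasurableSet s) (c : ℝ) :
    IsBddMeasurable (s.indicator fun _ => c) :=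
  ⟨measurable_const.indicator hs, |c|, fun y => by
    by_cases h : y ∈ s <;> simp [h]⟩

theorem integrable (hf : IsBddMeasurable f) (μ : Measure α) [IsFiniteMeasure μ] :
    Integrable f μ := by
  obtain ⟨a, ha⟩ := hf.bdd
  exact Integrable.of_bound hf.measurable.aestronglyMeasurable a (ae_of_all _ ha)

theorem intervalIntegrable {f : ℝ → ℝ} (hf : IsBddMeasurable f) (a b : ℝ) :
    IntervalIntegrable f volume a b :=
  ⟨hf.integrable _, hf.integrable _⟩

end IsBddMeasurable

theorem isBddMeasurable_indicator_id {s t : ℝ} :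
    IsBddMeasurable ((Set.Ico s t).indicator fun y => y) :=
  ⟨measurable_id.indicator measurableSet_Ico, max |s| |t|, fun y => by
    by_cases h : y ∈ Set.Ico s t
    · rw [Set.indicator_of_mem h]
      exact abs_le_max_abs_abs h.1 h.2.le
    · rw [Set.indicator_of_notMem h]
      simp⟩

theorem integral_indicator_Ico (f : ℝ → ℝ) {s t : ℝ} (h0 : 0 ≤ s) (hst : s ≤ t) (h1 : t ≤ 1) :
    ∫ y in (0 : ℝ)..1, (Set.Ico s t).indicator f y = ∫ y in s..t, f y := by
  rw [intervalIntegral.integral_of_le zero_le_one, intervalIntegral.integral_of_le hst,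
    ← integral_Ico_eq_integral_Ioc, ← integral_Ico_eq_integral_Ioc,
    setIntegral_indicator measurableSet_Ico, Set.inter_eq_right.2 (Set.Ico_subset_Ico h0 h1)]

theorem integral_indicator_Ico_const (c : ℝ) {s t : ℝ} (h0 : 0 ≤ s) (hst : s ≤ t) (h1 : t ≤ 1) :
    ∫ y in (0 : ℝ)..1, (Set.Ico s t).indicator (fun _ => c) y = (t - s) * c := by
  rw [integral_indicator_Ico _ h0 hst h1]
  simp

theorem integral_indicator_Ico_id {s t : ℝ} (h0 : 0 ≤ s) (hst : s ≤ t) (h1 : t ≤ 1) :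
    ∫ y in (0 : ℝ)..1, (Set.Ico s t).indicator (fun y => y) y = (t ^ 2 - s ^ 2) / 2 := by
  rw [integral_indicator_Ico _ h0 hst h1]
  simp

end BoundedMeasurable

/-! ### Folding the input interval in two -/

section Fold

/-- The two-to-one map of `[0,1]` onto itself, increasing with slope `2` on both halves. -/
noncomputable def fold (x : unitInterval) : ℝ := if (x : ℝ) < 1 / 2 then 2 * x else 2 * x - 1

/-- The sign that tells the two halves of `[0,1]` apart. -/
noncomputable def halfSign (x : unitInterval) : ℝ := if (x : ℝ) < 1 / 2 then 1 else -1

theorem measurableSet_half : MeasurableSet {x : unitInterval | (x : ℝ) < 1 / 2} :=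
  measurableSet_lt measurable_subtype_coe measurable_const

theorem measurable_fold : Measurable fold :=
  Measurable.ite measurableSet_half (by fun_prop) (by fun_prop)

theorem measurable_halfSign : Measurable halfSign :=
  Measurable.ite measurableSet_half measurable_const measurable_const

theorem halfSign_sq (x : unitInterval) : halfSign x ^ 2 = 1 := by
  unfold halfSign
  split_ifs <;> norm_num

theorem integral_fold_ite {A B : ℝ → ℝ} (hA : IsBddMeasurable A) (hB : IsBddMeasurable B) :
    ∫ x : unitInterval, (if (x : ℝ) < 1 / 2 then A (fold x) else B (fold x)) =
      ((∫ y in (0 : ℝ)..1, A y) + ∫ y in (0 : ℝ)..1, B y) / 2 := by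
  set F : ℝ → ℝ := fun x => if x < 1 / 2 then A (2 * x) else B (2 * x - 1)
  have hF : Measurable F := Measurable.ite measurableSet_Iio
    (hA.measurable.comp (by fun_prop)) (hB.measurable.comp (by fun_prop))
  have hFb : IsBddMeasurable F := by
    obtain ⟨a, ha⟩ := hA.bdd
    obtain ⟨b, hb⟩ := hB.bdd
    refine ⟨hF, max a b, fun y => ?_⟩
    simp only [F]
    split_ifs
    · exact (ha _).trans (le_max_left _ _)
    · exact (hb _).trans (le_max_right _ _)
  have h1 : ∀ x : unitInterval,
      (if (x : ℝ) < 1 / 2 then A (fold x) else B (fold x)) = F x := by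
    intro x
    simp only [F, fold]
    split_ifs <;> rfl
  simp_rw [h1]
  have h2 : ∫ x : unitInterval, F x = ∫ x in Set.Icc (0 : ℝ) 1, F x :=
    integral_subtype_comap measurableSet_Icc F
  rw [h2, integral_Icc_eq_integral_Ioc, ← integral_Ico_eq_integral_Ioc,
    ← Set.Ico_union_Ico_eq_Ico (b := (1 / 2 : ℝ)) (by norm_num) (by norm_num),
    setIntegral_union (Set.Ico_disjoint_Ico_same) measurableSet_Ico (hFb.integrable _)
      (hFb.integrable _)]
  have h3 : ∫ x in Set.Ico (0 : ℝ) (1 / 2), F x = (∫ y in (0 : ℝ)..1, A y) / 2 := by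
    rw [setIntegral_congr_fun (g := fun x => A (2 * x)) measurableSet_Ico
      (fun x hx => if_pos hx.2), integral_Ico_eq_integral_Ioc,
      ← intervalIntegral.integral_of_le (by norm_num),
      intervalIntegral.integral_comp_mul_left _ (by norm_num)]
    norm_num
    ring
  have h4 : ∫ x in Set.Ico (1 / 2 : ℝ) 1, F x = (∫ y in (0 : ℝ)..1, B y) / 2 := by
    rw [setIntegral_congr_fun (g := fun x => B (2 * x - 1)) measurableSet_Ico
      (fun x hx => if_neg (not_lt.2 hx.1)), integral_Ico_eq_integral_Ioc,
      ← intervalIntegral.integral_of_le (by norm_num),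
      intervalIntegral.integral_comp_mul_sub _ (by norm_num)]
    norm_num
    ring
  rw [h3, h4]
  ring

theorem integral_fold {A : ℝ → ℝ} (hA : IsBddMeasurable A) :
    ∫ x : unitInterval, A (fold x) = ∫ y in (0 : ℝ)..1, A y := by
  have := integral_fold_ite hA hA
  simp only [ite_self] at this
  rw [this]
  ring

/-- The two halves contribute equal and opposite amounts. This makes the constraints on the
compensators hold for every density of the form A ∘ `fold`. -/
theorem integral_halfSign_mul_fold {A : ℝ → ℝ} (hA : IsBddMeasurable A) :
    ∫ x : unitInterval, halfSign x * A (fold x) = 0 := by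
  have := integral_fold_ite hA (hA.const_mul (-1))
  rw [intervalIntegral.integral_const_mul] at this
  rw [show (0 : ℝ) = ((∫ y in (0 : ℝ)..1, A y) + -1 * ∫ y in (0 : ℝ)..1, A y) / 2 by ring, ← this]
  congr 1
  ext x
  unfold halfSign
  split_ifs <;> ring

theorem isAdmissible_fold {P : ℝ → ℝ} (hP : IsPiecewiseContinuous P) (hPm : IsBddMeasurable P)
    (hsupp : ∀ y, y ∉ Set.Ico (0 : ℝ) 1 → P y = 0) {cmax : ℝ} (h0 : ∀ y, 0 ≤ P y)
    (h1 : ∀ y, P y ≤ cmax) (hint : ∫ y in (0 : ℝ)..1, P y = 1) :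
    IsAdmissible cmax fun x => P (fold x) := by
  -- As P vanishes off [0,1), at most one of the two dilates is nonzero. The composition with the
  -- discontinuous `fold` thus becomes a sum of affine compositions.
  have heq : ∀ x : unitInterval, P (fold x) = P (2 * (x : ℝ) + 0) + P (2 * (x : ℝ) + -1) := by
    intro x
    unfold fold
    split_ifs with h
    · rw [hsupp (2 * (x : ℝ) + -1) fun h2 => by linarith [h2.1]]
      simp
    · rw [hsupp (2 * (x : ℝ) + 0) fun h2 => by linarith [h2.2]]
      simp [sub_eq_add_neg]
  have h := isAdmissible_restrict (f := fun x => P (2 * x + 0) + P (2 * x + -1)) (cmax := cmax)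
    ((hP.comp_two_mul_add 0).add (hP.comp_two_mul_add (-1)))
    (fun x => by rw [← heq]; exact h0 _) (fun x => by rw [← heq]; exact h1 _)
    (by simp_rw [← heq]; rw [integral_fold hPm, hint])
  simp_rw [← heq] at h
  exact h

end Fold

/-! ### Haar functions on the right half of the folded interval -/

section Haar

/-- The Haar function of the `i`-th of the `2 ^ k` blocks of equal length of `[1/2,1)`. -/
noncomputable def haar (k i : ℕ) (y : ℝ) : ℝ :=
  if ⌊4 * 2 ^ k * y⌋₊ = 2 * (2 ^ k + i) then 1
  else if ⌊4 * 2 ^ k * y⌋₊ = 2 * (2 ^ k + i) + 1 then -1 else 0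

/-- The linear combination of the Haar functions of level `k` with coefficients `θ`. -/
noncomputable def haarSum (k : ℕ) (θ : ℕ → ℝ) (y : ℝ) : ℝ :=
  ∑ i ∈ Finset.range (2 ^ k), θ i * haar k i y

theorem floor_eq_iff_mem_Ico {n : ℝ} (hn : 0 < n) {q : ℕ} (hq : q ≠ 0) (y : ℝ) :
    ⌊n * y⌋₊ = q ↔ y ∈ Set.Ico ((q : ℝ) / n) ((q + 1) / n) := by
  rw [Nat.floor_eq_iff' hq, Set.mem_Ico, div_le_iff₀ hn, lt_div_iff₀ hn, mul_comm y]

theorem haar_eq_indicator (k i : ℕ) (y : ℝ) :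
    haar k i y =
      (Set.Ico (((2 * (2 ^ k + i) : ℕ) : ℝ) / (4 * 2 ^ k))
        (((2 * (2 ^ k + i) : ℕ) + 1) / (4 * 2 ^ k))).indicator (fun _ => 1) y -
      (Set.Ico (((2 * (2 ^ k + i) + 1 : ℕ) : ℝ) / (4 * 2 ^ k))
        (((2 * (2 ^ k + i) + 1 : ℕ) + 1) / (4 * 2 ^ k))).indicator (fun _ => 1) y := by
  have h : (0 : ℝ) < 4 * 2 ^ k := by positivity
  have hk : 0 < 2 ^ k := by positivity
  simp only [Set.indicator_apply]
  simp only [← floor_eq_iff_mem_Ico h (show 2 * (2 ^ k + i) ≠ 0 by omega),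
    ← floor_eq_iff_mem_Ico h (show 2 * (2 ^ k + i) + 1 ≠ 0 by omega), haar]
  split_ifs <;> first | omega | norm_num

theorem abs_haar_le (k i : ℕ) (y : ℝ) : |haar k i y| ≤ 1 := by
  unfold haar
  split_ifs <;> norm_num

theorem isPiecewiseContinuous_haar (k i : ℕ) : IsPiecewiseContinuous (haar k i) := by
  rw [funext (haar_eq_indicator k i)]
  refine (IsPiecewiseContinuous.indicator_Ico continuous_const ?_).sub
    (IsPiecewiseContinuous.indicator_Ico continuous_const ?_) <;>
  · gcongr
    linarith

theorem isBddMeasurable_haar (k i : ℕ) : IsBddMeasurable (haar k i) := by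
  rw [funext (haar_eq_indicator k i)]
  exact (IsBddMeasurable.indicator_const measurableSet_Ico _).sub
    (IsBddMeasurable.indicator_const measurableSet_Ico _)

theorem isBddMeasurable_haarSum (k : ℕ) (θ : ℕ → ℝ) : IsBddMeasurable (haarSum k θ) :=
  IsBddMeasurable.sum _ fun i _ => (isBddMeasurable_haar k i).const_mul _

theorem floor_of_haar_ne_zero {k i : ℕ} {y : ℝ} (h : haar k i y ≠ 0) :
    ⌊4 * 2 ^ k * y⌋₊ / 2 = 2 ^ k + i := by
  unfold haar at h
  split_ifs at h with h1 h2
  · omega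
  · omega
  · exact absurd rfl h

theorem haar_eq_zero_of_notMem {k i : ℕ} (hi : i < 2 ^ k) {y : ℝ}
    (hy : y ∉ Set.Ico (1 / 2 : ℝ) 1) : haar k i y = 0 := by
  by_contra h
  have hf := floor_of_haar_ne_zero h
  have hk : (0 : ℝ) < 2 ^ k := by positivity
  have hk' : 0 < 2 ^ k := by positivity
  refine hy ⟨?_, ?_⟩
  · have h2 : 2 * 2 ^ k ≤ ⌊4 * 2 ^ k * y⌋₊ := by omega
    have h3 := (Nat.le_floor_iff' (by omega)).1 h2
    push_cast at h3
    nlinarith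
  · have h2 : ⌊4 * 2 ^ k * y⌋₊ < 4 * 2 ^ k := by omega
    have h3 := (Nat.floor_lt' (by omega)).1 h2
    push_cast at h3
    nlinarith

theorem haarSum_eq_zero_of_notMem (k : ℕ) (θ : ℕ → ℝ) {y : ℝ}
    (hy : y ∉ Set.Ico (1 / 2 : ℝ) 1) : haarSum k θ y = 0 :=
  Finset.sum_eq_zero fun i hi => by
    rw [haar_eq_zero_of_notMem (Finset.mem_range.1 hi) hy, mul_zero]

theorem haar_mul_haar_of_ne (k : ℕ) {i j : ℕ} (hij : i ≠ j) (y : ℝ) :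
    haar k i y * haar k j y = 0 := by
  by_contra h
  have h1 := floor_of_haar_ne_zero (left_ne_zero_of_mul h)
  have h2 := floor_of_haar_ne_zero (right_ne_zero_of_mul h)
  omega

theorem abs_haarSum_le (k : ℕ) {θ : ℕ → ℝ} {E : ℝ} (hE : 0 ≤ E)
    (h : ∀ i < 2 ^ k, |θ i| ≤ E) (y : ℝ) : |haarSum k θ y| ≤ E := by
  by_cases hz : ∃ i ∈ Finset.range (2 ^ k), haar k i y ≠ 0
  · obtain ⟨i, hi, hne⟩ := hz
    rw [haarSum, Finset.sum_eq_single_of_mem i hi fun j _ hj => by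
      have := haar_mul_haar_of_ne k hj y
      rw [(mul_eq_zero.1 this).resolve_right hne, mul_zero], abs_mul]
    exact (mul_le_of_le_one_right (abs_nonneg _) (abs_haar_le k i y)).trans
      (h i (Finset.mem_range.1 hi))
  · push Not at hz
    rw [haarSum, Finset.sum_eq_zero fun i hi => by rw [hz i hi, mul_zero]]
    simpa using hE

theorem integral_haar (k : ℕ) {i : ℕ} (hi : i < 2 ^ k) : ∫ y in (0 : ℝ)..1, haar k i y = 0 := by
  have hk : (0 : ℝ) < 4 * 2 ^ k := by positivity
  have hi' : (i : ℝ) + 1 ≤ 2 ^ k := by exact_mod_cast hi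
  rw [funext (haar_eq_indicator k i), intervalIntegral.integral_sub
    ((IsBddMeasurable.indicator_const measurableSet_Ico _).intervalIntegrable _ _)
    ((IsBddMeasurable.indicator_const measurableSet_Ico _).intervalIntegrable _ _),
    integral_indicator_Ico_const _ (by positivity) (by gcongr; linarith)
      (by rw [div_le_one hk]; push_cast; linarith),
    integral_indicator_Ico_const _ (by positivity) (by gcongr; linarith)
      (by rw [div_le_one hk]; push_cast; linarith)]
  push_cast
  ring

theorem integral_haar_sq (k : ℕ) {i : ℕ} (hi : i < 2 ^ k) :
    ∫ y in (0 : ℝ)..1, haar k i y * haar k i y = 1 / (2 * 2 ^ k) := by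
  have hk : (0 : ℝ) < 4 * 2 ^ k := by positivity
  have hk' : 0 < 2 ^ k := by positivity
  have hi' : (i : ℝ) + 1 ≤ 2 ^ k := by exact_mod_cast hi
  have h : ∀ y, haar k i y * haar k i y =
      (Set.Ico (((2 * (2 ^ k + i) : ℕ) : ℝ) / (4 * 2 ^ k))
        (((2 * (2 ^ k + i) : ℕ) + 1) / (4 * 2 ^ k))).indicator (fun _ => 1) y +
      (Set.Ico (((2 * (2 ^ k + i) + 1 : ℕ) : ℝ) / (4 * 2 ^ k))
        (((2 * (2 ^ k + i) + 1 : ℕ) + 1) / (4 * 2 ^ k))).indicator (fun _ => 1) y := by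
    intro y
    simp only [Set.indicator_apply]
    simp only [← floor_eq_iff_mem_Ico hk (show 2 * (2 ^ k + i) ≠ 0 by omega),
      ← floor_eq_iff_mem_Ico hk (show 2 * (2 ^ k + i) + 1 ≠ 0 by omega), haar]
    split_ifs <;> first | omega | norm_num
  simp_rw [h]
  rw [intervalIntegral.integral_add
    ((IsBddMeasurable.indicator_const measurableSet_Ico _).intervalIntegrable _ _)
    ((IsBddMeasurable.indicator_const measurableSet_Ico _).intervalIntegrable _ _),
    integral_indicator_Ico_const _ (by positivity) (by gcongr; linarith)
      (by rw [div_le_one hk]; push_cast; linarith),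
    integral_indicator_Ico_const _ (by positivity) (by gcongr; linarith)
      (by rw [div_le_one hk]; push_cast; linarith)]
  push_cast
  field_simp
  ring

/-- The coarser function is constant on the support of the finer one, which has mean zero.
Consequently the coefficients of one level can be changed without disturbing the constraints of any
other level. -/
theorem integral_haar_mul_haar_of_lt {k l : ℕ} (hkl : k < l) (i : ℕ) {j : ℕ} (hj : j < 2 ^ l) :
    ∫ y in (0 : ℝ)..1, haar k i y * haar l j y = 0 := by
  obtain ⟨d, rfl⟩ : ∃ d, l = k + (d + 1) := ⟨l - k - 1, by omega⟩
  -- The dyadic grids are nested, so the coarse cell index is an integer quotient of the fine one.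
  have hfl : ∀ y : ℝ, ⌊4 * 2 ^ k * y⌋₊ = ⌊4 * 2 ^ (k + (d + 1)) * y⌋₊ / 2 / 2 ^ d := by
    intro y
    rw [Nat.div_div_eq_div_mul, ← pow_succ', ← Nat.floor_div_natCast]
    congr 1
    push_cast
    rw [pow_add]
    field_simp
  have hval : ∃ C : ℝ, ∀ y, haar k i y * haar (k + (d + 1)) j y = C * haar (k + (d + 1)) j y := by
    refine ⟨if (2 ^ (k + (d + 1)) + j) / 2 ^ d = 2 * (2 ^ k + i) then 1
      else if (2 ^ (k + (d + 1)) + j) / 2 ^ d = 2 * (2 ^ k + i) + 1 then -1 else 0, fun y => ?_⟩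
    by_cases h : haar (k + (d + 1)) j y = 0
    · rw [h, mul_zero, mul_zero]
    · congr 1
      rw [haar, hfl, floor_of_haar_ne_zero h]
  obtain ⟨C, hC⟩ := hval
  simp_rw [hC]
  rw [intervalIntegral.integral_const_mul, integral_haar _ hj, mul_zero]

theorem integral_haar_mul_haar {k l i j : ℕ} (hi : i < 2 ^ k) (hj : j < 2 ^ l)
    (hne : k ≠ l ∨ i ≠ j) : ∫ y in (0 : ℝ)..1, haar k i y * haar l j y = 0 := by
  rcases lt_trichotomy k l with h | rfl | h
  · exact integral_haar_mul_haar_of_lt h i hj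
  · simp_rw [haar_mul_haar_of_ne k (hne.resolve_left (fun h => h rfl))]
    simp
  · simp_rw [mul_comm (haar k i _)]
    exact integral_haar_mul_haar_of_lt h j hi

theorem integral_haarSum (k : ℕ) (θ : ℕ → ℝ) : ∫ y in (0 : ℝ)..1, haarSum k θ y = 0 := by
  unfold haarSum
  rw [intervalIntegral.integral_finsetSum fun i _ =>
    ((isBddMeasurable_haar k i).const_mul _).intervalIntegrable _ _]
  refine Finset.sum_eq_zero fun i hi => ?_
  rw [intervalIntegral.integral_const_mul, integral_haar k (Finset.mem_range.1 hi), mul_zero]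

theorem integral_haarSum_mul_haar_self (k : ℕ) (θ : ℕ → ℝ) {j : ℕ} (hj : j < 2 ^ k) :
    ∫ y in (0 : ℝ)..1, haarSum k θ y * haar k j y = θ j / (2 * 2 ^ k) := by
  unfold haarSum
  simp_rw [Finset.sum_mul, mul_assoc]
  rw [intervalIntegral.integral_finsetSum fun i _ =>
    (((isBddMeasurable_haar k i).mul (isBddMeasurable_haar k j)).const_mul _).intervalIntegrable _ _,
    Finset.sum_eq_single_of_mem j (Finset.mem_range.2 hj) fun i hi hij => by
      rw [intervalIntegral.integral_const_mul,
        integral_haar_mul_haar (Finset.mem_range.1 hi) hj (Or.inr hij), mul_zero],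
    intervalIntegral.integral_const_mul, integral_haar_sq k hj]
  ring

theorem integral_haarSum_mul_haar_of_ne {k l : ℕ} (hkl : k ≠ l) (θ : ℕ → ℝ) {j : ℕ}
    (hj : j < 2 ^ l) : ∫ y in (0 : ℝ)..1, haarSum k θ y * haar l j y = 0 := by
  unfold haarSum
  simp_rw [Finset.sum_mul, mul_assoc]
  rw [intervalIntegral.integral_finsetSum fun i _ =>
    (((isBddMeasurable_haar k i).mul (isBddMeasurable_haar l j)).const_mul _).intervalIntegrable _ _]
  refine Finset.sum_eq_zero fun i hi => ?_
  rw [intervalIntegral.integral_const_mul,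
    integral_haar_mul_haar (Finset.mem_range.1 hi) hj (Or.inl hkl), mul_zero]

end Haar

/-- A code with at most `2 ^ (2 ^ k)` words for every level `k`, with letters in `[-1,1]`. -/
structure CodeSequence where
  /-- The number of words. -/
  size : ℕ → ℕ
  /-- The letters, indexed by level, word and position. -/
  letter : ℕ → ℕ → ℕ → ℝ
  size_pos : ∀ k, 0 < size k
  size_le : ∀ k, size k ≤ 2 ^ 2 ^ k
  abs_letter_le : ∀ k j i, |letter k j i| ≤ 1

/-! ### Hidden cells, constraints and the densities that select a word -/

section Hidden

variable (ε : ℝ) (C : CodeSequence)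

/-- Right end of the hidden interval of level `k`. -/
noncomputable def top (k : ℕ) : ℝ := ε / 2 ^ 2 ^ k

/-- The hidden interval of level `k`. -/
noncomputable def hid (k : ℕ) : Set ℝ := Set.Ico (top ε k / 2) (top ε k)

/-- The common length of the cells of the hidden interval of level `k`, one for every word. -/
noncomputable def cellLength (k : ℕ) : ℝ := top ε k / (2 * C.size k)

/-- The cell of the word `j` of level `k`. -/
noncomputable def cell (k j : ℕ) : Set ℝ :=
  Set.Ico (top ε k / 2 + j * cellLength ε C k) (top ε k / 2 + (j + 1) * cellLength ε C k)

/-- The index of the cell of a point. -/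
noncomputable def cellIndex (k : ℕ) (y : ℝ) : ℕ := ⌊(y - top ε k / 2) / cellLength ε C k⌋₊

/-- The `i`-th letter of the word whose cell contains `y`, and `0` off the hidden interval. -/
noncomputable def hidVal (k i : ℕ) : ℝ → ℝ :=
  (hid ε k).indicator fun y => C.letter k (cellIndex ε C k y) i

/-- The default density. -/
noncomputable def base (y : ℝ) : ℝ :=
  (Set.Ico 0 ε).indicator (fun y => y) y +
    (Set.Ico ε 1).indicator (fun _ => (1 - ε ^ 2 / 2) / (1 - ε)) y

/-- The mass of the hidden interval under the default density. -/
noncomputable def hidMass (k : ℕ) : ℝ := 3 * top ε k ^ 2 / 8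

/-- The weight of the visible part in the constraints. -/
noncomputable def weight (k : ℕ) : ℝ := 4 * 2 ^ k * hidMass ε k / ε

/-- The functions whose means are prescribed: those with `i < 2 ^ k` couple a Haar coefficient to
the hidden interval, the others fix the mass of the hidden interval. -/
noncomputable def constraintFun (k i : ℕ) (y : ℝ) : ℝ :=
  if i < 2 ^ k then weight ε k * haar k i y - hidVal ε C k i y
  else (hid ε k).indicator (fun _ => 1) y

/-- The mean of `hidVal` under the default density. -/
noncomputable def hidMean (k i : ℕ) : ℝ := ∫ y in (0 : ℝ)..1, base ε y * hidVal ε C k i y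

/-- The Haar coefficients of the density that selects the word `l`. -/
noncomputable def wordCoeff (k l i : ℕ) : ℝ :=
  2 * 2 ^ k / weight ε k * (hidMass ε k * C.letter k l i - hidMean ε C k i)

/-- The change of the default density on the hidden interval that selects the word `l`. -/
noncomputable def bump (k l : ℕ) (y : ℝ) : ℝ :=
  (cell ε C k l).indicator (fun _ => hidMass ε k / cellLength ε C k) y -
    (hid ε k).indicator (fun y => y) y

/-- The density that selects the word `l` of level `k`. -/
noncomputable def wordDensity (k l : ℕ) (y : ℝ) : ℝ :=
  base ε y + (haarSum k (wordCoeff ε C k l) y + bump ε C k l y)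

variable {ε} (hε : 0 < ε) (hε' : ε ≤ 1 / 2)

include hε in
theorem top_pos (k : ℕ) : 0 < top ε k := by unfold top; positivity

include hε in
theorem top_le (k : ℕ) : top ε k ≤ ε / 2 := by
  unfold top
  have : (2 : ℝ) ^ 1 ≤ 2 ^ 2 ^ k := pow_le_pow_right₀ (by norm_num) Nat.one_le_two_pow
  gcongr
  linarith

include hε in
theorem top_le_half_of_lt {k l : ℕ} (h : k < l) : top ε l ≤ top ε k / 2 := by
  unfold top
  have h1 : 2 ^ k + 1 ≤ 2 ^ l := Nat.pow_lt_pow_right (by norm_num) h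
  have h2 : (2 : ℝ) ^ (2 ^ k + 1) ≤ 2 ^ 2 ^ l := pow_le_pow_right₀ (by norm_num) h1
  rw [div_div]
  gcongr
  rwa [pow_succ] at h2

include hε in
theorem notMem_hid_of_mem_hid {k l : ℕ} (h : k ≠ l) {y : ℝ} (hy : y ∈ hid ε k) : y ∉ hid ε l := by
  intro hy'
  rcases lt_or_gt_of_ne h with h | h
  · have := top_le_half_of_lt hε h
    linarith [hy.1, hy'.2]
  · have := top_le_half_of_lt hε h
    linarith [hy'.1, hy.2]

include hε in
theorem hid_subset (k : ℕ) : hid ε k ⊆ Set.Ico 0 ε := fun y hy =>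
  ⟨by linarith [hy.1, top_pos hε k], by linarith [hy.2, top_le hε k]⟩

include hε in
theorem cellLength_pos (k : ℕ) : 0 < cellLength ε C k := by
  have := top_pos hε k
  have h : (0 : ℝ) < C.size k := by exact_mod_cast C.size_pos k
  unfold cellLength
  positivity

theorem size_mul_cellLength (k : ℕ) : C.size k * cellLength ε C k = top ε k / 2 := by
  have h : (C.size k : ℝ) ≠ 0 := by exact_mod_cast (C.size_pos k).ne'
  unfold cellLength
  field_simp

include hε in
theorem cell_subset_hid {k l : ℕ} (hl : l < C.size k) : cell ε C k l ⊆ hid ε k := by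
  have h1 := cellLength_pos C hε k
  have h2 := size_mul_cellLength (ε := ε) C k
  have h3 : (l : ℝ) + 1 ≤ C.size k := by exact_mod_cast hl
  refine Set.Ico_subset_Ico ?_ ?_
  · have : 0 ≤ (l : ℝ) * cellLength ε C k := by positivity
    linarith
  · have := mul_le_mul_of_nonneg_right h3 h1.le
    linarith

include hε in
theorem cellIndex_of_mem {k l : ℕ} {y : ℝ} (hy : y ∈ cell ε C k l) : cellIndex ε C k y = l := by
  have h1 := cellLength_pos C hε k
  have hl : 0 ≤ (l : ℝ) * cellLength ε C k := by positivity
  rw [cellIndex, Nat.floor_eq_iff (div_nonneg (by linarith [hy.1]) h1.le), le_div_iff₀ h1,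
    div_lt_iff₀ h1]
  exact ⟨by linarith [hy.1], by linarith [hy.2]⟩

include hε in
theorem cellIndex_lt {k : ℕ} {y : ℝ} (hy : y ∈ hid ε k) : cellIndex ε C k y < C.size k := by
  have h1 := cellLength_pos C hε k
  have h2 := size_mul_cellLength (ε := ε) C k
  rw [cellIndex, Nat.floor_lt (div_nonneg (by linarith [hy.1]) h1.le), div_lt_iff₀ h1]
  linarith [hy.2]

include hε in
theorem mem_cell_cellIndex {k : ℕ} {y : ℝ} (hy : y ∈ hid ε k) :
    y ∈ cell ε C k (cellIndex ε C k y) := by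
  have h1 := cellLength_pos C hε k
  have h0 : 0 ≤ (y - top ε k / 2) / cellLength ε C k := div_nonneg (by linarith [hy.1]) h1.le
  have h2 := Nat.floor_le h0
  have h3 := Nat.lt_floor_add_one ((y - top ε k / 2) / cellLength ε C k)
  rw [le_div_iff₀ h1] at h2
  rw [div_lt_iff₀ h1] at h3
  exact ⟨by unfold cellIndex; linarith, by unfold cellIndex; linarith⟩

theorem measurableSet_hid (k : ℕ) : MeasurableSet (hid ε k) := measurableSet_Ico

theorem measurableSet_cell (k l : ℕ) : MeasurableSet (cell ε C k l) := measurableSet_Ico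

theorem abs_hidVal_le (k i : ℕ) (y : ℝ) :
    |hidVal ε C k i y| ≤ (hid ε k).indicator (fun _ => 1) y := by
  unfold hidVal
  by_cases h : y ∈ hid ε k
  · rw [Set.indicator_of_mem h, Set.indicator_of_mem h]
    exact C.abs_letter_le _ _ _
  · rw [Set.indicator_of_notMem h, Set.indicator_of_notMem h, abs_zero]

theorem isBddMeasurable_hidVal (k i : ℕ) : IsBddMeasurable (hidVal ε C k i) := by
  refine ⟨Measurable.indicator ?_ (measurableSet_hid k), 1, fun y => ?_⟩
  · have h1 : Measurable (cellIndex ε C k) := Nat.measurable_floor.comp (by fun_prop)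
    exact (measurable_of_countable fun j => C.letter k j i).comp h1
  · refine (abs_hidVal_le C k i y).trans ?_
    by_cases h : y ∈ hid ε k <;> simp [h]

theorem isBddMeasurable_base : IsBddMeasurable (base ε) :=
  isBddMeasurable_indicator_id.add (IsBddMeasurable.indicator_const measurableSet_Ico _)

theorem isBddMeasurable_hid (k : ℕ) : IsBddMeasurable ((hid ε k).indicator fun _ => (1 : ℝ)) :=
  IsBddMeasurable.indicator_const (measurableSet_hid k) _

theorem isBddMeasurable_hid_id (k : ℕ) : IsBddMeasurable ((hid ε k).indicator fun y => y) :=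
  isBddMeasurable_indicator_id

theorem isBddMeasurable_constraintFun (k i : ℕ) : IsBddMeasurable (constraintFun ε C k i) := by
  unfold constraintFun
  split_ifs
  · exact ((isBddMeasurable_haar k i).const_mul _).sub (isBddMeasurable_hidVal C k i)
  · exact isBddMeasurable_hid k

theorem isBddMeasurable_bump (k l : ℕ) : IsBddMeasurable (bump ε C k l) :=
  (IsBddMeasurable.indicator_const (measurableSet_cell C k l) _).sub isBddMeasurable_indicator_id

theorem isBddMeasurable_wordDensity (k l : ℕ) : IsBddMeasurable (wordDensity ε C k l) :=
  isBddMeasurable_base.add ((isBddMeasurable_haarSum _ _).add (isBddMeasurable_bump C k l))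

include hε in
theorem hidMass_pos (k : ℕ) : 0 < hidMass ε k := by
  have := top_pos hε k
  unfold hidMass
  positivity

include hε in
theorem weight_pos (k : ℕ) : 0 < weight ε k := by
  have := hidMass_pos hε k
  unfold weight
  positivity

include hε hε' in
-- The hidden mass is of order `top`², and `top` decays doubly exponentially, which beats the factor
-- 2^k.
theorem weight_le_one (k : ℕ) : weight ε k ≤ 1 := by
  unfold weight hidMass top
  have h1 : (2 : ℝ) ^ k ≤ 2 ^ 2 ^ k := pow_le_pow_right₀ (by norm_num) Nat.lt_two_pow_self.le
  have h2 : (2 : ℝ) ^ 1 ≤ 2 ^ 2 ^ k := pow_le_pow_right₀ (by norm_num) Nat.one_le_two_pow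
  set N : ℝ := 2 ^ k
  set Q : ℝ := 2 ^ 2 ^ k
  have hQ : 0 < Q := by positivity
  have hN : 0 < N := by positivity
  rw [show 4 * N * (3 * (ε / Q) ^ 2 / 8) / ε = 3 / 2 * (N / Q) * (ε / Q) by field_simp; ring]
  have h3 : N / Q ≤ 1 := (div_le_one hQ).2 h1
  have h4 : ε / Q ≤ 1 / 2 := by rw [div_le_iff₀ hQ]; linarith
  have h5 : 0 ≤ N / Q := by positivity
  have h6 : 0 ≤ ε / Q := by positivity
  nlinarith

include hε hε' in
theorem base_height_mem : 1 ≤ (1 - ε ^ 2 / 2) / (1 - ε) ∧ (1 - ε ^ 2 / 2) / (1 - ε) ≤ 1 + 2 * ε := by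
  have h : 0 < 1 - ε := by linarith
  rw [le_div_iff₀ h, div_le_iff₀ h]
  constructor <;> nlinarith

theorem base_of_lt {y : ℝ} (hy : y ∈ Set.Ico 0 ε) : base ε y = y := by
  rw [base, Set.indicator_of_mem hy, Set.indicator_of_notMem (fun h => absurd hy.2 (not_lt.2 h.1)),
    add_zero]

theorem base_of_ge {y : ℝ} (hy : y ∈ Set.Ico ε 1) : base ε y = (1 - ε ^ 2 / 2) / (1 - ε) := by
  rw [base, Set.indicator_of_mem hy, Set.indicator_of_notMem (fun h => absurd h.2 (not_lt.2 hy.1)),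
    zero_add]

include hε hε' in
theorem base_of_notMem {y : ℝ} (hy : y ∉ Set.Ico (0 : ℝ) 1) : base ε y = 0 := by
  rw [base, Set.indicator_of_notMem fun h => hy ⟨h.1, by linarith [h.2]⟩,
    Set.indicator_of_notMem fun h => hy ⟨by linarith [h.1], h.2⟩, add_zero]

include hε hε' in
theorem base_nonneg (y : ℝ) : 0 ≤ base ε y := by
  refine add_nonneg (Set.indicator_nonneg (fun y hy => hy.1) _)
    (Set.indicator_nonneg (fun y _ => ?_) _)
  exact zero_le_one.trans (base_height_mem hε hε').1

include hε hε' in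
theorem integral_base : ∫ y in (0 : ℝ)..1, base ε y = 1 := by
  have h : 1 - ε ≠ 0 := by linarith
  unfold base
  rw [intervalIntegral.integral_add (isBddMeasurable_indicator_id.intervalIntegrable _ _)
    ((IsBddMeasurable.indicator_const measurableSet_Ico _).intervalIntegrable _ _),
    integral_indicator_Ico_id le_rfl hε.le (by linarith),
    integral_indicator_Ico_const _ hε.le (by linarith) le_rfl]
  field_simp
  ring

include hε' in
theorem haarSum_eq_zero_of_lt (k : ℕ) (θ : ℕ → ℝ) {y : ℝ} (hy : y < ε) : haarSum k θ y = 0 :=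
  haarSum_eq_zero_of_notMem k θ fun h => by linarith [h.1]

include hε in
theorem bump_of_notMem {k l : ℕ} (hl : l < C.size k) {y : ℝ} (hy : y ∉ hid ε k) :
    bump ε C k l y = 0 := by
  rw [bump, Set.indicator_of_notMem hy,
    Set.indicator_of_notMem fun h => hy (cell_subset_hid C hε hl h), sub_zero]

include hε hε' in
theorem integral_hid_id (k : ℕ) :
    ∫ y in (0 : ℝ)..1, (hid ε k).indicator (fun y => y) y = hidMass ε k := by
  have h1 := top_pos hε k
  have h2 := top_le hε k
  rw [hid, integral_indicator_Ico_id (by linarith) (by linarith) (by linarith), hidMass]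
  ring

theorem base_mul_hid (hε : 0 < ε) (k : ℕ) (y : ℝ) :
    base ε y * (hid ε k).indicator (fun _ => 1) y = (hid ε k).indicator (fun y => y) y := by
  by_cases h : y ∈ hid ε k
  · rw [Set.indicator_of_mem h, Set.indicator_of_mem h, mul_one, base_of_lt (hid_subset hε k h)]
  · rw [Set.indicator_of_notMem h, Set.indicator_of_notMem h, mul_zero]

include hε hε' in
theorem integral_cell_const {k l : ℕ} (hl : l < C.size k) (c : ℝ) :
    ∫ y in (0 : ℝ)..1, (cell ε C k l).indicator (fun _ => c) y = cellLength ε C k * c := by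
  have h1 := top_pos hε k
  have h2 := top_le hε k
  have h3 := cellLength_pos C hε k
  have h4 := size_mul_cellLength (ε := ε) C k
  have h5 : (l : ℝ) + 1 ≤ C.size k := by exact_mod_cast hl
  have h6 := mul_le_mul_of_nonneg_right h5 h3.le
  have h7 : 0 ≤ (l : ℝ) * cellLength ε C k := by positivity
  rw [cell, integral_indicator_Ico_const _ (by linarith) (by linarith) (by linarith)]
  ring

include hε hε' in
theorem integral_bump {k l : ℕ} (hl : l < C.size k) : ∫ y in (0 : ℝ)..1, bump ε C k l y = 0 := by
  have h3 := cellLength_pos C hε k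
  unfold bump
  rw [intervalIntegral.integral_sub ((IsBddMeasurable.indicator_const
    (measurableSet_cell C k l) _).intervalIntegrable _ _)
    ((isBddMeasurable_hid_id k).intervalIntegrable _ _), integral_cell_const C hε hε' hl,
    integral_hid_id hε hε']
  field_simp
  ring

include hε hε' in
-- The new density puts the whole hidden mass on the cell of `l`, where the letters are constant;
-- the old contribution is removed.
theorem integral_bump_mul_hidVal {k l : ℕ} (hl : l < C.size k) (i : ℕ) :
    ∫ y in (0 : ℝ)..1, bump ε C k l y * hidVal ε C k i y =
      hidMass ε k * C.letter k l i - hidMean ε C k i := by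
  have h3 := cellLength_pos C hε k
  have hpt : ∀ y, bump ε C k l y * hidVal ε C k i y =
      (cell ε C k l).indicator
        (fun _ => hidMass ε k / cellLength ε C k * C.letter k l i) y -
      base ε y * hidVal ε C k i y := by
    intro y
    by_cases h : y ∈ hid ε k
    · rw [bump, Set.indicator_of_mem h, base_of_lt (hid_subset hε k h), sub_mul]
      congr 1
      by_cases hc : y ∈ cell ε C k l
      · rw [Set.indicator_of_mem hc, Set.indicator_of_mem hc, hidVal, Set.indicator_of_mem h,
          cellIndex_of_mem C hε hc]
      · rw [Set.indicator_of_notMem hc, Set.indicator_of_notMem hc, zero_mul]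
    · rw [hidVal, Set.indicator_of_notMem h,
        Set.indicator_of_notMem fun hc => h (cell_subset_hid C hε hl hc)]
      simp
  simp_rw [hpt]
  rw [intervalIntegral.integral_sub ((IsBddMeasurable.indicator_const
    (measurableSet_cell C k l) _).intervalIntegrable _ _)
    ((isBddMeasurable_base.mul (isBddMeasurable_hidVal C k i)).intervalIntegrable _ _),
    integral_cell_const C hε hε' hl, hidMean]
  field_simp

include hε in
theorem bump_mul_eq_zero {k l : ℕ} (hl : l < C.size k) {F : ℝ → ℝ}
    (hF : ∀ y ∈ hid ε k, F y = 0) (y : ℝ) : bump ε C k l y * F y = 0 := by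
  by_cases h : y ∈ hid ε k
  · rw [hF y h, mul_zero]
  · rw [bump_of_notMem C hε hl h, zero_mul]

include hε hε' in
-- Haar sums vanish on all hidden intervals, and distinct Haar functions are orthogonal, so only the
-- coefficient of the same level and position survives.
theorem integral_haarSum_mul_constraintFun (k : ℕ) (θ : ℕ → ℝ) (m i : ℕ) :
    ∫ y in (0 : ℝ)..1, haarSum k θ y * constraintFun ε C m i y =
      if i < 2 ^ m ∧ m = k then weight ε k * (θ i / (2 * 2 ^ k)) else 0 := by
  have hz : ∀ y ∈ hid ε m, haarSum k θ y = 0 := fun y hy =>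
    haarSum_eq_zero_of_lt hε' k θ (hid_subset hε m hy).2
  by_cases hi : i < 2 ^ m
  · have hpt : ∀ y, haarSum k θ y * constraintFun ε C m i y =
        weight ε m * (haarSum k θ y * haar m i y) := by
      intro y
      rw [constraintFun, if_pos hi]
      by_cases h : y ∈ hid ε m
      · rw [hz y h]
        ring
      · rw [hidVal, Set.indicator_of_notMem h]
        ring
    simp_rw [hpt]
    rw [intervalIntegral.integral_const_mul]
    by_cases hmk : m = k
    · subst hmk
      rw [if_pos ⟨hi, rfl⟩, integral_haarSum_mul_haar_self m θ hi]
    · rw [if_neg fun h => hmk h.2, integral_haarSum_mul_haar_of_ne (Ne.symm hmk) θ hi, mul_zero]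
  · rw [if_neg fun h => hi h.1]
    have hpt : ∀ y, haarSum k θ y * constraintFun ε C m i y = 0 := by
      intro y
      rw [constraintFun, if_neg hi]
      by_cases h : y ∈ hid ε m
      · rw [hz y h, zero_mul]
      · rw [Set.indicator_of_notMem h, mul_zero]
    simp_rw [hpt]
    simp

include hε hε' in
-- The change is confined to the hidden interval of its own level, where all Haar functions vanish.
-- It keeps the hidden mass, so the mass constraint does not move.
theorem integral_bump_mul_constraintFun {k l : ℕ} (hl : l < C.size k) (m i : ℕ) :
    ∫ y in (0 : ℝ)..1, bump ε C k l y * constraintFun ε C m i y =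
      if i < 2 ^ m ∧ m = k then -(hidMass ε k * C.letter k l i - hidMean ε C k i) else 0 := by
  have hh : ∀ y ∈ hid ε k, ∀ n j, j < 2 ^ n → haar n j y = 0 := fun y hy n j hj =>
    haar_eq_zero_of_notMem hj fun h => by linarith [h.1, (hid_subset hε k hy).2]
  by_cases hmk : m = k
  · subst hmk
    by_cases hi : i < 2 ^ m
    · rw [if_pos ⟨hi, rfl⟩, ← integral_bump_mul_hidVal C hε hε' hl,
        ← intervalIntegral.integral_neg]
      congr 1
      ext y
      rw [constraintFun, if_pos hi, mul_sub, mul_left_comm,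
        bump_mul_eq_zero C hε hl fun y hy => hh y hy m i hi]
      ring
    · rw [if_neg fun h => hi h.1]
      refine Eq.trans ?_ (integral_bump C hε hε' hl)
      congr 1
      ext y
      rw [constraintFun, if_neg hi]
      by_cases h : y ∈ hid ε m
      · rw [Set.indicator_of_mem h, mul_one]
      · rw [bump_of_notMem C hε hl h, zero_mul]
  · rw [if_neg fun h => hmk h.2]
    have hpt : ∀ y, bump ε C k l y * constraintFun ε C m i y = 0 := by
      refine bump_mul_eq_zero C hε hl fun y hy => ?_
      have := notMem_hid_of_mem_hid hε (Ne.symm hmk) hy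
      unfold constraintFun
      split_ifs with hi
      · rw [hh y hy m i hi, hidVal, Set.indicator_of_notMem this, mul_zero, sub_zero]
      · rw [Set.indicator_of_notMem this]
    simp_rw [hpt]
    simp

include hε hε' in
theorem integral_wordDensity {k l : ℕ} (hl : l < C.size k) :
    ∫ y in (0 : ℝ)..1, wordDensity ε C k l y = 1 := by
  unfold wordDensity
  rw [intervalIntegral.integral_add (isBddMeasurable_base.intervalIntegrable _ _)
    (((isBddMeasurable_haarSum _ _).add (isBddMeasurable_bump C k l)).intervalIntegrable _ _),
    intervalIntegral.integral_add ((isBddMeasurable_haarSum _ _).intervalIntegrable _ _)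
    ((isBddMeasurable_bump C k l).intervalIntegrable _ _), integral_base hε hε', integral_haarSum,
    integral_bump C hε hε' hl]
  ring

include hε hε' in
/-- The densities that select a word satisfy all constraints. -/
theorem integral_wordDensity_mul_constraintFun {k l : ℕ} (hl : l < C.size k) (m i : ℕ) :
    ∫ y in (0 : ℝ)..1, wordDensity ε C k l y * constraintFun ε C m i y =
      ∫ y in (0 : ℝ)..1, base ε y * constraintFun ε C m i y := by
  have hw := weight_pos hε k
  have hc := isBddMeasurable_constraintFun (ε := ε) C m i
  unfold wordDensity
  simp_rw [add_mul]
  rw [intervalIntegral.integral_add ((isBddMeasurable_base.mul hc).intervalIntegrable _ _)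
    ((((isBddMeasurable_haarSum _ _).mul hc).add
      ((isBddMeasurable_bump C k l).mul hc)).intervalIntegrable _ _),
    intervalIntegral.integral_add (((isBddMeasurable_haarSum _ _).mul hc).intervalIntegrable _ _)
    (((isBddMeasurable_bump C k l).mul hc).intervalIntegrable _ _),
    integral_haarSum_mul_constraintFun C hε hε', integral_bump_mul_constraintFun C hε hε' hl]
  split_ifs
  -- The coefficients are defined so that the Haar part cancels the change of the hidden mean.
  · rw [wordCoeff]
    field_simp
    ring
  · ring

include hε' in
theorem base_mul_haar (k : ℕ) {i : ℕ} (hi : i < 2 ^ k) (y : ℝ) :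
    base ε y * haar k i y = (1 - ε ^ 2 / 2) / (1 - ε) * haar k i y := by
  by_cases h : y ∈ Set.Ico (1 / 2 : ℝ) 1
  · rw [base_of_ge ⟨by linarith [h.1], h.2⟩]
  · rw [haar_eq_zero_of_notMem hi h, mul_zero, mul_zero]

include hε' in
theorem integral_base_mul_constraintFun_of_lt (k : ℕ) {i : ℕ} (hi : i < 2 ^ k) :
    ∫ y in (0 : ℝ)..1, base ε y * constraintFun ε C k i y = -hidMean ε C k i := by
  have hpt : ∀ y, base ε y * constraintFun ε C k i y =
      weight ε k * ((1 - ε ^ 2 / 2) / (1 - ε)) * haar k i y - base ε y * hidVal ε C k i y := by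
    intro y
    rw [constraintFun, if_pos hi, mul_sub, mul_left_comm, base_mul_haar hε' k hi]
    ring
  simp_rw [hpt]
  rw [intervalIntegral.integral_sub
    (((isBddMeasurable_haar k i).const_mul _).intervalIntegrable _ _)
    ((isBddMeasurable_base.mul (isBddMeasurable_hidVal C k i)).intervalIntegrable _ _),
    intervalIntegral.integral_const_mul, integral_haar k hi, hidMean]
  ring

include hε hε' in
theorem integral_base_mul_constraintFun_of_ge (k : ℕ) {i : ℕ} (hi : ¬ i < 2 ^ k) :
    ∫ y in (0 : ℝ)..1, base ε y * constraintFun ε C k i y = hidMass ε k := by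
  rw [← integral_hid_id hε hε']
  congr 1
  ext y
  rw [constraintFun, if_neg hi, base_mul_hid hε]

include hε hε' in
theorem abs_constraintFun_le (k i : ℕ) (y : ℝ) : |constraintFun ε C k i y| ≤ 2 := by
  have h1 : |(hid ε k).indicator (fun _ => (1 : ℝ)) y| ≤ 1 := by
    by_cases h : y ∈ hid ε k <;> simp [h]
  unfold constraintFun
  split_ifs
  · have h2 : |weight ε k * haar k i y| ≤ 1 := by
      rw [abs_mul, abs_of_pos (weight_pos hε k)]
      exact mul_le_one₀ (weight_le_one hε hε' k) (abs_nonneg _) (abs_haar_le k i y)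
    have h3 := (abs_hidVal_le C k i y).trans ((le_abs_self _).trans h1)
    exact (abs_sub _ _).trans (by linarith)
  · linarith

include hε hε' in
theorem abs_hidMean_le (k i : ℕ) : |hidMean ε C k i| ≤ hidMass ε k := by
  rw [← integral_hid_id hε hε', hidMean]
  refine (intervalIntegral.abs_integral_le_integral_abs zero_le_one).trans
    (intervalIntegral.integral_mono zero_le_one ?_
      ((isBddMeasurable_hid_id k).intervalIntegrable _ _) fun y => ?_)
  · exact ((isBddMeasurable_base.mul (isBddMeasurable_hidVal C k i)).intervalIntegrable _ _).abs
  · rw [abs_mul, abs_of_nonneg (base_nonneg hε hε' y), ← base_mul_hid hε]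
    exact mul_le_mul_of_nonneg_left (abs_hidVal_le C k i y) (base_nonneg hε hε' y)

include hε hε' in
-- The hidden mean can move by at most twice the hidden mass; `weight` is calibrated so that this
-- costs exactly ε in the visible density.
theorem abs_wordCoeff_le (k l i : ℕ) : |wordCoeff ε C k l i| ≤ ε := by
  have hw := weight_pos hε k
  have hm := hidMass_pos hε k
  have h1 : |hidMass ε k * C.letter k l i - hidMean ε C k i| ≤ 2 * hidMass ε k := by
    refine (abs_sub _ _).trans ?_
    rw [abs_mul, abs_of_pos hm]
    have := mul_le_of_le_one_right hm.le (C.abs_letter_le k l i)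
    linarith [abs_hidMean_le C hε hε' k i]
  rw [wordCoeff, abs_mul, abs_of_pos (by positivity)]
  calc 2 * 2 ^ k / weight ε k * |hidMass ε k * C.letter k l i - hidMean ε C k i|
      ≤ 2 * 2 ^ k / weight ε k * (2 * hidMass ε k) := by gcongr
    _ = ε := by
      unfold weight
      field_simp
      ring

include hε hε' in
-- The default density decreases linearly to 0 at the origin, so the hidden mass is of order `top`².
-- Even piled onto one of at most 2^(2^k) cells it has height at most 1, since `size` times `top` is
-- at most ε. On the visible part a height between 1 and 1 + 2ε is perturbed by at most ε. This
-- leaves room under any bound larger than 1.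
theorem wordDensity_mem {k l : ℕ} (hl : l < C.size k) (y : ℝ) :
    0 ≤ wordDensity ε C k l y ∧ wordDensity ε C k l y ≤ 1 + 3 * ε := by
  have hv := base_height_mem hε hε'
  have hH := abs_le.1 (abs_haarSum_le k hε.le
    (fun i _ => abs_wordCoeff_le C hε hε' k l i) y)
  unfold wordDensity
  by_cases h : y ∈ hid ε k
  · have h2 := hid_subset hε k h
    rw [base_of_lt h2, haarSum_eq_zero_of_lt hε' k _ h2.2, bump, Set.indicator_of_mem h]
    have hm := hidMass_pos hε k
    have hc := cellLength_pos C hε k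
    have hcell : hidMass ε k / cellLength ε C k ≤ 1 := by
      rw [div_le_one hc]
      have hs : (0 : ℝ) < C.size k := by exact_mod_cast C.size_pos k
      have ht := top_pos hε k
      have hst : C.size k * top ε k ≤ 1 := by
        have h4 : (C.size k : ℝ) ≤ 2 ^ 2 ^ k := by exact_mod_cast C.size_le k
        calc C.size k * top ε k ≤ 2 ^ 2 ^ k * top ε k := by gcongr
          _ = ε := by unfold top; field_simp
          _ ≤ 1 := by linarith
      unfold hidMass cellLength
      rw [le_div_iff₀ (by positivity)]
      nlinarith
    by_cases hc' : y ∈ cell ε C k l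
    · rw [Set.indicator_of_mem hc']
      have : 0 ≤ hidMass ε k / cellLength ε C k := by positivity
      constructor <;> linarith
    · rw [Set.indicator_of_notMem hc']
      constructor <;> linarith
  · rw [bump_of_notMem C hε hl h, add_zero]
    by_cases h1 : y ∈ Set.Ico 0 ε
    · rw [base_of_lt h1, haarSum_eq_zero_of_lt hε' k _ h1.2]
      constructor <;> linarith [h1.1, h1.2]
    · by_cases h2 : y ∈ Set.Ico ε 1
      · rw [base_of_ge h2]
        constructor <;> linarith
      · have h3 : y ∉ Set.Ico (0 : ℝ) 1 := by
          intro h3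
          rcases lt_or_ge y ε with h4 | h4
          · exact h1 ⟨h3.1, h4⟩
          · exact h2 ⟨h4, h3.2⟩
        rw [base_of_notMem hε hε' h3, haarSum_eq_zero_of_notMem k _ fun h4 =>
          h3 ⟨by linarith [h4.1], h4.2⟩]
        constructor <;> linarith

include hε hε' in
theorem wordDensity_of_notMem {k l : ℕ} (hl : l < C.size k) {y : ℝ}
    (hy : y ∉ Set.Ico (0 : ℝ) 1) : wordDensity ε C k l y = 0 := by
  rw [wordDensity, base_of_notMem hε hε' hy, haarSum_eq_zero_of_notMem k _ fun h4 =>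
    hy ⟨by linarith [h4.1], h4.2⟩, bump_of_notMem C hε hl fun h => hy ?_]
  · ring
  · have := hid_subset hε k h
    exact ⟨this.1, by linarith [this.2]⟩

include hε hε' in
theorem isPiecewiseContinuous_wordDensity (k l : ℕ) :
    IsPiecewiseContinuous (wordDensity ε C k l) := by
  have h1 := top_pos hε k
  have h2 := cellLength_pos C hε k
  unfold wordDensity base haarSum bump
  refine IsPiecewiseContinuous.add (IsPiecewiseContinuous.add
    (.indicator_Ico continuous_id hε.le) (.indicator_Ico continuous_const (by linarith)))
    (IsPiecewiseContinuous.add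
      (.sum _ fun i _ => (isPiecewiseContinuous_haar k i).const_mul _)
      (IsPiecewiseContinuous.sub (.indicator_Ico continuous_const (by linarith))
        (.indicator_Ico continuous_id (by linarith))))

include hε hε' in
theorem isAdmissible_wordDensity {k l : ℕ} (hl : l < C.size k) {cmax : ℝ}
    (hc : 1 + 3 * ε ≤ cmax) : IsAdmissible cmax fun x => wordDensity ε C k l (fold x) :=
  isAdmissible_fold (isPiecewiseContinuous_wordDensity C hε hε' k l)
    (isBddMeasurable_wordDensity C k l) (fun _ hy => wordDensity_of_notMem C hε hε' hl hy)
    (fun y => (wordDensity_mem C hε hε' hl y).1)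
    (fun y => (wordDensity_mem C hε hε' hl y).2.trans hc) (integral_wordDensity C hε hε' hl)

include hε hε' in
/-- The mean of a Haar sum under the density that selects a word. -/
theorem integral_wordDensity_mul_haarSum {k l : ℕ} (hl : l < C.size k) (θ : ℕ → ℝ) :
    weight ε k * ∫ y in (0 : ℝ)..1, wordDensity ε C k l y * haarSum k θ y =
      ∑ i ∈ Finset.range (2 ^ k), θ i * (hidMass ε k * C.letter k l i - hidMean ε C k i) := by
  have hw := weight_pos hε k
  have hd := isBddMeasurable_wordDensity (ε := ε) C k l
  have hpt : ∀ y, wordDensity ε C k l y * haarSum k θ y =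
      ∑ i ∈ Finset.range (2 ^ k), θ i * (wordDensity ε C k l y * haar k i y) := by
    intro y
    rw [haarSum, Finset.mul_sum]
    exact Finset.sum_congr rfl fun i _ => by ring
  simp_rw [hpt]
  rw [intervalIntegral.integral_finsetSum fun i _ =>
    ((hd.mul (isBddMeasurable_haar k i)).const_mul _).intervalIntegrable _ _, Finset.mul_sum]
  refine Finset.sum_congr rfl fun i hi => ?_
  have hi' := Finset.mem_range.1 hi
  have hpt2 : ∀ y, wordDensity ε C k l y * haar k i y =
      (1 - ε ^ 2 / 2) / (1 - ε) * haar k i y + haarSum k (wordCoeff ε C k l) y * haar k i y := by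
    intro y
    rw [wordDensity, add_mul, add_mul, base_mul_haar hε' k hi',
      bump_mul_eq_zero C hε hl (F := haar k i) fun z hz => haar_eq_zero_of_notMem hi' fun h => by
        linarith [h.1, (hid_subset hε k hz).2]]
    ring
  rw [intervalIntegral.integral_const_mul]
  simp_rw [hpt2]
  rw [intervalIntegral.integral_add (((isBddMeasurable_haar k i).const_mul _).intervalIntegrable _ _)
    (((isBddMeasurable_haarSum _ _).mul (isBddMeasurable_haar k i)).intervalIntegrable _ _),
    intervalIntegral.integral_const_mul, integral_haar k hi',
    integral_haarSum_mul_haar_self k _ hi', wordCoeff]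
  field_simp
  ring

/-- The correlation of the signs `θ` with the word of a cell. -/
theorem sum_mul_hidVal (k : ℕ) (θ : ℕ → ℝ) (y : ℝ) :
    ∑ i ∈ Finset.range (2 ^ k), θ i * hidVal ε C k i y =
      (hid ε k).indicator (fun y => ∑ i ∈ Finset.range (2 ^ k),
        θ i * C.letter k (cellIndex ε C k y) i) y := by
  by_cases h : y ∈ hid ε k
  · rw [Set.indicator_of_mem h]
    simp_rw [hidVal, Set.indicator_of_mem h]
  · rw [Set.indicator_of_notMem h]
    simp_rw [hidVal, Set.indicator_of_notMem h, mul_zero, Finset.sum_const_zero]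

theorem sum_mul_hidMean (k : ℕ) (θ : ℕ → ℝ) :
    ∑ i ∈ Finset.range (2 ^ k), θ i * hidMean ε C k i =
      ∫ y in (0 : ℝ)..1, base ε y * ∑ i ∈ Finset.range (2 ^ k), θ i * hidVal ε C k i y := by
  have hpt : ∀ y, base ε y * ∑ i ∈ Finset.range (2 ^ k), θ i * hidVal ε C k i y =
      ∑ i ∈ Finset.range (2 ^ k), θ i * (base ε y * hidVal ε C k i y) := by
    intro y
    rw [Finset.mul_sum]
    exact Finset.sum_congr rfl fun i _ => by ring
  simp_rw [hpt]
  rw [intervalIntegral.integral_finsetSum fun i _ => ((isBddMeasurable_base.mul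
    (isBddMeasurable_hidVal C k i)).const_mul _).intervalIntegrable _ _]
  exact Finset.sum_congr rfl fun i _ => by rw [intervalIntegral.integral_const_mul, hidMean]

include hε hε' in
-- The sum is an average of the correlations of θ with the words, taken over the hidden interval.
theorem neg_sum_mul_hidMean_le (k : ℕ) (θ : ℕ → ℝ) {B : ℝ}
    (hB : ∀ j < C.size k, |∑ i ∈ Finset.range (2 ^ k), θ i * C.letter k j i| ≤ B) :
    -∑ i ∈ Finset.range (2 ^ k), θ i * hidMean ε C k i ≤ B * hidMass ε k := by
  rw [sum_mul_hidMean, ← intervalIntegral.integral_neg, ← integral_hid_id hε hε',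
    ← intervalIntegral.integral_const_mul]
  have hs := (isBddMeasurable_base (ε := ε)).mul (IsBddMeasurable.sum (Finset.range (2 ^ k))
    fun i _ => (isBddMeasurable_hidVal (ε := ε) C k i).const_mul (θ i))
  refine intervalIntegral.integral_mono zero_le_one (hs.intervalIntegrable _ _).neg
    (((isBddMeasurable_hid_id k).const_mul _).intervalIntegrable _ _) fun y => ?_
  simp only
  rw [sum_mul_hidVal, ← base_mul_hid hε]
  by_cases h : y ∈ hid ε k
  · rw [Set.indicator_of_mem h, Set.indicator_of_mem h]
    have h1 := (abs_le.1 (hB _ (cellIndex_lt C hε h))).1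
    nlinarith [base_nonneg hε hε' y]
  · rw [Set.indicator_of_notMem h, Set.indicator_of_notMem h]
    simp

include hε hε' in
-- Only the cell of `l` can see the large correlation B', and there the default density y is at most
-- `top`. All other cells contribute at most B times their mass.
theorem sum_mul_hidMean_le {k l : ℕ} (hl : l < C.size k) (θ : ℕ → ℝ) {B B' : ℝ} (hB0 : 0 ≤ B)
    (hB0' : 0 ≤ B')
    (hB : ∀ j < C.size k, j ≠ l → ∑ i ∈ Finset.range (2 ^ k), θ i * C.letter k j i ≤ B)
    (hB' : ∑ i ∈ Finset.range (2 ^ k), θ i * C.letter k l i ≤ B') :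
    ∑ i ∈ Finset.range (2 ^ k), θ i * hidMean ε C k i ≤
      B * hidMass ε k + B' * (top ε k * cellLength ε C k) := by
  have ht := top_pos hε k
  rw [sum_mul_hidMean, mul_comm (top ε k), ← integral_cell_const C hε hε' hl,
    ← integral_hid_id hε hε', ← intervalIntegral.integral_const_mul,
    ← intervalIntegral.integral_const_mul, ← intervalIntegral.integral_add
      (((isBddMeasurable_hid_id k).const_mul _).intervalIntegrable _ _)
      (((IsBddMeasurable.indicator_const (measurableSet_cell C k l) _).const_mul
        _).intervalIntegrable _ _)]
  have hs := (isBddMeasurable_base (ε := ε)).mul (IsBddMeasurable.sum (Finset.range (2 ^ k))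
    fun i _ => (isBddMeasurable_hidVal (ε := ε) C k i).const_mul (θ i))
  refine intervalIntegral.integral_mono zero_le_one (hs.intervalIntegrable _ _)
    ((((isBddMeasurable_hid_id k).const_mul _).add
      ((IsBddMeasurable.indicator_const (measurableSet_cell C k l) _).const_mul
        _)).intervalIntegrable _ _) fun y => ?_
  simp only
  rw [sum_mul_hidVal]
  by_cases h : y ∈ hid ε k
  · have hy0 := (hid_subset hε k h).1
    rw [Set.indicator_of_mem h, Set.indicator_of_mem h, base_of_lt (hid_subset hε k h)]
    by_cases hc : y ∈ cell ε C k l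
    · rw [Set.indicator_of_mem hc, cellIndex_of_mem C hε hc]
      have := h.2.le
      nlinarith
    · rw [Set.indicator_of_notMem hc]
      have hne : cellIndex ε C k y ≠ l := by
        rintro rfl
        exact hc (mem_cell_cellIndex C hε h)
      have := hB _ (cellIndex_lt C hε h) hne
      nlinarith
  · rw [Set.indicator_of_notMem h, Set.indicator_of_notMem h,
      Set.indicator_of_notMem fun hc => h (cell_subset_hid C hε hl hc)]
    simp

include hε hε' in
/-- The mean of a Haar sum under an arbitrary density that satisfies the constraints. -/
theorem integral_mul_haarSum_le {cmax : ℝ} {p : unitInterval → ℝ} (hp : IsAdmissible cmax p)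
    (hcon : ∀ k i, ∫ x, p x * constraintFun ε C k i (fold x) =
      ∫ y in (0 : ℝ)..1, base ε y * constraintFun ε C k i y)
    (k : ℕ) (θ : ℕ → ℝ) {B : ℝ}
    (hB : ∀ j < C.size k, ∑ i ∈ Finset.range (2 ^ k), θ i * C.letter k j i ≤ B) :
    weight ε k * ∫ x, p x * haarSum k θ (fold x) ≤
      B * hidMass ε k - ∑ i ∈ Finset.range (2 ^ k), θ i * hidMean ε C k i := by
  have hI : ∀ {f : ℝ → ℝ}, IsBddMeasurable f → Integrable (fun x => p x * f (fold x)) := by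
    intro f hf
    obtain ⟨D, hD⟩ := hf.bdd
    exact hp.integrable_mul (hf.measurable.comp measurable_fold) fun x => hD _
  -- The coupling constraints turn the weighted Haar mean into the mean, over the hidden interval,
  -- of the correlation of θ with the word of the cell.
  have h1 : weight ε k * (∫ x, p x * haarSum k θ (fold x)) +
      ∑ i ∈ Finset.range (2 ^ k), θ i * hidMean ε C k i =
      ∫ x, p x * ∑ i ∈ Finset.range (2 ^ k), θ i * hidVal ε C k i (fold x) := by
    have e1 : ∀ x, p x * haarSum k θ (fold x) =
        ∑ i ∈ Finset.range (2 ^ k), θ i * (p x * haar k i (fold x)) := by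
      intro x
      rw [haarSum, Finset.mul_sum]
      exact Finset.sum_congr rfl fun i _ => by ring
    have e2 : ∀ x, p x * ∑ i ∈ Finset.range (2 ^ k), θ i * hidVal ε C k i (fold x) =
        ∑ i ∈ Finset.range (2 ^ k), θ i * (p x * hidVal ε C k i (fold x)) := by
      intro x
      rw [Finset.mul_sum]
      exact Finset.sum_congr rfl fun i _ => by ring
    simp_rw [e1, e2]
    rw [integral_finsetSum _ fun i _ => (hI (isBddMeasurable_haar k i)).const_mul _,
      integral_finsetSum _ fun i _ => (hI (isBddMeasurable_hidVal C k i)).const_mul _,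
      Finset.mul_sum, ← Finset.sum_add_distrib]
    refine Finset.sum_congr rfl fun i hi => ?_
    have hi' := Finset.mem_range.1 hi
    have h2 := hcon k i
    rw [integral_base_mul_constraintFun_of_lt C hε' k hi'] at h2
    simp_rw [constraintFun, if_pos hi', mul_sub, mul_left_comm (p _)] at h2
    rw [integral_sub ((hI (isBddMeasurable_haar k i)).const_mul _)
      (hI (isBddMeasurable_hidVal C k i)), integral_const_mul] at h2
    rw [integral_const_mul, integral_const_mul]
    linear_combination θ i * h2
  -- Any index from 2^k on gives the constraint on the hidden mass.
  have h3 := hcon k (2 ^ k)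
  rw [integral_base_mul_constraintFun_of_ge C hε hε' k (lt_irrefl _)] at h3
  simp_rw [constraintFun, if_neg (lt_irrefl _)] at h3
  have h4 : ∫ x, p x * ∑ i ∈ Finset.range (2 ^ k), θ i * hidVal ε C k i (fold x) ≤
      B * hidMass ε k := by
    rw [← h3, ← integral_const_mul]
    refine integral_mono (hI (IsBddMeasurable.sum (Finset.range (2 ^ k))
      fun i _ => (isBddMeasurable_hidVal (ε := ε) C k i).const_mul (θ i)))
      ((hI (isBddMeasurable_hid k)).const_mul _) fun x => ?_
    simp only
    rw [sum_mul_hidVal]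
    by_cases h : fold x ∈ hid ε k
    · rw [Set.indicator_of_mem h, Set.indicator_of_mem h]
      nlinarith [hp.nonneg x, hB _ (cellIndex_lt C hε h)]
    · rw [Set.indicator_of_notMem h, Set.indicator_of_notMem h]
      simp
  linarith

end Hidden

/-! ### Harvesting functions of bounded variation -/

section Variation

theorem eVariationOn_le_mul_of_edist_le {α : Type*} [LinearOrder α] {E F : Type*}
    [PseudoEMetricSpace E] [PseudoEMetricSpace F] {f : α → E} {g : α → F} {s : Set α} {L : ℝ≥0∞}
    (h : ∀ x y, edist (f x) (f y) ≤ L * edist (g x) (g y)) :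
    eVariationOn f s ≤ L * eVariationOn g s := by
  refine iSup_le fun q => ?_
  calc ∑ i ∈ Finset.range q.1, edist (f ((q.2 : ℕ → α) (i + 1))) (f ((q.2 : ℕ → α) i))
      ≤ ∑ i ∈ Finset.range q.1, L * edist (g ((q.2 : ℕ → α) (i + 1))) (g ((q.2 : ℕ → α) i)) :=
        Finset.sum_le_sum fun i _ => h _ _
    _ = L * ∑ i ∈ Finset.range q.1, edist (g ((q.2 : ℕ → α) (i + 1))) (g ((q.2 : ℕ → α) i)) := by
        rw [Finset.mul_sum]
    _ ≤ L * eVariationOn g s := by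
        gcongr
        exact eVariationOn.sum_le q.2.2.1 q.2.2.2

/-- A function with values of modulus at most `δ` that only depends on `⌊n x⌋` has variation at most
`2 δ n`. -/
theorem eVariationOn_le_of_floor {f : unitInterval → ℝ} {n : ℕ} {a δ : ℝ}
    (hδ : ∀ x, |f x - a| ≤ δ)
    (hf : ∀ x y : unitInterval, ⌊n * (x : ℝ)⌋₊ = ⌊n * (y : ℝ)⌋₊ → f x = f y) :
    eVariationOn f Set.univ ≤ ENNReal.ofReal (2 * δ * n) := by
  set s : unitInterval → ℝ := fun x => (⌊n * (x : ℝ)⌋₊ : ℝ)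
  have hδ0 : 0 ≤ δ := (abs_nonneg _).trans (hδ 0)
  -- Distinct floors differ by at least 1 while f oscillates by at most 2δ, so f is 2δ-Lipschitz
  -- relative to a monotone step function of total variation n.
  have h1 : ∀ x y, edist (f x) (f y) ≤ ENNReal.ofReal (2 * δ) * edist (s x) (s y) := by
    intro x y
    rw [edist_dist, edist_dist, ← ENNReal.ofReal_mul (by positivity), Real.dist_eq, Real.dist_eq]
    refine ENNReal.ofReal_le_ofReal ?_
    by_cases h : ⌊n * (x : ℝ)⌋₊ = ⌊n * (y : ℝ)⌋₊
    · rw [hf x y h, sub_self, abs_zero]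
      positivity
    · have h2 : |f x - f y| ≤ 2 * δ := by
        have := abs_sub_le (f x) a (f y)
        rw [abs_sub_comm a] at this
        linarith [hδ x, hδ y]
      have h3 : (1 : ℝ) ≤ |s x - s y| := by
        simp only [s]
        rcases lt_or_gt_of_ne h with h | h
        · have h' : (⌊n * (x : ℝ)⌋₊ : ℝ) + 1 ≤ ⌊n * (y : ℝ)⌋₊ := by exact_mod_cast h
          rw [abs_sub_comm]
          exact le_trans (by linarith) (le_abs_self _)
        · have h' : (⌊n * (y : ℝ)⌋₊ : ℝ) + 1 ≤ ⌊n * (x : ℝ)⌋₊ := by exact_mod_cast h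
          exact le_trans (by linarith) (le_abs_self _)
      nlinarith
  have hmono : Monotone s := by
    intro x y hxy
    have : (x : ℝ) ≤ y := hxy
    simp only [s]
    gcongr
  have h2 : eVariationOn s Set.univ ≤ ENNReal.ofReal n := by
    have h := (MonotoneOn.eVariationOn_eq (s := Set.univ) (hmono.monotoneOn _)
      (Set.mem_univ (0 : unitInterval)) (Set.mem_univ 1)).le
    have hI : (Set.univ : Set unitInterval) ∩ Set.Icc 0 1 = Set.univ :=
      Set.eq_univ_of_forall fun x => ⟨Set.mem_univ _, unitInterval.nonneg', unitInterval.le_one'⟩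
    rw [hI] at h
    refine h.trans (ENNReal.ofReal_le_ofReal ?_)
    simp [s]
  calc eVariationOn f Set.univ ≤ ENNReal.ofReal (2 * δ) * eVariationOn s Set.univ :=
        eVariationOn_le_mul_of_edist_le h1
    _ ≤ ENNReal.ofReal (2 * δ) * ENNReal.ofReal n := by gcongr
    _ = ENNReal.ofReal (2 * δ * n) := by rw [← ENNReal.ofReal_mul (by positivity)]

/-- The harvesting function with base level `a` and oscillations `δ θ`. -/
noncomputable def harvest (a δ : ℝ) (k : ℕ) (θ : ℕ → ℝ) (x : unitInterval) : ℝ :=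
  a + δ * haarSum k θ (fold x)

/-- `fold` doubles x and subtracts 1 on the right half, which shifts the index by 4·2^k. A Haar sum
after folding therefore depends only on ⌊8·2^k x⌋. -/
theorem floor_fold (k : ℕ) (x : unitInterval) :
    ⌊4 * 2 ^ k * fold x⌋₊ =
      if ⌊((8 * 2 ^ k : ℕ) : ℝ) * (x : ℝ)⌋₊ < 4 * 2 ^ k then ⌊((8 * 2 ^ k : ℕ) : ℝ) * (x : ℝ)⌋₊
      else ⌊((8 * 2 ^ k : ℕ) : ℝ) * (x : ℝ)⌋₊ - 4 * 2 ^ k := by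
  have hk : (0 : ℝ) < 2 ^ k := by positivity
  have h : ⌊((8 * 2 ^ k : ℕ) : ℝ) * (x : ℝ)⌋₊ < 4 * 2 ^ k ↔ (x : ℝ) < 1 / 2 := by
    rw [Nat.floor_lt' (by positivity)]
    push_cast
    constructor <;> intro h <;> nlinarith
  simp only [h, fold]
  split_ifs with hx
  · congr 1
    push_cast
    ring
  · rw [← Nat.floor_sub_natCast]
    congr 1
    push_cast
    ring

theorem abs_harvest_sub_le {a δ : ℝ} (hδ : 0 ≤ δ) (k : ℕ) {θ : ℕ → ℝ} (hθ : ∀ i, |θ i| ≤ 1)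
    (x : unitInterval) : |harvest a δ k θ x - a| ≤ δ := by
  rw [harvest, add_sub_cancel_left, abs_mul, abs_of_nonneg hδ]
  exact mul_le_of_le_one_right hδ (abs_haarSum_le k zero_le_one (fun i _ => hθ i) _)

theorem harvest_mem_BV {K : ℝ≥0} {a δ : ℝ} (hδ : 0 ≤ δ) (k : ℕ) (hK : 16 * 2 ^ k * δ ≤ K)
    {θ : ℕ → ℝ} (hθ : ∀ i, |θ i| ≤ 1) : harvest a δ k θ ∈ BV K := by
  have h := eVariationOn_le_of_floor (f := harvest a δ k θ) (n := 8 * 2 ^ k)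
    (abs_harvest_sub_le hδ k hθ) fun x y hxy => by
      simp only [harvest, haarSum, haar, floor_fold, hxy]
  refine h.trans ?_
  rw [← ENNReal.ofReal_coe_nnreal]
  refine ENNReal.ofReal_le_ofReal ?_
  push_cast
  linarith

end Variation

/-! ### The channel of a code and its energy capacities -/

section EnergyCapacity

variable {ε : ℝ} (C : CodeSequence)

/-- A channel for which the inputs of maximal mutual information satisfy the constraints, and
include the densities that select a word. -/
theorem exists_channel_of_code (hε : 0 < ε) (hε' : ε ≤ 1 / 2) {cmax : ℝ} (hc : 1 + 3 * ε ≤ cmax) :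
    ∃ (W : Kernel unitInterval (ℕ × ℝ)) (_ : IsMarkovKernel W) (R : ℝ≥0),
      (R : ℝ≥0∞) = capacity W cmax ∧
      (∀ p, IsAdmissible cmax p → (R : ℝ≥0∞) ≤ mutualInfo W p → ∀ k i,
        ∫ x, p x * constraintFun ε C k i (fold x) =
          ∫ y in (0 : ℝ)..1, base ε y * constraintFun ε C k i y) ∧
      ∀ k, ∀ l < C.size k, (R : ℝ≥0∞) ≤ mutualInfo W fun x => wordDensity ε C k l (fold x) := by
  set r : ℕ → ℕ → ℝ := fun k i => ∫ y in (0 : ℝ)..1, base ε y * constraintFun ε C k i y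
  have hr : ∀ k i, |r k i| ≤ 2 := by
    intro k i
    refine (intervalIntegral.abs_integral_le_integral_abs zero_le_one).trans ?_
    have h2 : ∫ y in (0 : ℝ)..1, base ε y * 2 = 2 := by
      rw [intervalIntegral.integral_mul_const, integral_base hε hε', one_mul]
    rw [← h2]
    have hI := (isBddMeasurable_base (ε := ε)).mul (isBddMeasurable_constraintFun (ε := ε) C k i)
    refine intervalIntegral.integral_mono zero_le_one (hI.intervalIntegrable _ _).abs
      ((isBddMeasurable_base.mul (IsBddMeasurable.const 2)).intervalIntegrable _ _) fun y => ?_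
    simp only
    rw [abs_mul, abs_of_nonneg (base_nonneg hε hε' y)]
    exact mul_le_mul_of_nonneg_left (abs_constraintFun_le C hε hε' k i y) (base_nonneg hε hε' y)
  -- The pairs (level, index) are enumerated by `Nat.unpair`. Subtracting the prescribed mean
  -- centres each constraint, and the factor 1/4 brings a difference of two terms bounded by 2 into
  -- [-1,1].
  set G : ℕ → ℝ → ℝ := fun n y =>
    1 / 4 * (constraintFun ε C n.unpair.1 n.unpair.2 y - r n.unpair.1 n.unpair.2)
  have hG : ∀ n, IsBddMeasurable (G n) := fun n =>
    ((isBddMeasurable_constraintFun C _ _).sub (IsBddMeasurable.const _)).const_mul _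
  have hG1 : ∀ n y, |G n y| ≤ 1 := by
    intro n y
    simp only [G]
    rw [abs_mul]
    have := abs_sub (constraintFun ε C n.unpair.1 n.unpair.2 y) (r n.unpair.1 n.unpair.2)
    have h3 := abs_constraintFun_le C hε hε' n.unpair.1 n.unpair.2 y
    have h4 := hr n.unpair.1 n.unpair.2
    rw [abs_of_nonneg (by norm_num : (0 : ℝ) ≤ 1 / 4)]
    linarith
  obtain ⟨W, hW, R, hR⟩ := exists_channel_of_constraints (fun n x => G n (fold x))
    (fun n => (hG n).measurable.comp measurable_fold) (fun n x => hG1 n _) halfSign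
    measurable_halfSign halfSign_sq
  have hword : ∀ k, ∀ l < C.size k,
      (R : ℝ≥0∞) ≤ mutualInfo W fun x => wordDensity ε C k l (fold x) := by
    intro k l hl
    rw [(hR cmax _ (isAdmissible_wordDensity C hε hε' hl hc)).2]
    intro n
    have hd := isBddMeasurable_wordDensity (ε := ε) C k l
    constructor
    · rw [integral_fold (A := fun y => wordDensity ε C k l y * G n y) (hd.mul (hG n))]
      have hpt : ∀ y, wordDensity ε C k l y * G n y =
          1 / 4 * (wordDensity ε C k l y * constraintFun ε C n.unpair.1 n.unpair.2 y -
            wordDensity ε C k l y * r n.unpair.1 n.unpair.2) := fun y => by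
        simp only [G]
        ring
      simp_rw [hpt]
      rw [intervalIntegral.integral_const_mul, intervalIntegral.integral_sub
        ((hd.mul (isBddMeasurable_constraintFun C _ _)).intervalIntegrable _ _)
        ((hd.mul (IsBddMeasurable.const _)).intervalIntegrable _ _),
        intervalIntegral.integral_mul_const, integral_wordDensity C hε hε' hl,
        integral_wordDensity_mul_constraintFun C hε hε' hl]
      simp [r]
    · have hs : IsBddMeasurable fun y => √(1 - G n y ^ 2) := by
        refine ⟨Real.continuous_sqrt.measurable.comp
          (measurable_const.sub ((hG n).measurable.pow_const 2)), 1, fun y => ?_⟩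
        rw [abs_of_nonneg (Real.sqrt_nonneg _), Real.sqrt_le_one]
        linarith [sq_nonneg (G n y)]
      have := integral_halfSign_mul_fold (hd.mul hs)
      rw [← this]
      congr 1
      ext x
      ring
  refine ⟨W, hW, R, le_antisymm ?_ (iSup₂_le fun p hp => (hR cmax p hp).1), ?_, hword⟩
  · exact (hword 0 0 (C.size_pos 0)).trans (le_iSup₂_of_le _
      (isAdmissible_wordDensity C hε hε' (C.size_pos 0) hc) le_rfl)
  · intro p hp hRp k i
    have h := (((hR cmax p hp).2.1 hRp) (Nat.pair k i)).1
    simp only [G, Nat.unpair_pair] at h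
    have hI : Integrable fun x => p x * constraintFun ε C k i (fold x) :=
      hp.integrable_mul ((isBddMeasurable_constraintFun C k i).measurable.comp measurable_fold)
        fun x => abs_constraintFun_le C hε hε' k i _
    have hpt : ∀ x, p x * (1 / 4 * (constraintFun ε C k i (fold x) - r k i)) =
        1 / 4 * (p x * constraintFun ε C k i (fold x) - p x * r k i) := fun x => by ring
    simp_rw [hpt] at h
    rw [integral_const_mul, integral_sub hI (hp.integrable.mul_const _), integral_mul_const,
      hp.integral_eq_one] at h
    linarith

variable (hε : 0 < ε) (hε' : ε ≤ 1 / 2) {cmax : ℝ} {W : Kernel unitInterval (ℕ × ℝ)} {R : ℝ≥0}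
  (hcon : ∀ p, IsAdmissible cmax p → (R : ℝ≥0∞) ≤ mutualInfo W p → ∀ k i,
    ∫ x, p x * constraintFun ε C k i (fold x) =
      ∫ y in (0 : ℝ)..1, base ε y * constraintFun ε C k i y)
  (hword : ∀ k, ∀ l < C.size k,
    (R : ℝ≥0∞) ≤ mutualInfo W fun x => wordDensity ε C k l (fold x))

theorem IsAdmissible.integral_mul_harvest {p : unitInterval → ℝ} (hp : IsAdmissible cmax p)
    (a δ : ℝ) (k : ℕ) (θ : ℕ → ℝ) :
    ∫ x, p x * harvest a δ k θ x = a + δ * ∫ x, p x * haarSum k θ (fold x) := by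
  obtain ⟨D, hD⟩ := (isBddMeasurable_haarSum k θ).bdd
  have hI : Integrable fun x => p x * haarSum k θ (fold x) := hp.integrable_mul
    ((isBddMeasurable_haarSum k θ).measurable.comp measurable_fold) fun x => hD _
  have hpt : ∀ x, p x * harvest a δ k θ x = p x * a + δ * (p x * haarSum k θ (fold x)) :=
    fun x => by rw [harvest]; ring
  simp_rw [hpt]
  rw [integral_add (hp.integrable.mul_const _) (hI.const_mul _), integral_mul_const,
    integral_const_mul, hp.integral_eq_one, one_mul]

include hε hε' hcon in
theorem integral_mul_harvest_le {p : unitInterval → ℝ} (hp : IsAdmissible cmax p)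
    (hRp : (R : ℝ≥0∞) ≤ mutualInfo W p) (a : ℝ) {δ : ℝ} (hδ : 0 ≤ δ) (k : ℕ) (θ : ℕ → ℝ) {B : ℝ}
    (hB : ∀ j < C.size k, ∑ i ∈ Finset.range (2 ^ k), θ i * C.letter k j i ≤ B) :
    ∫ x, p x * harvest a δ k θ x ≤ a + δ / weight ε k *
      (B * hidMass ε k - ∑ i ∈ Finset.range (2 ^ k), θ i * hidMean ε C k i) := by
  have hw := weight_pos hε k
  have h := integral_mul_haarSum_le C hε hε' hp (hcon p hp hRp) k θ hB
  rw [hp.integral_mul_harvest]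
  have h2 : δ * ∫ x, p x * haarSum k θ (fold x) =
      δ / weight ε k * (weight ε k * ∫ x, p x * haarSum k θ (fold x)) := by
    field_simp
  rw [h2]
  gcongr

include hε hε' hcon hword in
theorem energyCapacity_harvest_le (hc : 1 + 3 * ε ≤ cmax) (a : ℝ) {δ : ℝ} (hδ : 0 ≤ δ) (k : ℕ)
    (θ : ℕ → ℝ) {B : ℝ}
    (hB : ∀ j < C.size k, ∑ i ∈ Finset.range (2 ^ k), θ i * C.letter k j i ≤ B) :
    energyCapacity W cmax R (harvest a δ k θ) ≤ a + δ / weight ε k *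
      (B * hidMass ε k - ∑ i ∈ Finset.range (2 ^ k), θ i * hidMean ε C k i) := by
  refine csSup_le ⟨_, _, isAdmissible_wordDensity C hε hε' (C.size_pos 0) hc,
    hword 0 0 (C.size_pos 0), rfl⟩ ?_
  rintro _ ⟨p, hp, hRp, rfl⟩
  exact integral_mul_harvest_le C hε hε' hcon hp hRp a hδ k θ hB

include hε hε' hcon hword in
-- The density that selects `l` is a feasible input, and its Haar means are known exactly.
theorem le_energyCapacity_harvest (hc : 1 + 3 * ε ≤ cmax) (a : ℝ) {δ : ℝ} (hδ : 0 ≤ δ) {k l : ℕ}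
    (hl : l < C.size k) {θ : ℕ → ℝ} (hθ : ∀ i, |θ i| ≤ 1) :
    a + δ / weight ε k * ∑ i ∈ Finset.range (2 ^ k),
      θ i * (hidMass ε k * C.letter k l i - hidMean ε C k i) ≤
      energyCapacity W cmax R (harvest a δ k θ) := by
  have hw := weight_pos hε k
  have hp := isAdmissible_wordDensity C hε hε' hl hc
  -- The real supremum needs an upper bound; the trivial correlation bound 2^k suffices.
  refine le_csSup ⟨a + δ / weight ε k * ((2 ^ k) * hidMass ε k -
    ∑ i ∈ Finset.range (2 ^ k), θ i * hidMean ε C k i), ?_⟩ ⟨_, hp, hword k l hl, ?_⟩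
  · rintro _ ⟨p, hp, hRp, rfl⟩
    refine integral_mul_harvest_le C hε hε' hcon hp hRp a hδ k θ fun j _ => ?_
    calc ∑ i ∈ Finset.range (2 ^ k), θ i * C.letter k j i
        ≤ ∑ i ∈ Finset.range (2 ^ k), (1 : ℝ) := Finset.sum_le_sum fun i _ => by
          refine (le_abs_self _).trans ?_
          rw [abs_mul]
          exact mul_le_one₀ (hθ i) (abs_nonneg _) (C.abs_letter_le k j i)
      _ = 2 ^ k := by simp
  · rw [hp.integral_mul_harvest, integral_fold (A := fun y => wordDensity ε C k l y * haarSum k θ y)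
      ((isBddMeasurable_wordDensity C k l).mul (isBddMeasurable_haarSum k θ)),
      ← integral_wordDensity_mul_haarSum C hε hε' hl]
    field_simp

include hε hε' hcon hword in
/-- The energy capacity separates the words of the code from words uncorrelated with the code. -/
theorem energyCapacity_separation (hc : 1 + 3 * ε ≤ cmax) (a : ℝ) {δ : ℝ} (hδ : 0 ≤ δ) {k : ℕ}
    (hsize : 11 ≤ C.size k) {d : ℕ → ℕ → ℝ}
    (hdiag : ∀ l < C.size k, ∑ i ∈ Finset.range (2 ^ k), C.letter k l i * C.letter k l i = 2 ^ k)
    (hoff : ∀ l < C.size k, ∀ j < C.size k, j ≠ l →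
      |∑ i ∈ Finset.range (2 ^ k), C.letter k l i * C.letter k j i| ≤ 2 ^ k / 4)
    (hcross : ∀ l < C.size k, ∀ j < C.size k,
      |∑ i ∈ Finset.range (2 ^ k), d l i * C.letter k j i| ≤ 2 ^ k / 4) :
    ∃ v₁ v₂ : ℝ, v₁ - v₂ = δ * ε / 32 ∧
      (∀ l < C.size k, v₁ ≤ energyCapacity W cmax R (harvest a δ k (C.letter k l))) ∧
      ∀ l < C.size k, energyCapacity W cmax R (harvest a δ k (d l)) ≤ v₂ := by
  have hw := weight_pos hε k
  have hm := hidMass_pos hε k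
  have hN : (0 : ℝ) < 2 ^ k := by positivity
  -- In units of 2^k times the hidden mass, a code word gets at least 1 - 1/4 - 1/8 = 5/8: its
  -- self-correlation, less the correlations with other words and the share of its own cell. An
  -- uncorrelated word gets at most 1/4 + 1/4 = 1/2.
  refine ⟨a + δ / weight ε k * (5 / 8 * 2 ^ k * hidMass ε k),
    a + δ / weight ε k * (1 / 2 * 2 ^ k * hidMass ε k), ?_, fun l hl => ?_, fun l hl => ?_⟩
  · have hm' := hm.ne'
    unfold weight
    field_simp
    ring
  · refine le_trans ?_ (le_energyCapacity_harvest C hε hε' hcon hword hc a hδ hl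
      fun i => C.abs_letter_le k l i)
    have h1 := sum_mul_hidMean_le C hε hε' hl (C.letter k l) (B := 2 ^ k / 4) (B' := 2 ^ k)
      (by positivity) hN.le (fun j hj hne => (le_abs_self _).trans (hoff l hl j hj hne))
      (hdiag l hl).le
    -- The ratio to the hidden mass is 4/(3 `size`), which is at most 1/8 from size 11 on.
    have h2 : top ε k * cellLength ε C k ≤ hidMass ε k / 8 := by
      have hs : (11 : ℝ) ≤ C.size k := by exact_mod_cast hsize
      have ht := top_pos hε k
      unfold cellLength hidMass
      rw [mul_div_assoc', div_le_iff₀ (by positivity)]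
      nlinarith [sq_nonneg (top ε k)]
    have h3 : ∑ i ∈ Finset.range (2 ^ k), C.letter k l i *
        (hidMass ε k * C.letter k l i - hidMean ε C k i) =
        hidMass ε k * 2 ^ k - ∑ i ∈ Finset.range (2 ^ k), C.letter k l i * hidMean ε C k i := by
      rw [← hdiag l hl, Finset.mul_sum, ← Finset.sum_sub_distrib]
      exact Finset.sum_congr rfl fun i _ => by ring
    rw [h3]
    have h4 := mul_le_mul_of_nonneg_left h2 hN.le
    gcongr
    linarith
  · refine (energyCapacity_harvest_le C hε hε' hcon hword hc a hδ k (d l) (B := 2 ^ k / 4)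
      fun j hj => (le_abs_self _).trans (hcross l hl j hj)).trans ?_
    have h1 := neg_sum_mul_hidMean_le C hε hε' k (d l) fun j hj => hcross l hl j hj
    gcongr
    linarith

end EnergyCapacity

/-! ### Splitting a large code into two indistinguishable families -/

section Words

/-- The sequence of signs of a word, extended by zero. -/
noncomputable def wordSeq {N : ℕ} (x : Fin N → Bool) (i : ℕ) : ℝ :=
  if h : i < N then boolSign (x ⟨i, h⟩) else 0

theorem abs_wordSeq_le {N : ℕ} (x : Fin N → Bool) (i : ℕ) : |wordSeq x i| ≤ 1 := by
  unfold wordSeq boolSign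
  split_ifs <;> simp

theorem sum_wordSeq_mul {N : ℕ} (x y : Fin N → Bool) :
    ∑ i ∈ Finset.range N, wordSeq x i * wordSeq y i = ∑ i, boolSign (x i) * boolSign (y i) := by
  rw [Finset.sum_range]
  refine Finset.sum_congr rfl fun i _ => ?_
  simp [wordSeq]

/-- Two families of words such that the first is a code uncorrelated with the second, and the
mixtures of the Gaussian laws shifted by the two families are close for all sample sizes `m < n`. -/
theorem exists_words {N M n : ℕ} {v : ℝ≥0} (hv : v ≠ 0) (a : ℝ) (hN : 0 < N)
    (hM : 4 * (M : ℝ) < Real.exp (N / 32)) (hn : 16 * n * Real.exp (N / 64) ≤ M)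
    (s : ∀ m, (Fin N → Bool) → Fin m → ℝ)
    (hs : ∀ m < n, ∀ x, (∑ i, s m x i ^ 2) / v ≤ (N : ℝ) / 64) :
    ∃ c d : Fin M → Fin N → Bool,
      (∀ l j, j ≠ l → |∑ i, boolSign (c l i) * boolSign (c j i)| ≤ (N : ℝ) / 4) ∧
      (∀ l j, |∑ i, boolSign (d l i) * boolSign (c j i)| ≤ (N : ℝ) / 4) ∧
      ∀ m < n, ∫ y, (∑ l, (shiftLikelihood v a (s m (c l)) y -
        shiftLikelihood v a (s m (d l)) y)) ^ 2 ∂(Measure.pi fun _ : Fin m => gaussianReal a v) ≤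
        (M : ℝ) ^ 2 / 4 := by
  -- One nearly orthogonal family of 2M words, arranged in pairs: the signs chosen next send one
  -- word of each pair to `c` and its partner to `d`.
  obtain ⟨D, hD⟩ := exists_code (ι := Fin M × Bool) hN (by
    rw [Fintype.card_prod, Fintype.card_fin, Fintype.card_bool]
    push_cast
    linarith)
  have hL : ∀ l b m, MemLp (shiftLikelihood v a (s m (D (l, b)))) 2
      (Measure.pi fun _ : Fin m => gaussianReal a v) := fun l b m => memLp_shiftLikelihood hv a _
  -- The signs are chosen for the sum over all sample sizes below n, because one code has to serve
  -- them all; each summand is then bounded by the total.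
  obtain ⟨e, he⟩ := exists_signs_sum_integral_sq_le (Finset.univ : Finset (Fin M))
    (Finset.range n) (fun m => Measure.pi fun _ : Fin m => gaussianReal a v)
    (fun l m y => shiftLikelihood v a (s m (D (l, true))) y -
      shiftLikelihood v a (s m (D (l, false))) y)
    fun l m => (hL l true m).sub (hL l false m)
  refine ⟨fun l => D (l, e l), fun l => D (l, !e l), fun l j hne => hD _ _ fun h => hne ?_,
    fun l j => hD _ _ fun h => ?_, fun m hm => ?_⟩
  · exact (Prod.ext_iff.1 h).1.symm
  · obtain ⟨h1, h2⟩ := Prod.ext_iff.1 h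
    simp only at h1 h2
    subst h1
    simp at h2
  · have hsingle : ∀ l : Fin M, ∀ m ∈ Finset.range n,
        ∫ y, (shiftLikelihood v a (s m (D (l, true))) y -
          shiftLikelihood v a (s m (D (l, false))) y) ^ 2
          ∂(Measure.pi fun _ : Fin m => gaussianReal a v) ≤ 4 * Real.exp (N / 64) := by
      intro l m hm
      have h := integral_add_sq_add_integral_sub_sq (hL l true m) (hL l false m)
      rw [integral_shiftLikelihood_sq hv, integral_shiftLikelihood_sq hv] at h
      have h1 := Real.exp_le_exp.2 (hs m (Finset.mem_range.1 hm) (D (l, true)))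
      have h2 := Real.exp_le_exp.2 (hs m (Finset.mem_range.1 hm) (D (l, false)))
      have h3 : 0 ≤ ∫ y, (shiftLikelihood v a (s m (D (l, true))) y +
          shiftLikelihood v a (s m (D (l, false))) y) ^ 2
          ∂(Measure.pi fun _ : Fin m => gaussianReal a v) := integral_nonneg fun y => sq_nonneg _
      linarith
    have htot := he.trans (Finset.sum_le_sum fun l _ => Finset.sum_le_sum (hsingle l))
    simp only [Finset.sum_const, Finset.card_univ, Fintype.card_fin, Finset.card_range,
      nsmul_eq_mul] at htot
    have hterm := (Finset.single_le_sum (f := fun m => ∫ y, (∑ l, boolSign (e l) *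
      (shiftLikelihood v a (s m (D (l, true))) y - shiftLikelihood v a (s m (D (l, false))) y)) ^ 2
        ∂(Measure.pi fun _ : Fin m => gaussianReal a v))
      (fun m _ => integral_nonneg fun y => sq_nonneg _) (Finset.mem_range.2 hm)).trans htot
    have hpt : ∀ y, ∑ l, (shiftLikelihood v a (s m (D (l, e l))) y -
        shiftLikelihood v a (s m (D (l, !e l))) y) = ∑ l, boolSign (e l) *
        (shiftLikelihood v a (s m (D (l, true))) y - shiftLikelihood v a (s m (D (l, false))) y) :=
      fun y => Finset.sum_congr rfl fun l _ => by
        rcases e l <;> simp [boolSign]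
    simp_rw [hpt]
    -- The total is at most 4 n M exp(N/64), which the assumed lower bound on M puts below M²/4.
    refine hterm.trans ?_
    have hM0 : (0 : ℝ) ≤ M := Nat.cast_nonneg M
    nlinarith

end Words

/-! ### Choice of the code size at each level -/

section Samples

/-- The mean of the samples of `harvest a δ k θ`, minus `a`. -/
noncomputable def gridShift (δ : ℝ) (k : ℕ) (θ : ℕ → ℝ) (m : ℕ) (i : Fin m) : ℝ :=
  δ * haarSum k θ (fold (gridPoint m i))

theorem sampleLaw_harvest {σ : ℝ≥0} (hσ : 0 < σ) (m : ℕ) (a δ : ℝ) (k : ℕ) (θ : ℕ → ℝ) :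
    sampleLaw σ m (harvest a δ k θ) =
      (Measure.pi fun _ : Fin m => gaussianReal a (σ ^ 2)).withDensity
        fun y => ENNReal.ofReal (shiftLikelihood (σ ^ 2) a (gridShift δ k θ m) y) :=
  pi_gaussianReal_shift (pow_pos hσ 2).ne' a _

theorem sum_gridShift_sq_le (δ : ℝ) (k : ℕ) {θ : ℕ → ℝ} (hθ : ∀ i, |θ i| ≤ 1) (m : ℕ) :
    ∑ i, gridShift δ k θ m i ^ 2 ≤ m * δ ^ 2 := by
  have h : ∀ i, gridShift δ k θ m i ^ 2 ≤ δ ^ 2 := fun i => by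
    rw [gridShift, mul_pow]
    exact mul_le_of_le_one_right (sq_nonneg _) ((sq_le_one_iff_abs_le_one _).2
      (abs_haarSum_le k zero_le_one (fun i _ => hθ i) _))
  calc ∑ i, gridShift δ k θ m i ^ 2 ≤ ∑ _i : Fin m, δ ^ 2 := Finset.sum_le_sum fun i _ => h i
    _ = m * δ ^ 2 := by simp

/-- The code must exceed the number of sample sizes by an exponential factor and still fit below
exp(2^k/32). Since 8^k is only a cube of 2^k, the exponential wins. -/
theorem eventually_code_size (α : ℝ) :
    ∀ᶠ k : ℕ in atTop, 64 * (α * 8 ^ k + 1) + 4 < Real.exp (2 ^ k / 64) := by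
  have h1 : Tendsto (fun x : ℝ => (64 * (α * (64 * x) ^ 3 + 1) + 4) * Real.exp (-x)) atTop
      (𝓝 0) := by
    have h3 := (Real.tendsto_pow_mul_exp_neg_atTop_nhds_zero 3).const_mul (64 * α * 64 ^ 3)
    have h0 := (Real.tendsto_pow_mul_exp_neg_atTop_nhds_zero 0).const_mul 68
    have h := h3.add h0
    simp only [mul_zero, add_zero] at h
    refine h.congr fun x => ?_
    ring
  have h2 : Tendsto (fun k : ℕ => (2 : ℝ) ^ k / 64) atTop atTop :=
    (tendsto_pow_atTop_atTop_of_one_lt one_lt_two).atTop_div_const (by norm_num)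
  filter_upwards [(h1.comp h2).eventually (gt_mem_nhds one_pos)] with k hk
  simp only [Function.comp_apply] at hk
  rw [Real.exp_neg, ← div_eq_mul_inv, div_lt_one (Real.exp_pos _)] at hk
  have : (64 * ((2 : ℝ) ^ k / 64)) ^ 3 = 8 ^ k := by
    rw [mul_div_cancel₀ _ (by norm_num : (64 : ℝ) ≠ 0), ← pow_mul, mul_comm, pow_mul]
    norm_num
  rwa [this] at hk

/-- Two families of words as in `exists_words`, for the samples of the harvesting functions of level
`k`. -/
theorem exists_harvest_words {σ : ℝ≥0} (hσ : 0 < σ) (a δ : ℝ) {α : ℝ} (hα : 0 ≤ α) (k : ℕ)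
    (hk : 64 * (α * 8 ^ k + 1) + 4 < Real.exp (2 ^ k / 64))
    (hδ : α * 8 ^ k * δ ^ 2 / σ ^ 2 ≤ 2 ^ k / 64) :
    ∃ (M : ℕ) (c d : ℕ → ℕ → ℝ), 11 ≤ M ∧ M ≤ 2 ^ 2 ^ k ∧
      (∀ l i, |c l i| ≤ 1) ∧ (∀ l i, |d l i| ≤ 1) ∧
      (∀ l < M, ∑ i ∈ Finset.range (2 ^ k), c l i * c l i = 2 ^ k) ∧
      (∀ l < M, ∀ j < M, j ≠ l → |∑ i ∈ Finset.range (2 ^ k), c l i * c j i| ≤ 2 ^ k / 4) ∧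
      (∀ l < M, ∀ j < M, |∑ i ∈ Finset.range (2 ^ k), d l i * c j i| ≤ 2 ^ k / 4) ∧
      ∀ m : ℕ, (m : ℝ) ≤ α * 8 ^ k →
        ∫ y, (∑ l : Fin M, (shiftLikelihood (σ ^ 2) a (gridShift δ k (c l) m) y -
          shiftLikelihood (σ ^ 2) a (gridShift δ k (d l) m) y)) ^ 2
          ∂(Measure.pi fun _ : Fin m => gaussianReal a (σ ^ 2)) ≤ (M : ℝ) ^ 2 / 4 := by
  have hα8 : 0 ≤ α * 8 ^ k := by positivity
  set E := Real.exp ((2 : ℝ) ^ k / 64) with hE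
  have hE1 : 1 ≤ E := Real.one_le_exp (by positivity)
  have hEE : Real.exp ((2 : ℝ) ^ k / 32) = E * E := by
    rw [hE, ← Real.exp_add]
    ring_nf
  -- The smallest size that makes the mixtures close; `hk` ensures that a nearly orthogonal family
  -- of 2M words still exists.
  set M := ⌈16 * (α * 8 ^ k + 1) * E⌉₊ with hMdef
  have hMle : 16 * (α * 8 ^ k + 1) * E ≤ M := Nat.le_ceil _
  have hMlt : (M : ℝ) < 16 * (α * 8 ^ k + 1) * E + 1 := Nat.ceil_lt_add_one (by positivity)
  have hM4 : 4 * (M : ℝ) < E * E := by nlinarith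
  have hM11 : 11 ≤ M := by
    have : (11 : ℝ) ≤ M := by nlinarith
    exact_mod_cast this
  have hM2 : M ≤ 2 ^ 2 ^ k := by
    have h1 : Real.exp ((2 : ℝ) ^ k / 32) ≤ 2 ^ 2 ^ k := by
      have h2 : Real.exp (1 / 32) ≤ 2 := by
        have := Real.exp_one_lt_d9
        have h3 : Real.exp (1 / 32) ^ 32 = Real.exp 1 := by
          rw [← Real.exp_nat_mul]
          norm_num
        by_contra! h
        have h4 : (2 : ℝ) ^ 32 < Real.exp (1 / 32) ^ 32 := by gcongr
        norm_num at h4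
        linarith
      calc Real.exp ((2 : ℝ) ^ k / 32) = Real.exp (1 / 32) ^ 2 ^ k := by
            rw [← Real.exp_nat_mul]
            push_cast
            ring_nf
        _ ≤ 2 ^ 2 ^ k := by gcongr
    have : (M : ℝ) ≤ 2 ^ 2 ^ k := by
      have hM0 : (0 : ℝ) ≤ M := Nat.cast_nonneg M
      linarith
    exact_mod_cast this
  have hcast : ((2 ^ k : ℕ) : ℝ) = 2 ^ k := by push_cast; rfl
  obtain ⟨c, d, hoff, hcross, hclose⟩ := exists_words (N := 2 ^ k) (M := M)
    (n := ⌊α * 8 ^ k⌋₊ + 1) (v := σ ^ 2) (pow_pos hσ 2).ne' a (by positivity)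
    (by rw [hcast, hEE]; exact hM4)
    (by
      rw [hcast]
      push_cast
      have := Nat.floor_le hα8
      refine le_trans ?_ hMle
      gcongr)
    (fun m x => gridShift δ k (wordSeq x) m) (by
      intro m hm x
      rw [hcast]
      refine le_trans ?_ hδ
      have hm' : (m : ℝ) ≤ α * 8 ^ k :=
        (Nat.le_floor_iff hα8).1 (Nat.lt_succ_iff.1 hm)
      push_cast
      have := sum_gridShift_sq_le δ k (abs_wordSeq_le x) m
      gcongr
      exact this.trans (by gcongr))
  have hM0 : 0 < M := by omega
  rw [hcast] at hoff hcross
  -- Out-of-range indices repeat the first word, so that the bound on the letters holds for all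
  -- indices.
  let w : (Fin M → Fin (2 ^ k) → Bool) → ℕ → ℕ → ℝ :=
    fun c l => wordSeq (c (if h : l < M then ⟨l, h⟩ else ⟨0, hM0⟩))
  have hw : ∀ c l, ∀ h : l < M, w c l = wordSeq (c ⟨l, h⟩) := fun c l h => by simp [w, h]
  refine ⟨M, w c, w d, hM11, hM2, fun l i => abs_wordSeq_le _ _, fun l i => abs_wordSeq_le _ _,
    fun l hl => ?_, fun l hl j hj hne => ?_, fun l hl j hj => ?_, fun m hm => ?_⟩
  · rw [hw c l hl, sum_wordSeq_mul]
    simp [← sq, boolSign_sq]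
  · rw [hw c l hl, hw c j hj, sum_wordSeq_mul]
    exact hoff _ _ fun h => hne (Fin.ext_iff.1 h)
  · rw [hw c j hj, hw d l hl, sum_wordSeq_mul]
    exact hcross _ _
  · have h := hclose m (Nat.lt_succ_iff.2 (Nat.le_floor hm))
    have hc' : ∀ c, ∀ l : Fin M, w c l = wordSeq (c l) := fun c l => hw c l l.2
    simp_rw [hc']
    exact h

end Samples

/-! ### From separated energies to the worst-case loss -/

section LowerBound

theorem le_worstCaseEnergyLoss {W : Kernel unitInterval (ℕ × ℝ)} {R : ℝ≥0} {cmax : ℝ} {K σ : ℝ≥0}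
    (hσ : 0 < σ) {δ : ℝ} (hδ : 0 ≤ δ) {k : ℕ} (hK : 16 * 2 ^ k * δ ≤ K) {M : ℕ} (hM : 0 < M)
    {c d : ℕ → ℕ → ℝ} (hc1 : ∀ l i, |c l i| ≤ 1) (hd1 : ∀ l i, |d l i| ≤ 1) {m : ℕ}
    (hclose : ∫ y, (∑ l : Fin M, (shiftLikelihood (σ ^ 2) K (gridShift δ k (c l) m) y -
      shiftLikelihood (σ ^ 2) K (gridShift δ k (d l) m) y)) ^ 2
      ∂(Measure.pi fun _ : Fin m => gaussianReal K (σ ^ 2)) ≤ (M : ℝ) ^ 2 / 4)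
    {v₁ v₂ : ℝ} (hv : v₂ ≤ v₁)
    (hv₁ : ∀ l < M, v₁ ≤ energyCapacity W cmax R (harvest K δ k (c l)))
    (hv₂ : ∀ l < M, energyCapacity W cmax R (harvest K δ k (d l)) ≤ v₂)
    {βhat : (Fin m → ℝ) → unitInterval → ℝ} (hβ : IsReconstruction W cmax R m βhat) :
    ENNReal.ofReal ((v₁ - v₂) / 4) ≤
      worstCaseEnergyLoss W cmax R σ m {β | β ∈ BV K ∧ ∀ x, 0 ≤ β x} βhat := by
  have hσ2 : (σ ^ 2 : ℝ≥0) ≠ 0 := (pow_pos hσ 2).ne'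
  have hmem : ∀ θ : ℕ → ℝ, (∀ i, |θ i| ≤ 1) →
      harvest K δ k θ ∈ {β | β ∈ BV K ∧ ∀ x, 0 ≤ β x} := fun θ hθ => by
    -- The base level K dominates the oscillation, because the variation bound already forces δ ≤
    -- K/16.
    refine ⟨harvest_mem_BV hδ k hK hθ, fun x => ?_⟩
    have h1 := (abs_le.1 (abs_harvest_sub_le (a := K) hδ k hθ x)).1
    have h2 : (1 : ℝ) ≤ 2 ^ k := one_le_pow₀ one_le_two
    nlinarith
  have hS : ∀ θ : ℕ → ℝ, (∀ i, |θ i| ≤ 1) →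
      ∫⁻ y, ENNReal.ofReal |energyCapacity W cmax R (harvest K δ k θ) -
        energyCapacity W cmax R (βhat y)|
        ∂((Measure.pi fun _ : Fin m => gaussianReal K (σ ^ 2)).withDensity
          fun y => ENNReal.ofReal (shiftLikelihood (σ ^ 2) K (gridShift δ k θ m) y)) ≤
      worstCaseEnergyLoss W cmax R σ m {β | β ∈ BV K ∧ ∀ x, 0 ≤ β x} βhat := fun θ hθ => by
    rw [← sampleLaw_harvest hσ]
    exact le_iSup₂ (f := fun β (_ : β ∈ {β | β ∈ BV K ∧ ∀ x, 0 ≤ β x}) =>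
      expectedEnergyLoss W cmax R σ m β βhat) _ (hmem θ hθ)
  exact le_of_close_mixtures (Measure.pi fun _ : Fin m => gaussianReal K (σ ^ 2)) hM
    (fun l => shiftLikelihood (σ ^ 2) K (gridShift δ k (c l) m))
    (fun l => shiftLikelihood (σ ^ 2) K (gridShift δ k (d l) m))
    (fun l y => (shiftLikelihood_pos _ _ _ _).le) (fun l y => (shiftLikelihood_pos _ _ _ _).le)
    (fun l => (continuous_shiftLikelihood _ _ _).measurable)
    (fun l => (continuous_shiftLikelihood _ _ _).measurable)
    (fun l => memLp_shiftLikelihood hσ2 _ _) (fun l => memLp_shiftLikelihood hσ2 _ _)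
    (fun l => integral_shiftLikelihood hσ2 _ _) hclose _ hβ.measurable_energy
    (fun l => energyCapacity W cmax R (harvest K δ k (c l)))
    (fun l => energyCapacity W cmax R (harvest K δ k (d l))) v₁ v₂ hv
    (fun l => hv₁ l l.2) (fun l => hv₂ l l.2) _ (fun l => hS _ (hc1 l)) (fun l => hS _ (hd1 l))

/-- Every large `m` lies between consecutive terms of `α 8 ^ k`. -/
theorem eventually_exists_level {α : ℝ} (hα : 0 < α) (k₀ : ℕ) :
    ∀ᶠ m : ℕ in atTop, ∃ k ≥ k₀, (m : ℝ) ≤ α * 8 ^ k ∧ α * 8 ^ k < 8 * m := by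
  filter_upwards [(tendsto_natCast_atTop_atTop (R := ℝ)).eventually_gt_atTop (α * 8 ^ k₀)]
    with m hm
  have hex : ∃ k : ℕ, (m : ℝ) ≤ α * 8 ^ k := by
    obtain ⟨k, hk⟩ := pow_unbounded_of_one_lt ((m : ℝ) / α) (by norm_num : (1 : ℝ) < 8)
    exact ⟨k, by rw [div_lt_iff₀ hα] at hk; linarith⟩
  classical
  have hlt : k₀ < Nat.find hex := by
    rw [Nat.lt_find_iff]
    intro j hj hmj
    have : (8 : ℝ) ^ j ≤ 8 ^ k₀ := pow_le_pow_right₀ (by norm_num) hj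
    nlinarith
  refine ⟨Nat.find hex, hlt.le, Nat.find_spec hex, ?_⟩
  obtain ⟨j, hj⟩ := Nat.exists_eq_succ_of_ne_zero (by omega : Nat.find hex ≠ 0)
  have h := Nat.find_min hex (m := j) (by omega)
  rw [hj, pow_succ]
  linarith [not_le.1 h]

/-- As the sample size is within a factor 8 = 2³ of α 8^k, its cube root is within a factor 2 of
that of the level. -/
theorem rpow_le_of_level {α : ℝ} (hα : 0 < α) {k m : ℕ} (h : α * 8 ^ k < 8 * m) :
    α ^ (1 / 3 : ℝ) * (m : ℝ) ^ (-(1 / 3 : ℝ)) ≤ 2 / 2 ^ k := by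
  have hm : (0 : ℝ) < m := by
    have : 0 < α * 8 ^ k := by positivity
    linarith
  have h1 : α / m ≤ (2 / 2 ^ k) ^ 3 := by
    rw [div_pow, ← pow_mul, mul_comm k, pow_mul, div_le_div_iff₀ hm (by positivity)]
    norm_num
    linarith
  rw [Real.rpow_neg hm.le, ← div_eq_mul_inv, ← Real.div_rpow hα.le hm.le]
  calc (α / m) ^ (1 / 3 : ℝ) ≤ ((2 / 2 ^ k : ℝ) ^ 3) ^ (1 / 3 : ℝ) := by gcongr
    _ = 2 / 2 ^ k := by
      rw [← Real.rpow_natCast, ← Real.rpow_mul (by positivity)]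
      norm_num

end LowerBound

end SIET

/-! ### Assembly of the levels and constants -/

theorem theorem4 (K σ : ℝ≥0) (cmax : ℝ) (hK : 0 < K) (hσ : 0 < σ) (hcmax : 1 < cmax) :
    ∃ (𝒴 : Type) (_ : MeasurableSpace 𝒴) (_ : StandardBorelSpace 𝒴)
      (W : Kernel unitInterval 𝒴) (_ : IsMarkovKernel W) (R : ℝ≥0),
      (R : ℝ≥0∞) = SIET.capacity W cmax ∧
      ∃ c : ℝ, 0 < c ∧ ∀ᶠ m : ℕ in atTop,
        ∀ βhat : (Fin m → ℝ) → unitInterval → ℝ,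
          SIET.IsReconstruction W cmax R m βhat →
          ENNReal.ofReal (c * (m : ℝ) ^ (-(1 / 3 : ℝ))) ≤
            SIET.worstCaseEnergyLoss W cmax R σ m
              {β | β ∈ SIET.BV K ∧ ∀ x, 0 ≤ β x} βhat := by
  have hK' : (0 : ℝ) < K := hK
  have hσ' : (0 : ℝ) < σ := hσ
  -- With the largest amplitude δ that the variation allows, this α makes α 8^k δ²/σ² equal to
  -- 2^k/64, the largest signal for which the mixtures stay close.
  set α : ℝ := 4 * σ ^ 2 / K ^ 2 with hαdef
  have hα : 0 < α := by positivity
  set δ : ℕ → ℝ := fun k => K / (16 * 2 ^ k) with hδdef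
  have hδ : ∀ k, 0 < δ k := fun k => by simp only [hδdef]; positivity
  -- The word densities reach up to 1 + 3ε, which must not exceed `cmax`.
  set ε : ℝ := min (1 / 2) ((cmax - 1) / 3) with hεdef
  have hε : 0 < ε := lt_min (by norm_num) (by linarith)
  have hε' : ε ≤ 1 / 2 := min_le_left _ _
  have hc : 1 + 3 * ε ≤ cmax := by linarith [min_le_right (1 / 2 : ℝ) ((cmax - 1) / 3)]
  have hδ2 : ∀ k, α * 8 ^ k * δ k ^ 2 / σ ^ 2 ≤ 2 ^ k / 64 := by
    intro k
    have h8 : (8 : ℝ) ^ k = 2 ^ k * 2 ^ k * 2 ^ k := by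
      rw [← mul_pow, ← mul_pow]
      norm_num
    refine le_of_eq ?_
    simp only [hαdef, hδdef, h8]
    field_simp
    norm_num
  obtain ⟨k₀, hk₀⟩ := eventually_atTop.1 (SIET.eventually_code_size α)
  have hlevel : ∀ k, ∃ (M : ℕ) (c d : ℕ → ℕ → ℝ), 0 < M ∧ M ≤ 2 ^ 2 ^ k ∧
      (∀ l i, |c l i| ≤ 1) ∧ (k₀ ≤ k → 11 ≤ M ∧ (∀ l i, |d l i| ≤ 1) ∧
      (∀ l < M, ∑ i ∈ Finset.range (2 ^ k), c l i * c l i = 2 ^ k) ∧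
      (∀ l < M, ∀ j < M, j ≠ l → |∑ i ∈ Finset.range (2 ^ k), c l i * c j i| ≤ 2 ^ k / 4) ∧
      (∀ l < M, ∀ j < M, |∑ i ∈ Finset.range (2 ^ k), d l i * c j i| ≤ 2 ^ k / 4) ∧
      ∀ m : ℕ, (m : ℝ) ≤ α * 8 ^ k →
        ∫ y, (∑ l : Fin M, (SIET.shiftLikelihood (σ ^ 2) K (SIET.gridShift (δ k) k (c l) m) y -
          SIET.shiftLikelihood (σ ^ 2) K (SIET.gridShift (δ k) k (d l) m) y)) ^ 2
          ∂(Measure.pi fun _ : Fin m => gaussianReal K (σ ^ 2)) ≤ (M : ℝ) ^ 2 / 4) := by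
    intro k
    by_cases hk : k₀ ≤ k
    · obtain ⟨M, c, d, h1, h2, h3, h4⟩ :=
        SIET.exists_harvest_words hσ K (δ k) hα.le k (hk₀ k hk) (hδ2 k)
      exact ⟨M, c, d, by omega, h2, h3, fun _ => ⟨h1, h4⟩⟩
    -- Small levels get a dummy code with a single zero word; the lower bound never uses them.
    · exact ⟨1, 0, 0, one_pos, Nat.one_le_two_pow, by simp, fun h => absurd h hk⟩
  choose M c d hM hM2 hc1 hgood using hlevel
  let C : SIET.CodeSequence := ⟨M, c, hM, hM2, hc1⟩
  obtain ⟨W, hW, R, hR, hcon, hword⟩ := SIET.exists_channel_of_code C hε hε' hc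
  -- A quarter of the gap δε/32 is Kε/(2048·2^k), that is Kε/4096 times the 2/2^k of
  -- `rpow_le_of_level`.
  refine ⟨ℕ × ℝ, inferInstance, inferInstance, W, hW, R, hR,
    K * ε / 4096 * α ^ (1 / 3 : ℝ), by positivity, ?_⟩
  filter_upwards [SIET.eventually_exists_level hα k₀] with m hm βhat hβ
  obtain ⟨k, hk, hmk, hkm⟩ := hm
  obtain ⟨h11, hd1, hdiag, hoff, hcross, hclose⟩ := hgood k hk
  obtain ⟨v₁, v₂, hv, hv₁, hv₂⟩ := SIET.energyCapacity_separation C hε hε' hcon hword hc K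
    (hδ k).le (k := k) h11 (d := d k) hdiag hoff hcross
  have hpos : 0 < δ k * ε / 32 := by have := hδ k; positivity
  refine le_trans (ENNReal.ofReal_le_ofReal ?_) (SIET.le_worstCaseEnergyLoss hσ (hδ k).le (k := k)
    (by simp only [hδdef]; field_simp; exact le_rfl) (hM k) (hc1 k) hd1 (hclose m hmk)
    (by linarith) hv₁ hv₂ hβ)
  rw [hv, mul_assoc]
  have h := mul_le_mul_of_nonneg_left (SIET.rpow_le_of_level hα hkm)
    (by positivity : 0 ≤ K * ε / 4096)
  refine h.trans (le_of_eq ?_)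
  simp only [hδdef]
  field_simp
  norm_num
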